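/- **Setting.** Fix $j_0,N,L\in\mathbb N$ and write $S_{j,k}=2^{-j}[k-L+1,k+L)\cap[0,1)$. Let $\varphi_{j,k},\psi_{j,k}$ ($j\ge j_0$, $0\le k<2^j$) be a compactly supported wavelet basis of $L^2([0,1])$ (for example the Cohen–Daubechies–Vial basis, where $L=N$, or the Haar basis, where $L=N=1$), that is: for each $i\ge j_0$ the functions $\varphi_{i,k}$ and $\psi_{j,k}$, $j\ge i$, form an orthonormal basis; $\varphi_{j,k},\psi_{j,k}$ vanish off $S_{j,k}$; the $\psi_{j,k}$ have $N$ vanishing moments; $\int\varphi_{i,k}=2^{-i/2}$ for $L\le k<2^i-L$; for $i>j$, $\varphi_{j,k}$ and $\psi_{j,k}$ are orthogonal to every $\varphi_{i,l}$ with $2^{-i}l\notin S_{j,k}$; and, for some $C$ and some $\gamma>\frac12$, every $g=\varphi_{j,k}$ or $\psi_{j,k}$ satisfies $|g|\le C2^{j/2}$ and $|g(x)-g(y)|\le C2^{j/2}2^{-\gamma(i-j)}$ for $x,y\in S_{i,l}$, $i\ge j$. Functions $f\in L^2([0,1])$ have coefficients $\alpha_{j,k}=\int f\varphi_{j,k}$,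 $\beta_{j,k}=\int f\psi_{j,k}$ and are identified on $[0,1)$ with the pointwise sum of their wavelet series. **Classes.** For $I\subseteq[0,1]$, $C^s(M,I)$ is the set of $f\in L^2([0,1])$ with $2^{j_0(s+1/2)}|\alpha_{j_0,k}|\le M$ if $S_{j_0,k}\subseteq I$ and $2^{j(s+1/2)}|\beta_{j,k}|\le M$ if $j\ge j_0$, $S_{j,k}\subseteq I$. For $p<\infty$, $B^r_{p,\infty}(M)$ is the set of $f\in L^2([0,1])$ with $2^{j_0(r+1/2-1/p)}\|(\alpha_{j_0,k})_k\|_{\ell^p}\le M$ and $2^{j(r+1/2-1/p)}\|(\beta_{j,k})_k\|_{\ell^p}\le M$ for all $j\ge j_0$; $B^r_{\infty,\infty}(M)=C^r(M,[0,1])$. $D^s_t(M,I)$ is the set of $f\in C^s(M,I)$ such that for all $j\ge\lceil j_0/t\rceil$ and $k$ with $S_{j,k}\cap I\ne\emptyset$ there are $\lfloor tj\rfloor\le j'<j$ and $k'$ with $S_{j',k'}\supseteq S_{j,k}$ and $|\beta_{j',k'}|\ge (j'/j)2^{(j-j')(s+1/2)}|\beta_{j,k}|$. Put $\mathcal F=B^r_{p,\infty}(M)\cap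 D^s_t(M,I)$. **Algorithm.** One observes $Y_n=f(x_n)+\varepsilon_n$, $\varepsilon_n$ i.i.d. $N(0,\sigma^2)$, $\sigma>0$ known, where each $x_n$ is chosen from the past (and possibly independent randomisation). Fix $\kappa>1$, $\lambda>0$, stage sizes $n_0<n_1<\cdots$ with $n_0$ a power of two and $n_{m}/n_{m-1}$ bounded away from $1$ and $\infty$, and levels $j_n^{\max}>j_0$ with $2^{j_n^{\max}}\asymp n/\log n$. Let $\xi_n=\{x_1,\dots,x_n\}$ and let $Y(x)$ be the observation at $x\in\xi_n$. Let $i_n(j,k)=\max\{i>j: S_{j,k}\cap2^{-i}\mathbb Z\subseteq\xi_n\}$, $e_n(j,k)=\sigma2^{-i_n(j,k)/2}\sqrt{2\log n}$. With $i=i_n(j,k)$ let $\hat\beta_{j,k}=\sum_{l}2^{-i/2}Y(2^{-i}l)\int\varphi_{i,l}\psi_{j,k}$; define $\hat\alpha_{j_0,k}$ likewise with $i=i_n(j_0,k)$ and $\varphi_{j_0,k}$ in place of $\psi_{j,k}$ (both are $0$ if $i$ does not exist). Let $\hat\beta^T_{j,k}=\hat\beta_{j,k}1(|\hat\beta_{j,k}|\ge\kappa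 e_n(j,k))$ and $$\hat f_n=\sum_k\hat\alpha_{j_0,k}\varphi_{j_0,k}+\sum_{j=j_0}^{j_n^{\max}-1}\sum_k\hat\beta^T_{j,k}\psi_{j,k}.$$ The first $n_0$ points are $(i-1)/n_0$. In stage $m\ge1$ put $J=j^{\max}_{n_m}$, $J'=j^{\max}_{n_{m-1}}$, $I_l=2^{-J}[l,l+1)$ for $0\le l<2^J$; rank, for each $j_0\le j<J'$, the $|\hat\beta^T_{j,k}|$ at time $n_{m-1}$ in decreasing order, with ranks $r_j(k)\in\{1,\dots,2^j\}$; let $$p_l=\max\Big(\{\lambda\}\cup\Big\{\tfrac{2^j}{r_j(k)J'^2}: j_0\le j<J',\ I_l\subseteq S_{j,k},\ \hat\beta^T_{j,k}\ne0\Big\}\Big),\qquad q_{l,n}=n^{-1}\max\{2^i:2^{-i}\mathbb Z\cap I_l\subseteq\xi_n\}.$$ First add all points of $2^{-J}\mathbb Z\cap[0,1)$ not yet in the design; then, repeatedly, choose $l$ maximising $p_l/q_{l,n}$ and add, one by one, the points of $2^{-i}\mathbb Z\cap I_l\setminus\xi_n$ for the smallest $i$ for which this set is non-empty; stop when there are $n_m$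 design points. Ties and orders are arbitrary. **Theorem.** Let $p\in[1,\infty]$, $r\in[\frac12+\frac1p,N)$, $s\in[r-\frac1p,N)$, $t\in(0,1)$, $M>0$, and let $I\subseteq[0,1]$ be an interval. Put $\alpha(s)=s/(2s+1)$, $u=\max(r-s,0)$, $r'=s+tu$, $s'=s/(1-ptu)$ (where $ptu=0$ if $p=\infty$), and $$c_n=\big(n/\log(n)^3\big)^{-\alpha(\min(r',s'))}\,\log(n)^{1(r'=s')}.$$ Then $\sup_{x\in I\cap[0,1)}|\hat f_n(x)-f(x)|=O_p(c_n)$ as $n\to\infty$, uniformly over $f\in\mathcal F$ (and over all ways of resolving the ties), where, in the case $r'>s'$ only, $f$ is also required to satisfy $|\beta_{j,k}|\le M2^{-j(s+1/2)}$ for those $S_{j,k}$ that meet $I$ without being contained in it. That is: for every $\eta>0$ there are $K$ and $n_1$ such that, for all $n\ge n_1$ and all such $f$, the supremum exceeds $Kc_n$ with probability at most $\eta$. -/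

import Mathlib

open MeasureTheory ProbabilityTheory Set Filter Asymptotics
open scoped ENNReal Topology

noncomputable section

/-! ### Dyadic geometry and wavelet bases -/

/-- The support interval `S_{j,k} = 2^{-j} [k - L + 1, k + L) ∩ [0, 1)`. -/
def suppInterval (L j k : ℕ) : Set ℝ :=
  Ico (((k : ℝ) - L + 1) / 2 ^ j) (((k : ℝ) + L) / 2 ^ j) ∩ Ico 0 1

/-- The dyadic grid `2^{-i} ℤ`. -/
def dyadicGrid (i : ℕ) : Set ℝ := {y | ∃ k : ℤ, y = (k : ℝ) / 2 ^ i}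

/-- The dyadic cell `2^{-J} [l, l + 1)`. -/
def dyadicCell (J l : ℕ) : Set ℝ := Ico ((l : ℝ) / 2 ^ J) (((l : ℝ) + 1) / 2 ^ J)

/-- The inner product `∫ f g` of `L²([0,1])`. -/
def innerL2 (f g : ℝ → ℝ) : ℝ := ∫ x in Ico (0 : ℝ) 1, f x * g x

/-- A compactly supported orthonormal wavelet basis of `L²([0,1])` with coarsest level `j₀`,
`N` vanishing moments and support parameter `L` (scaling functions `φ j k`, wavelets `ψ j k`,
`j ≥ j₀`, `0 ≤ k < 2^j`), as given by the Cohen–Daubechies–Vial construction, with `L = N`, or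
by the Haar basis, with `N = L = 1`.  Values of `φ`, `ψ` at other indices play no role. -/
structure WaveletBasis (j₀ N L : ℕ) where
  φ : ℕ → ℕ → ℝ → ℝ
  ψ : ℕ → ℕ → ℝ → ℝ
  measurable_φ : ∀ j k, j₀ ≤ j → k < 2 ^ j → Measurable (φ j k)
  measurable_ψ : ∀ j k, j₀ ≤ j → k < 2 ^ j → Measurable (ψ j k)
  /-- supports -/
  φ_eq_zero : ∀ j k, j₀ ≤ j → k < 2 ^ j → ∀ x, x ∉ suppInterval L j k → φ j k x = 0
  ψ_eq_zero : ∀ j k, j₀ ≤ j → k < 2 ^ j → ∀ x, x ∉ suppInterval L j k → ψ j k x = 0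
  /-- `φ_{i,·}` together with `ψ_{j,·}`, `j ≥ i`, is orthonormal, for every `i ≥ j₀` -/
  φ_φ : ∀ i k k', j₀ ≤ i → k < 2 ^ i → k' < 2 ^ i →
    innerL2 (φ i k) (φ i k') = if k = k' then 1 else 0
  φ_ψ : ∀ i j k k', j₀ ≤ i → i ≤ j → k < 2 ^ i → k' < 2 ^ j → innerL2 (φ i k) (ψ j k') = 0
  ψ_ψ : ∀ j j' k k', j₀ ≤ j → j₀ ≤ j' → k < 2 ^ j → k' < 2 ^ j' →
    innerL2 (ψ j k) (ψ j' k') = if j = j' ∧ k = k' then 1 else 0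
  /-- and this family is complete in `L²([0,1])` -/
  complete : ∀ i, j₀ ≤ i → ∀ g : ℝ → ℝ, MemLp g 2 (volume.restrict (Ico (0 : ℝ) 1)) →
    (∀ k < 2 ^ i, innerL2 g (φ i k) = 0) →
    (∀ j k, i ≤ j → k < 2 ^ j → innerL2 g (ψ j k) = 0) →
    g =ᵐ[volume.restrict (Ico (0 : ℝ) 1)] 0
  /-- vanishing moments -/
  moments : ∀ j k, j₀ ≤ j → k < 2 ^ j → ∀ a < N, innerL2 (fun x => x ^ a) (ψ j k) = 0
  /-- normalisation of the scaling functions that are not adapted to an end point of `[0,1]` -/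
  integral_φ : ∀ i k, j₀ ≤ i → L ≤ k → k + L < 2 ^ i →
    ∫ x in Ico (0 : ℝ) 1, φ i k x = (2 : ℝ) ^ (-(i : ℝ) / 2)
  /-- finite refinement filters: at a finer level `i`, the functions `φ_{j,k}` and `ψ_{j,k}` only
  involve those `φ_{i,l}` whose grid point `2^{-i} l` lies in `S_{j,k}` -/
  filter_φ : ∀ i j k l : ℕ, j₀ ≤ j → j < i → k < 2 ^ j → l < 2 ^ i →
    (l : ℝ) / 2 ^ i ∉ suppInterval L j k → innerL2 (φ i l) (φ j k) = 0
  filter_ψ : ∀ i j k l : ℕ, j₀ ≤ j → j < i → k < 2 ^ j → l < 2 ^ i →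
    (l : ℝ) / 2 ^ i ∉ suppInterval L j k → innerL2 (φ i l) (ψ j k) = 0
  /-- dilation scaling: uniformly bounded and Hölder of some order `> 1/2` after rescaling.  The
  Hölder bound is written as an oscillation bound on the intervals `S_{i,l}`; for `L ≥ 2` it is
  Hölder continuity on `[0,1)`, for `L = 1` it is the dyadic version satisfied by the Haar basis. -/
  regular : ∃ γ > (1 / 2 : ℝ), ∃ C : ℝ, ∀ j k, j₀ ≤ j → k < 2 ^ j →
    (∀ x, |φ j k x| ≤ C * (2 : ℝ) ^ ((j : ℝ) / 2) ∧ |ψ j k x| ≤ C * (2 : ℝ) ^ ((j : ℝ) / 2)) ∧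
    ∀ i l, j ≤ i → l < 2 ^ i → ∀ x ∈ suppInterval L i l, ∀ y ∈ suppInterval L i l,
      |φ j k x - φ j k y| ≤ C * (2 : ℝ) ^ ((j : ℝ) / 2) * (2 : ℝ) ^ (γ * ((j : ℝ) - i)) ∧
      |ψ j k x - ψ j k y| ≤ C * (2 : ℝ) ^ ((j : ℝ) / 2) * (2 : ℝ) ^ (γ * ((j : ℝ) - i))

namespace WaveletBasis

variable {j₀ N L : ℕ}

/-- Scaling coefficients `α_{j,k}` of `f`. -/
def coeffα (W : WaveletBasis j₀ N L) (f : ℝ → ℝ) (j k : ℕ) : ℝ := innerL2 f (W.φ j k)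

/-- Wavelet coefficients `β_{j,k}` of `f`. -/
def coeffβ (W : WaveletBasis j₀ N L) (f : ℝ → ℝ) (j k : ℕ) : ℝ := innerL2 f (W.ψ j k)

/-- `f` is, at every point of `[0,1)`, the sum of its wavelet series: this singles out the
representative of an element of `L²([0,1])` whose point values are observed and estimated. -/
def IsSumOfSeries (W : WaveletBasis j₀ N L) (f : ℝ → ℝ) : Prop :=
  ∀ x ∈ Ico (0 : ℝ) 1,
    HasSum (fun a : ℕ => ∑ k ∈ Finset.range (2 ^ (j₀ + a)),
        W.coeffβ f (j₀ + a) k * W.ψ (j₀ + a) k x)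
      (f x - ∑ k ∈ Finset.range (2 ^ j₀), W.coeffα f j₀ k * W.φ j₀ k x)

/-! ### Function classes -/

/-- The local Hölder class `C^s(M, I)`. -/
def holderClass (W : WaveletBasis j₀ N L) (s M : ℝ) (I : Set ℝ) : Set (ℝ → ℝ) :=
  {f | MemLp f 2 (volume.restrict (Ico (0 : ℝ) 1)) ∧
    (∀ k < 2 ^ j₀, suppInterval L j₀ k ⊆ I →
      (2 : ℝ) ^ ((j₀ : ℝ) * (s + 1 / 2)) * |W.coeffα f j₀ k| ≤ M) ∧
    ∀ j k, j₀ ≤ j → k < 2 ^ j → suppInterval L j k ⊆ I →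
      (2 : ℝ) ^ ((j : ℝ) * (s + 1 / 2)) * |W.coeffβ f j k| ≤ M}

/-- The Besov class `B^r_{p,∞}(M)`, with `B^r_{∞,∞}(M) = C^r(M)`. -/
def besovClass (W : WaveletBasis j₀ N L) (r : ℝ) (p : ℝ≥0∞) (M : ℝ) : Set (ℝ → ℝ) :=
  if p = ⊤ then W.holderClass r M (Icc 0 1) else
  {f | MemLp f 2 (volume.restrict (Ico (0 : ℝ) 1)) ∧
    (2 : ℝ) ^ ((j₀ : ℝ) * (r + 1 / 2 - 1 / p.toReal)) *
      (∑ k ∈ Finset.range (2 ^ j₀), |W.coeffα f j₀ k| ^ p.toReal) ^ (1 / p.toReal) ≤ M ∧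
    ∀ j, j₀ ≤ j → (2 : ℝ) ^ ((j : ℝ) * (r + 1 / 2 - 1 / p.toReal)) *
      (∑ k ∈ Finset.range (2 ^ j), |W.coeffβ f j k| ^ p.toReal) ^ (1 / p.toReal) ≤ M}

/-- The detectable class `D^s_t(M, I)`. -/
def detectableClass (W : WaveletBasis j₀ N L) (s t M : ℝ) (I : Set ℝ) : Set (ℝ → ℝ) :=
  {f | f ∈ W.holderClass s M I ∧
    ∀ j k, ⌈(j₀ : ℝ) / t⌉₊ ≤ j → k < 2 ^ j → (suppInterval L j k ∩ I).Nonempty →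
      ∃ j' k', ⌊t * (j : ℝ)⌋₊ ≤ j' ∧ j' < j ∧ k' < 2 ^ j' ∧
        suppInterval L j k ⊆ suppInterval L j' k' ∧
        ((j' : ℝ) / j) * (2 : ℝ) ^ (((j : ℝ) - j') * (s + 1 / 2)) * |W.coeffβ f j k| ≤
          |W.coeffβ f j' k'|}

/-- The class `𝓕(p, r, s, t, M, I)` of sparse and detectable functions. -/
def sparseDetectable (W : WaveletBasis j₀ N L) (p : ℝ≥0∞) (r s t M : ℝ) (I : Set ℝ) :
    Set (ℝ → ℝ) :=
  W.besovClass r p M ∩ W.detectableClass s t M I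

/-- The bound `|β_{j,k}| ≤ M 2^{-j(s+1/2)}` for all `S_{j,k}` that meet `I`, including those that
stick out of `I`. -/
def EdgeBound (W : WaveletBasis j₀ N L) (s M : ℝ) (I : Set ℝ) (f : ℝ → ℝ) : Prop :=
  ∀ j k, j₀ ≤ j → k < 2 ^ j → (suppInterval L j k ∩ I).Nonempty →
    (2 : ℝ) ^ ((j : ℝ) * (s + 1 / 2)) * |W.coeffβ f j k| ≤ M

end WaveletBasis

/-! ### The algorithm

Design points and observations are indexed from `0`: the first `n` of them are `x 0, …, x (n-1)`
and `Y 0, …, Y (n-1)`. -/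

/-- The choices made by the user of the algorithm: noise level `σ`, threshold `κ > 1`, density
floor `lam > 0`, stage sizes `n_m = size m` and maximal resolution levels `jmax n`. -/
structure Tuning (j₀ : ℕ) where
  σ : ℝ
  κ : ℝ
  lam : ℝ
  size : ℕ → ℕ
  jmax : ℕ → ℕ
  σ_pos : 0 < σ
  one_lt_κ : 1 < κ
  lam_pos : 0 < lam
  size_zero : ∃ a : ℕ, size 0 = 2 ^ a
  size_ratio : ∃ C D : ℝ, 1 < C ∧
    ∀ m, C * size m ≤ size (m + 1) ∧ (size (m + 1) : ℝ) ≤ D * size m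
  lt_jmax : ∀ n, j₀ < jmax n
  jmax_order : (fun n : ℕ => (2 : ℝ) ^ jmax n) =Θ[atTop] fun n : ℕ => (n : ℝ) / Real.log n

/-- The design `ξ_n`, the set of the first `n` design points. -/
def design (x : ℕ → ℝ) (n : ℕ) : Set ℝ := x '' Iio n

/-- The observation `Y(y)` made at the point `y` among the first `n` (design points are distinct;
the value is `0` if `y` is not in the design). -/
def obsAt (x Y : ℕ → ℝ) (n : ℕ) (y : ℝ) : ℝ :=
  ∑ i ∈ Finset.range n, if x i = y then Y i else 0

/-- The index `i_n(j,k)`; it is at most `j` (namely `0`) iff no admissible index exists. -/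
def obsLevel (L : ℕ) (x : ℕ → ℝ) (n j k : ℕ) : ℕ :=
  sSup {i | j < i ∧ suppInterval L j k ∩ dyadicGrid i ⊆ design x n}

/-- The noise bound `e_n(j,k)`. -/
def noiseBound (L : ℕ) (σ : ℝ) (x : ℕ → ℝ) (n j k : ℕ) : ℝ :=
  σ * (2 : ℝ) ^ (-(obsLevel L x n j k : ℝ) / 2) * √(2 * Real.log n)

namespace WaveletBasis

variable {j₀ N L : ℕ}

/-- The projected estimate on level `i`, `∑_l α̂^i_{i,l} φ_{i,l}` with
`α̂^i_{i,l} = 2^{-i/2} Y(2^{-i} l)`, tested against `g`.  By orthonormality, `g = φ_{j₀,k}` and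
`g = ψ_{j,k}` give its wavelet coefficients `α̂^i_{j₀,k}` and `β̂^i_{j,k}`. -/
def levelEst (W : WaveletBasis j₀ N L) (x Y : ℕ → ℝ) (n i : ℕ) (g : ℝ → ℝ) : ℝ :=
  ∑ l ∈ Finset.range (2 ^ i),
    (2 : ℝ) ^ (-(i : ℝ) / 2) * obsAt x Y n ((l : ℝ) / 2 ^ i) * innerL2 (W.φ i l) g

/-- The estimate `α̂_{j₀,k}` (`0` if `i_n(j₀,k)` does not exist). -/
def alphaHat (W : WaveletBasis j₀ N L) (x Y : ℕ → ℝ) (n k : ℕ) : ℝ :=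
  if j₀ < obsLevel L x n j₀ k then W.levelEst x Y n (obsLevel L x n j₀ k) (W.φ j₀ k) else 0

/-- The estimate `β̂_{j,k}` (`0` if `i_n(j,k)` does not exist). -/
def betaHat (W : WaveletBasis j₀ N L) (x Y : ℕ → ℝ) (n j k : ℕ) : ℝ :=
  if j < obsLevel L x n j k then W.levelEst x Y n (obsLevel L x n j k) (W.ψ j k) else 0

/-- The hard-threshold estimate `β̂^T_{j,k}`. -/
def betaThr (W : WaveletBasis j₀ N L) (T : Tuning j₀) (x Y : ℕ → ℝ) (n j k : ℕ) : ℝ :=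
  if T.κ * noiseBound L T.σ x n j k ≤ |W.betaHat x Y n j k| then W.betaHat x Y n j k else 0

/-- The estimate `f̂_n` of the regression function. -/
def estimator (W : WaveletBasis j₀ N L) (T : Tuning j₀) (x Y : ℕ → ℝ) (n : ℕ) (z : ℝ) : ℝ :=
  ∑ k ∈ Finset.range (2 ^ j₀), W.alphaHat x Y n k * W.φ j₀ k z +
    ∑ j ∈ Finset.Ico j₀ (T.jmax n), ∑ k ∈ Finset.range (2 ^ j),
      W.betaThr T x Y n j k * W.ψ j k z

/-- The target density `p_{l,m+1}` on the cell `I_{l,m+1}`, computed from the first `n_m`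
observations and the rankings `rank j`.  The normalising constant `A` is omitted: the algorithm
depends on the densities only through the location of the maximum of `p / q`. -/
def targetDensity (W : WaveletBasis j₀ N L) (T : Tuning j₀) (x Y : ℕ → ℝ) (rank : ℕ → ℕ → ℕ)
    (m l : ℕ) : ℝ :=
  sSup ({T.lam} ∪ {y | ∃ j k, j₀ ≤ j ∧ j < T.jmax (T.size m) ∧ k < 2 ^ j ∧
    dyadicCell (T.jmax (T.size (m + 1))) l ⊆ suppInterval L j k ∧
    W.betaThr T x Y (T.size m) j k ≠ 0 ∧
    y = (2 : ℝ) ^ j / ((rank j k : ℝ) * (T.jmax (T.size m) : ℝ) ^ 2)})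

end WaveletBasis

/-- The effective density `q_{l,n}` on the cell `2^{-J}[l,l+1)` of a design `ξ` of `n` points. -/
def effectiveDensity (ξ : Set ℝ) (n J l : ℕ) : ℝ :=
  (2 : ℝ) ^ sSup {i : ℕ | dyadicGrid i ∩ dyadicCell J l ⊆ ξ} / n

/-- The points of `2^{-i}ℤ` in the cell `2^{-J}[l,l+1)` that are not yet in the design `ξ`. -/
def missingPoints (ξ : Set ℝ) (J l i : ℕ) : Set ℝ := (dyadicGrid i ∩ dyadicCell J l) \ ξ

/-- The smallest `i` for which some point of `2^{-i}ℤ` in the cell is missing. -/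
def nextLevel (ξ : Set ℝ) (J l : ℕ) : ℕ := sInf {i | (missingPoints ξ J l i).Nonempty}

/-- `rank` is a bijective ranking of `b 0, …, b (K-1)` by decreasing absolute value, from `1`. -/
def IsRanking (K : ℕ) (b : ℕ → ℝ) (rank : ℕ → ℕ) : Prop :=
  BijOn rank (Iio K) (Icc 1 K) ∧
    ∀ k < K, ∀ k' < K, rank k ≤ rank k' → |b k'| ≤ |b k|

/-- The design points `x` and the observations `Y` form a run of the spatially-adaptive sensing
algorithm.  Ties in the ranking, in the choice of the cell maximising `p / q`, and in the order in
which the points of a batch are selected, may be resolved in any way. -/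
def IsRun {j₀ N L : ℕ} (W : WaveletBasis j₀ N L) (T : Tuning j₀) (x Y : ℕ → ℝ) : Prop :=
  -- initial stage: uniform design
  (∀ i < T.size 0, x i = (i : ℝ) / T.size 0) ∧
  ∃ (rank : ℕ → ℕ → ℕ → ℕ) (cell : ℕ → ℕ), ∀ m,
    (∀ j, j₀ ≤ j → j < T.jmax (T.size m) →
      IsRanking (2 ^ j) (W.betaThr T x Y (T.size m) j) (rank m j)) ∧
    -- selection of the point `x n` in stage `m + 1`, given the points selected so far
    ∀ n, T.size m ≤ n → n < T.size (m + 1) →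
      -- first add the points of `2^{-J}ℤ ∩ [0,1)` that are not in the design
      (¬ dyadicGrid (T.jmax (T.size (m + 1))) ∩ Ico 0 1 ⊆ design x n →
        x n ∈ (dyadicGrid (T.jmax (T.size (m + 1))) ∩ Ico 0 1) \ design x n) ∧
      -- then refine a cell that maximises `p / q`
      (dyadicGrid (T.jmax (T.size (m + 1))) ∩ Ico 0 1 ⊆ design x n →
        cell n < 2 ^ T.jmax (T.size (m + 1)) ∧
        (∀ l < 2 ^ T.jmax (T.size (m + 1)),
          W.targetDensity T x Y (rank m) m l /
              effectiveDensity (design x n) n (T.jmax (T.size (m + 1))) l ≤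
            W.targetDensity T x Y (rank m) m (cell n) /
              effectiveDensity (design x n) n (T.jmax (T.size (m + 1))) (cell n)) ∧
        x n ∈ missingPoints (design x n) (T.jmax (T.size (m + 1))) (cell n)
          (nextLevel (design x n) (T.jmax (T.size (m + 1))) (cell n)) ∧
        -- and stay in that cell until the batch of missing points is exhausted
        (n + 1 < T.size (m + 1) →
          (missingPoints (design x (n + 1)) (T.jmax (T.size (m + 1))) (cell n)
            (nextLevel (design x n) (T.jmax (T.size (m + 1))) (cell n))).Nonempty →
          cell (n + 1) = cell n))

/-- The algorithm is run on the regression model `Y_n = f(x_n) + ε_n` with `ε_n` i.i.d.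
`N(0, σ²)`, the design being chosen sequentially.  Here `ℱ n` is the information available before
`x n` is observed; it contains the past, and the noise `ε n` is independent of it (so that the
`ε n` are independent of each other). -/
structure SensingExperiment {j₀ N L : ℕ} (W : WaveletBasis j₀ N L) (T : Tuning j₀) (f : ℝ → ℝ)
    {Ω : Type*} [mΩ : MeasurableSpace Ω] (μ : Measure Ω) (ε x Y : ℕ → Ω → ℝ)
    (ℱ : Filtration ℕ mΩ) : Prop where
  noise_law : ∀ n, μ.map (ε n) = gaussianReal 0 (T.σ ^ 2).toNNReal
  noise_adapted : ∀ n, Measurable[ℱ (n + 1)] (ε n)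
  noise_indep : ∀ n, Indep (MeasurableSpace.comap (ε n) inferInstance) (ℱ n) μ
  design_adapted : ∀ n, Measurable[ℱ n] (x n)
  observation : ∀ n ω, Y n ω = f (x n ω) + ε n ω
  run : ∀ ω, IsRun W T (fun n => x n ω) (fun n => Y n ω)

/-! ### The rate -/

/-- `α(s) = s / (2 s + 1)`. -/
def rateExp (s : ℝ) : ℝ := s / (2 * s + 1)

/-- `u = max (r - s) 0`. -/
def gapU (r s : ℝ) : ℝ := max (r - s) 0

/-- `r' = s + t u`. -/
def rPrime (r s t : ℝ) : ℝ := s + t * gapU r s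

/-- `s' = s / (1 - p t u)`.  For `p = ∞` one has `u = 0` in the theorem, and `p t u` is read as
`0`, which is what `(⊤ : ℝ≥0∞).toReal = 0` gives. -/
def sPrime (p : ℝ≥0∞) (r s t : ℝ) : ℝ := s / (1 - p.toReal * t * gapU r s)

/-- `c_n = (n / log(n)^3)^{-α(min(r', s'))} log(n)^{1(r' = s')}`. -/
def sensingRate (p : ℝ≥0∞) (r s t : ℝ) (n : ℕ) : ℝ :=
  ((n : ℝ) / Real.log n ^ 3) ^ (-rateExp (min (rPrime r s t) (sPrime p r s t))) *
    (if rPrime r s t = sPrime p r s t then Real.log n else 1)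

end

noncomputable section

/-! ### Expansions in scaling functions -/

/-! The probabilistic part is confined to one event; on it, the bound is deterministic. At finitely
many times, all level estimates of pure noise are below `κ` times their typical maximum, for a fixed
`κ` with `1 < κ < T.κ` (`measure_exists_noise_ge_le`). The weight given to an observation is a fixed
function of the design point, hence known before the noise is drawn, and the squared weights sum to
at most `2^{-i}` because design points are distinct. An exponential martingale gives the tail
`n^{-κ²}`, and a union bound over `O(n)` events suffices. Since `r ≥ 1/2 + 1/p`, `f` is dyadically
Hölder of order `1/2`, and replacing scaling coefficients by point values costs `O(2^{-i/2})`
(`exists_bias_bound`), which is smaller than the noise bound by a factor `√log n`. Thresholding then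
errs by at most a multiple of `min(|β|, e)`, and a coefficient well above its noise level is
detected (`exists_estimates`).

The target densities sum to `O(2^J)`, so always refining a cell with maximal `p/q` gives every cell
a density of order at least `p` (`grid_subset_design_of_selection`). The rank of a detected
coefficient is at most the number of comparable coefficients on its level, which the Besov norm
bounds. Hence after the next stage `e² (2^{j'(r+1/2)} |β_{j',k'}|)^p = O(log³ n / n)` for the noise
level `e` of every coefficient supported inside `S_{j',k'}` (`exists_adaptive_noiseBound`).

Detectability provides an ancestor on level at least about `t j` of comparable normalised size. If
it was detected, the previous bound controls `min(|β|, e)^{p+2}`. If not, it is itself below an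
earlier noise level and the argument is repeated for it. Two stages lower the level by the factor
`t`, so a number of stages independent of `n` leads to levels so coarse that the uniform noise bound
is enough (`Cascade.exists_bound`).

Finally put `w = log³ n / n`. The error on level `j` is, up to constants, at most each of `(w
2^j)^{1/2}`, `(j+1) 2^{-js}` and, if `u > 0`, `w^{1/(p+2)} 2^{j(1-pr')/(p+2)}`. For `u > 0` the sign
of `1 - p r'` is that of `r' - s'`, and it decides which two bounds are balanced; at equality all
levels contribute alike, which costs the extra logarithm (`exists_level_sum`). -/

theorem innerL2_comm (f g : ℝ → ℝ) : innerL2 f g = innerL2 g f := by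
  unfold innerL2; simp_rw [mul_comm]

theorem integrable_mul_of_bounded {f g : ℝ → ℝ} {μ : Measure ℝ} (hf : Integrable f μ)
    (hg : Measurable g) {B : ℝ} (hB : ∀ x, |g x| ≤ B) : Integrable (fun x => f x * g x) μ := by
  exact (hf.bdd_mul hg.aestronglyMeasurable (Eventually.of_forall hB)).congr
    (Eventually.of_forall fun x => mul_comm _ _)

theorem integrable_of_bounded {g : ℝ → ℝ} (hg : Measurable g) {B : ℝ} (hB : ∀ x, |g x| ≤ B) :
    Integrable g (volume.restrict (Ico (0 : ℝ) 1)) :=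
  Integrable.of_bound hg.aestronglyMeasurable B (Eventually.of_forall hB)

namespace WaveletBasis

variable {j₀ N L : ℕ}

theorem exists_regular (W : WaveletBasis j₀ N L) : ∃ γ > (1 / 2 : ℝ), ∃ C : ℝ, 1 ≤ C ∧
    ∀ j k, j₀ ≤ j → k < 2 ^ j →
    (∀ x, |W.φ j k x| ≤ C * (2 : ℝ) ^ ((j : ℝ) / 2) ∧ |W.ψ j k x| ≤ C * (2 : ℝ) ^ ((j : ℝ) / 2)) ∧
    ∀ i l, j ≤ i → l < 2 ^ i → ∀ x ∈ suppInterval L i l, ∀ y ∈ suppInterval L i l,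
      |W.φ j k x - W.φ j k y| ≤ C * (2 : ℝ) ^ ((j : ℝ) / 2) * (2 : ℝ) ^ (γ * ((j : ℝ) - i)) ∧
      |W.ψ j k x - W.ψ j k y| ≤
        C * (2 : ℝ) ^ ((j : ℝ) / 2) * (2 : ℝ) ^ (γ * ((j : ℝ) - i)) := by
  obtain ⟨γ, hγ, C, hC⟩ := W.regular
  refine ⟨γ, hγ, max C 1, le_max_right _ _, fun j k hj hk => ⟨fun x => ?_, ?_⟩⟩
  · obtain ⟨h1, h2⟩ := (hC j k hj hk).1 x
    have : C * (2 : ℝ) ^ ((j : ℝ) / 2) ≤ max C 1 * (2 : ℝ) ^ ((j : ℝ) / 2) := by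
      gcongr; exact le_max_left _ _
    exact ⟨h1.trans this, h2.trans this⟩
  · intro i l hi hl x hx y hy
    obtain ⟨h1, h2⟩ := (hC j k hj hk).2 i l hi hl x hx y hy
    have : C * (2 : ℝ) ^ ((j : ℝ) / 2) * (2 : ℝ) ^ (γ * ((j : ℝ) - i)) ≤
        max C 1 * (2 : ℝ) ^ ((j : ℝ) / 2) * (2 : ℝ) ^ (γ * ((j : ℝ) - i)) := by
      gcongr; exact le_max_left _ _
    exact ⟨h1.trans this, h2.trans this⟩

theorem exists_bound_φ (W : WaveletBasis j₀ N L) {j k : ℕ} (hj : j₀ ≤ j) (hk : k < 2 ^ j) :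
    ∃ B, ∀ x, |W.φ j k x| ≤ B := by
  obtain ⟨γ, -, C, -, hC⟩ := W.exists_regular
  exact ⟨_, fun x => ((hC j k hj hk).1 x).1⟩

theorem exists_bound_ψ (W : WaveletBasis j₀ N L) {j k : ℕ} (hj : j₀ ≤ j) (hk : k < 2 ^ j) :
    ∃ B, ∀ x, |W.ψ j k x| ≤ B := by
  obtain ⟨γ, -, C, -, hC⟩ := W.exists_regular
  exact ⟨_, fun x => ((hC j k hj hk).1 x).2⟩

theorem integrable_mul_φ (W : WaveletBasis j₀ N L) {j k : ℕ} (hj : j₀ ≤ j) (hk : k < 2 ^ j)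
    {f : ℝ → ℝ} (hf : Integrable f (volume.restrict (Ico (0 : ℝ) 1))) :
    Integrable (fun x => f x * W.φ j k x) (volume.restrict (Ico (0 : ℝ) 1)) := by
  obtain ⟨B, hB⟩ := W.exists_bound_φ hj hk
  exact integrable_mul_of_bounded hf (W.measurable_φ j k hj hk) hB

theorem integrable_φ (W : WaveletBasis j₀ N L) {j k : ℕ} (hj : j₀ ≤ j) (hk : k < 2 ^ j) :
    Integrable (W.φ j k) (volume.restrict (Ico (0 : ℝ) 1)) := by
  obtain ⟨B, hB⟩ := W.exists_bound_φ hj hk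
  exact integrable_of_bounded (W.measurable_φ j k hj hk) hB

/-- The residual is orthogonal to the scaling functions of level `i` by orthonormality, and to all
wavelets from level `i` on by `hort`, so completeness annihilates it. The functions `φ j k` and `ψ j
k` with `j < i` satisfy `hort`; this is how samples on level `i` reach coarser coefficients. -/
theorem ae_eq_sum_φ (W : WaveletBasis j₀ N L) {i : ℕ} (hi : j₀ ≤ i) {g : ℝ → ℝ}
    (hg : Measurable g) {B : ℝ} (hB : ∀ x, |g x| ≤ B)
    (hort : ∀ j k, i ≤ j → k < 2 ^ j → innerL2 g (W.ψ j k) = 0) :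
    g =ᵐ[volume.restrict (Ico (0 : ℝ) 1)]
      fun x => ∑ l ∈ Finset.range (2 ^ i), innerL2 (W.φ i l) g * W.φ i l x := by
  set h : ℝ → ℝ := fun x => g x - ∑ l ∈ Finset.range (2 ^ i), innerL2 (W.φ i l) g * W.φ i l x
    with hh
  have hgi := integrable_of_bounded hg hB
  have hmeas : Measurable h := hg.sub (Finset.measurable_fun_sum _ fun l hl =>
    (W.measurable_φ i l hi (Finset.mem_range.1 hl)).const_mul _)
  have hbd : ∃ B', ∀ x, |h x| ≤ B' := by
    have : ∀ l, ∃ B', l < 2 ^ i → ∀ x, |W.φ i l x| ≤ B' := fun l => by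
      by_cases hl : l < 2 ^ i
      · obtain ⟨b, hb⟩ := W.exists_bound_φ hi hl
        exact ⟨b, fun _ => hb⟩
      · exact ⟨0, fun h => absurd h hl⟩
    choose b hb using this
    refine ⟨B + ∑ l ∈ Finset.range (2 ^ i), |innerL2 (W.φ i l) g| * b l, fun x => ?_⟩
    refine (abs_sub _ _).trans (add_le_add (hB x) ((Finset.abs_sum_le_sum_abs _ _).trans
      (Finset.sum_le_sum fun l hl => ?_)))
    rw [abs_mul]
    exact mul_le_mul_of_nonneg_left (hb l (Finset.mem_range.1 hl) x) (abs_nonneg _)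
  obtain ⟨B', hB'⟩ := hbd
  have key : ∀ q : ℝ → ℝ, Measurable q → ∀ b, (∀ x, |q x| ≤ b) →
      innerL2 h q = innerL2 g q -
        ∑ l ∈ Finset.range (2 ^ i), innerL2 (W.φ i l) g * innerL2 (W.φ i l) q := by
    intro q hq b hb
    unfold innerL2
    have e : ∀ x, h x * q x = g x * q x - ∑ l ∈ Finset.range (2 ^ i),
        innerL2 (W.φ i l) g * (W.φ i l x * q x) := fun x => by
      rw [hh, sub_mul, Finset.sum_mul]; simp only [mul_assoc]
    simp_rw [e]
    have hI : ∀ l ∈ Finset.range (2 ^ i), Integrable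
        (fun x => innerL2 (W.φ i l) g * (W.φ i l x * q x)) (volume.restrict (Ico (0 : ℝ) 1)) :=
      fun l hl => (integrable_mul_of_bounded
        (W.integrable_φ hi (Finset.mem_range.1 hl)) hq hb).const_mul _
    rw [integral_sub (integrable_mul_of_bounded hgi hq hb) (integrable_finsetSum _ hI),
      integral_finsetSum _ hI]
    simp_rw [integral_const_mul]; rfl
  have h0 := W.complete i hi h (MemLp.of_bound hmeas.aestronglyMeasurable B'
    (Eventually.of_forall hB')) (fun k hk => ?_) (fun j k hj hk => ?_)
  · filter_upwards [h0] with x hx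
    simpa [hh, sub_eq_zero] using hx
  · obtain ⟨b, hb⟩ := W.exists_bound_φ hi hk
    rw [key _ (W.measurable_φ i k hi hk) b hb, Finset.sum_congr rfl fun l hl => by
      rw [W.φ_φ i l k hi (Finset.mem_range.1 hl) hk]]
    simp [hk, innerL2_comm]
  · obtain ⟨b, hb⟩ := W.exists_bound_ψ (hi.trans hj) hk
    rw [key _ (W.measurable_ψ j k (hi.trans hj) hk) b hb, hort j k hj hk,
      Finset.sum_eq_zero fun l hl => by
        rw [W.φ_ψ i j l k hi hj (Finset.mem_range.1 hl) hk, mul_zero]]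
    simp

theorem innerL2_eq_sum_φ (W : WaveletBasis j₀ N L) {i : ℕ} (hi : j₀ ≤ i) {g : ℝ → ℝ}
    (hg : Measurable g) {B : ℝ} (hB : ∀ x, |g x| ≤ B)
    (hort : ∀ j k, i ≤ j → k < 2 ^ j → innerL2 g (W.ψ j k) = 0) {f : ℝ → ℝ}
    (hf : Integrable f (volume.restrict (Ico (0 : ℝ) 1))) :
    innerL2 f g =
      ∑ l ∈ Finset.range (2 ^ i), innerL2 (W.φ i l) g * innerL2 f (W.φ i l) := by
  have h1 : innerL2 f g = ∫ x in Ico (0 : ℝ) 1, ∑ l ∈ Finset.range (2 ^ i),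
      innerL2 (W.φ i l) g * (f x * W.φ i l x) := by
    refine integral_congr_ae ?_
    filter_upwards [W.ae_eq_sum_φ hi hg hB hort] with x hx
    rw [hx, Finset.mul_sum]
    exact Finset.sum_congr rfl fun l _ => by ring
  rw [h1, integral_finsetSum _ fun l hl =>
    (W.integrable_mul_φ hi (Finset.mem_range.1 hl) hf).const_mul _]
  simp_rw [integral_const_mul]; rfl

/-- Parseval on the span of level `i`. It bounds both the sampling bias and the noise variance of a
coefficient, however many `φ i l` enter it. -/
theorem sum_sq_innerL2_φ (W : WaveletBasis j₀ N L) {i : ℕ} (hi : j₀ ≤ i) {g : ℝ → ℝ}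
    (hg : Measurable g) {B : ℝ} (hB : ∀ x, |g x| ≤ B)
    (hort : ∀ j k, i ≤ j → k < 2 ^ j → innerL2 g (W.ψ j k) = 0) :
    ∑ l ∈ Finset.range (2 ^ i), innerL2 (W.φ i l) g ^ 2 = innerL2 g g := by
  rw [W.innerL2_eq_sum_φ hi hg hB hort (integrable_of_bounded hg hB)]
  exact Finset.sum_congr rfl fun l _ => by rw [innerL2_comm g, sq]

end WaveletBasis

/-! ### Dyadic combinatorics -/

/-- At most `2 L` of the intervals `S_{j,k}` contain a given point. -/
theorem abs_sum_le_of_suppInterval {L j : ℕ} {z B : ℝ} (hB : 0 ≤ B) {a : ℕ → ℝ}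
    (h0 : ∀ k < 2 ^ j, z ∉ suppInterval L j k → a k = 0)
    (h1 : ∀ k < 2 ^ j, z ∈ suppInterval L j k → |a k| ≤ B) :
    |∑ k ∈ Finset.range (2 ^ j), a k| ≤ 2 * L * B := by
  classical
  set s := (Finset.range (2 ^ j)).filter fun k => z ∈ suppInterval L j k
  have hs : (s.card : ℝ) ≤ 2 * L := by
    have hsub : s ⊆ Finset.Ico (⌊z * 2 ^ j⌋₊ + 1 - L) (⌊z * 2 ^ j⌋₊ + L) := by
      intro k hk
      simp only [s, Finset.mem_filter, suppInterval, mem_inter_iff, mem_Ico] at hk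
      obtain ⟨-, ⟨h1, h2⟩, h3, -⟩ := hk
      rw [div_le_iff₀ (by positivity)] at h1
      rw [lt_div_iff₀ (by positivity)] at h2
      have hz : 0 ≤ z * 2 ^ j := by positivity
      have h4 : ⌊z * 2 ^ j⌋₊ < k + L := (Nat.floor_lt hz).2 (by push_cast; exact h2)
      have h5 : k + 1 ≤ ⌊z * 2 ^ j⌋₊ + L := by
        rw [← Nat.floor_add_natCast hz]
        exact Nat.le_floor (by push_cast; linarith)
      rw [Finset.mem_Ico]; omega
    have := Finset.card_le_card hsub
    rw [Nat.card_Ico] at this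
    have h2 : s.card ≤ 2 * L := by omega
    exact_mod_cast h2
  have e : ∑ k ∈ Finset.range (2 ^ j), a k = ∑ k ∈ s, a k := by
    refine (Finset.sum_subset (Finset.filter_subset _ _) fun k hk hks => ?_).symm
    refine h0 k (Finset.mem_range.1 hk) fun hz => hks ?_
    exact Finset.mem_filter.2 ⟨hk, hz⟩
  rw [e]
  calc |∑ k ∈ s, a k| ≤ ∑ k ∈ s, |a k| := Finset.abs_sum_le_sum_abs _ _
    _ ≤ ∑ k ∈ s, B := Finset.sum_le_sum fun k hk => by
        rw [Finset.mem_filter, Finset.mem_range] at hk; exact h1 k hk.1 hk.2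
    _ = s.card * B := by simp
    _ ≤ 2 * L * B := by gcongr

theorem cell_subset_suppInterval {L j k : ℕ} (hL : 1 ≤ L) (hk : k < 2 ^ j) :
    Ico ((k : ℝ) / 2 ^ j) ((k + 1) / 2 ^ j) ⊆ suppInterval L j k := by
  have hL' : (1 : ℝ) ≤ L := by exact_mod_cast hL
  have hk' : (k : ℝ) + 1 ≤ 2 ^ j := by exact_mod_cast hk
  intro x ⟨h1, h2⟩
  refine ⟨⟨le_trans (by gcongr; linarith) h1, h2.trans_le (by gcongr)⟩,
    le_trans (by positivity) h1, h2.trans_le ?_⟩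
  rw [div_le_one (by positivity)]; exact hk'

theorem left_mem_suppInterval {L j k : ℕ} (hL : 1 ≤ L) (hk : k < 2 ^ j) :
    (k : ℝ) / 2 ^ j ∈ suppInterval L j k :=
  cell_subset_suppInterval hL hk ⟨le_rfl, by gcongr; linarith⟩

/-- With `L = 0` all support intervals are empty, so `φ j₀ 0` would vanish although its norm is `1`.
-/
theorem WaveletBasis.one_le_L {j₀ N L : ℕ} (W : WaveletBasis j₀ N L) : 1 ≤ L := by
  by_contra h
  have hL : L = 0 := by omega
  have h1 := W.φ_φ j₀ 0 0 le_rfl (by positivity) (by positivity)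
  have : W.φ j₀ 0 = 0 := by
    ext x
    refine W.φ_eq_zero j₀ 0 le_rfl (by positivity) x fun hx => ?_
    have := hx.1
    simp [hL] at this
  simp [this, innerL2] at h1

/-- Two-sided geometric sums are bounded. -/
theorem sum_pow_dist_le {ρ : ℝ} (h0 : 0 ≤ ρ) (h1 : ρ < 1) (i n : ℕ) :
    ∑ j ∈ Finset.range n, ρ ^ Nat.dist j i ≤ 2 / (1 - ρ) := by
  classical
  have hle : ∀ m, ∑ j ∈ Finset.range m, ρ ^ j ≤ 1 / (1 - ρ) := fun m => by
    rw [le_div_iff₀ (by linarith), mul_comm, mul_neg_geom_sum]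
    linarith [pow_nonneg h0 m]
  have hsplit : ∀ m, ∑ j ∈ Finset.range (i + m), ρ ^ Nat.dist j i ≤ 2 / (1 - ρ) := by
    intro m
    rw [Finset.sum_range_add]
    have h2 : ∑ j ∈ Finset.range i, ρ ^ Nat.dist j i ≤ ρ * (1 / (1 - ρ)) := by
      rw [← Finset.sum_range_reflect]
      refine le_trans (le_of_eq ?_) (mul_le_mul_of_nonneg_left (hle i) h0)
      rw [Finset.mul_sum]
      refine Finset.sum_congr rfl fun j hj => ?_
      rw [Finset.mem_range] at hj
      rw [← pow_succ']; congr 1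
      simp [Nat.dist]; omega
    have h3 : ∑ j ∈ Finset.range m, ρ ^ Nat.dist (i + j) i ≤ 1 / (1 - ρ) := by
      refine le_trans (le_of_eq (Finset.sum_congr rfl fun j _ => ?_)) (hle m)
      congr 1; simp [Nat.dist]
    have h4 : ρ * (1 / (1 - ρ)) ≤ 1 * (1 / (1 - ρ)) := by
      gcongr; 
    have : 2 / (1 - ρ) = 1 * (1 / (1 - ρ)) + 1 / (1 - ρ) := by ring
    linarith
  refine le_trans ?_ (hsplit n)
  exact Finset.sum_le_sum_of_subset_of_nonneg (Finset.range_mono (by omega))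
    fun _ _ _ => pow_nonneg h0 _

/-! ### Pointwise bounds and the discretisation bias -/

/-- Meant for differences of wavelets at two points: only indices whose interval contains `x` or `y`
contribute, at most `2 L` for each point. -/
theorem abs_sum_le_of_two_suppInterval {L j : ℕ} {x y B : ℝ} (hB : 0 ≤ B) {a : ℕ → ℝ}
    (h0 : ∀ k < 2 ^ j, x ∉ suppInterval L j k → y ∉ suppInterval L j k → a k = 0)
    (h1 : ∀ k < 2 ^ j, |a k| ≤ B) :
    |∑ k ∈ Finset.range (2 ^ j), a k| ≤ 4 * L * B := by
  classical
  have e : ∑ k ∈ Finset.range (2 ^ j), a k =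
      ∑ k ∈ Finset.range (2 ^ j), (if x ∈ suppInterval L j k then a k else 0) +
      ∑ k ∈ Finset.range (2 ^ j), (if x ∈ suppInterval L j k then 0 else a k) := by
    rw [← Finset.sum_add_distrib]
    exact Finset.sum_congr rfl fun k _ => by split_ifs <;> simp
  have h2 := abs_sum_le_of_suppInterval (L := L) (j := j) (z := x) hB
    (a := fun k => if x ∈ suppInterval L j k then a k else 0)
    (fun k _ hx => by simp [hx]) (fun k hk hx => by simpa [hx] using h1 k hk)
  have h3 := abs_sum_le_of_suppInterval (L := L) (j := j) (z := y) hB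
    (a := fun k => if x ∈ suppInterval L j k then 0 else a k)
    (fun k hk hy => by
      by_cases hx : x ∈ suppInterval L j k
      · simp [hx]
      · simp [hx, h0 k hk hx hy])
    (fun k hk _ => by
      by_cases hx : x ∈ suppInterval L j k
      · simp [hx, hB]
      · simpa [hx] using h1 k hk)
  rw [e]
  exact (abs_add_le _ _).trans (by linarith)

theorem HasSum.abs_le_of_abs_sum_range_le {u : ℕ → ℝ} {X B : ℝ} (hu : HasSum u X)
    (h : ∀ n, |∑ a ∈ Finset.range n, u a| ≤ B) : |X| ≤ B :=
  le_of_tendsto hu.tendsto_sum_nat.abs (Eventually.of_forall h)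

theorem abs_setIntegral_le_of_suppInterval {L i l : ℕ} {h : ℝ → ℝ} {B : ℝ}
    (hB : 0 ≤ B) (h0 : ∀ x, x ∉ suppInterval L i l → h x = 0)
    (h1 : ∀ x ∈ suppInterval L i l, |h x| ≤ B) :
    |∫ x in Ico (0 : ℝ) 1, h x| ≤ B * (2 * L / 2 ^ i) := by
  have hS : MeasurableSet (suppInterval L i l) := measurableSet_Ico.inter measurableSet_Ico
  have hsub : suppInterval L i l ⊆ Ico 0 1 := inter_subset_right
  rw [setIntegral_eq_of_subset_of_forall_sdiff_eq_zero measurableSet_Ico hsub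
    fun x hx => h0 x hx.2]
  have hfin : volume (suppInterval L i l) < ⊤ :=
    (measure_mono hsub).trans_lt (by simp)
  have hvol : volume.real (suppInterval L i l) ≤ 2 * L / 2 ^ i := by
    have : volume.real (suppInterval L i l) ≤
        volume.real (Ico (((l : ℝ) - L + 1) / 2 ^ i) (((l : ℝ) + L) / 2 ^ i)) :=
      measureReal_mono inter_subset_left (by simp)
    refine this.trans ?_
    rw [Real.volume_real_Ico]
    refine max_le ?_ (by positivity)
    rw [← sub_div]; gcongr; linarith
  refine (norm_setIntegral_le_of_norm_le_const (f := h) hfin (C := B) h1).trans ?_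
  gcongr

namespace WaveletBasis

variable {j₀ N L : ℕ}

/-- A single coefficient is at most the `ℓ^p` norm of its level, and the assumption on `r` says that
the exponent `r + 1/2 - 1/p` is at least `1`. This crude decay is all that the bias estimate uses.
-/
theorem besovClass_bounds (W : WaveletBasis j₀ N L) {p : ℝ≥0∞} (hp : 1 ≤ p) {r M : ℝ}
    (hr : 1 / 2 + p⁻¹.toReal ≤ r) {f : ℝ → ℝ} (hf : f ∈ W.besovClass r p M) :
    MemLp f 2 (volume.restrict (Ico (0 : ℝ) 1)) ∧ (∀ k < 2 ^ j₀, |W.coeffα f j₀ k| ≤ M) ∧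
      ∀ j k, j₀ ≤ j → k < 2 ^ j → |W.coeffβ f j k| ≤ M * (2 : ℝ) ^ (-(j : ℝ)) := by
  have aux : ∀ (j : ℕ) (e X : ℝ), (j : ℝ) ≤ e → 0 ≤ X → (2 : ℝ) ^ e * X ≤ M →
      X ≤ M * (2 : ℝ) ^ (-(j : ℝ)) := by
    intro j e X hje hX h
    rw [Real.rpow_neg (by norm_num), ← div_eq_mul_inv, le_div_iff₀ (by positivity), mul_comm]
    refine le_trans ?_ h
    gcongr; norm_num
  have aux0 : ∀ (j : ℕ) (X : ℝ), 0 ≤ X → X ≤ M * (2 : ℝ) ^ (-(j : ℝ)) → X ≤ M := by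
    intro j X hX h
    have h1 : (2 : ℝ) ^ (-(j : ℝ)) ≤ 1 := Real.rpow_le_one_of_one_le_of_nonpos (by norm_num)
      (by simp)
    have h2 : (0 : ℝ) < (2 : ℝ) ^ (-(j : ℝ)) := by positivity
    have hM : 0 ≤ M := by
      by_contra hM
      have := mul_neg_of_neg_of_pos (not_le.1 hM) h2
      linarith
    exact h.trans (mul_le_of_le_one_right hM h1)
  by_cases htop : p = ⊤
  · subst htop
    simp only [besovClass, if_true, holderClass] at hf
    have hsub : ∀ j k, suppInterval L j k ⊆ Icc (0 : ℝ) 1 := fun j k =>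
      inter_subset_right.trans Ico_subset_Icc_self
    obtain ⟨h1, h2, h3⟩ := hf
    simp at hr
    have he : ∀ j : ℕ, (j : ℝ) ≤ j * (r + 1 / 2) := fun j =>
      le_mul_of_one_le_right (by positivity) (by norm_num at hr ⊢; linarith)
    exact ⟨h1, fun k hk => aux0 j₀ _ (abs_nonneg _)
      (aux j₀ _ _ (he j₀) (abs_nonneg _) (h2 k hk (hsub _ _))),
      fun j k hj hk => aux j _ _ (he j) (abs_nonneg _) (h3 j k hj hk (hsub _ _))⟩
  · simp only [besovClass, htop, if_false] at hf
    obtain ⟨h1, h2, h3⟩ := hf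
    have hP : 1 ≤ p.toReal := by
      rw [← ENNReal.toReal_one]; exact ENNReal.toReal_mono htop hp
    rw [ENNReal.toReal_inv, ← one_div] at hr
    have he : ∀ j : ℕ, (j : ℝ) ≤ j * (r + 1 / 2 - 1 / p.toReal) := fun j =>
      le_mul_of_one_le_right (by positivity) (by linarith)
    have single : ∀ (j k : ℕ) (a : ℕ → ℝ), k < 2 ^ j → |a k| ≤
        (∑ k ∈ Finset.range (2 ^ j), |a k| ^ p.toReal) ^ (1 / p.toReal) := by
      intro j k a hk
      have h4 : |a k| ^ p.toReal ≤ ∑ k ∈ Finset.range (2 ^ j), |a k| ^ p.toReal :=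
        Finset.single_le_sum (f := fun k => |a k| ^ p.toReal) (fun _ _ => by positivity)
          (Finset.mem_range.2 hk)
      calc |a k| = (|a k| ^ p.toReal) ^ (1 / p.toReal) := by
            rw [← Real.rpow_mul (abs_nonneg _), mul_one_div_cancel (by linarith), Real.rpow_one]
        _ ≤ _ := by gcongr
    refine ⟨h1, fun k hk => ?_, fun j k hj hk => ?_⟩
    · exact aux0 j₀ _ (abs_nonneg _) ((single j₀ k (W.coeffα f j₀) hk).trans
        (aux j₀ _ _ (he j₀) (by positivity) h2))
    · exact (single j k (W.coeffβ f j) hk).trans (aux j _ _ (he j) (by positivity) (h3 j hj))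

/-- Functions in the Besov class are bounded and Hölder of order `1/2` at dyadic scales. -/
theorem exists_oscillation_bound (W : WaveletBasis j₀ N L) {M : ℝ} (hM : 0 < M) :
    ∃ C : ℝ, 0 < C ∧ ∀ f : ℝ → ℝ, W.IsSumOfSeries f → (∀ k < 2 ^ j₀, |W.coeffα f j₀ k| ≤ M) →
      (∀ j k, j₀ ≤ j → k < 2 ^ j → |W.coeffβ f j k| ≤ M * (2 : ℝ) ^ (-(j : ℝ))) →
      (∀ z ∈ Ico (0 : ℝ) 1, |f z| ≤ C) ∧
      ∀ i l, j₀ ≤ i → l < 2 ^ i → ∀ x ∈ suppInterval L i l, ∀ y ∈ suppInterval L i l,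
        |f x - f y| ≤ C * (2 : ℝ) ^ (-(i : ℝ) / 2) := by
  obtain ⟨γ, hγ, C, hC1, hC⟩ := W.exists_regular
  -- With `|β| ≤ M 2^{-j}`, level `j` contributes `2^{-i/2} 2^{-(γ-1/2)(i-j)}` for `j ≤ i`, by
  -- regularity, and `2^{-i/2} 2^{-(j-i)/2}` for `j ≥ i`, by size; `δ` is the slower of the two
  -- decays. Its positivity is where `γ > 1/2` enters.
  set δ := min (1 / 2) (γ - 1 / 2) with hδ
  have hδ0 : 0 < δ := lt_min (by norm_num) (by linarith)
  set ρ : ℝ := (2 : ℝ) ^ (-δ) with hρ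
  have hρ0 : 0 < ρ := by positivity
  have hρ1 : ρ < 1 := Real.rpow_lt_one_of_one_lt_of_neg (by norm_num) (by linarith)
  set D : ℝ := (2 : ℝ) ^ ((j₀ : ℝ) / 2) with hD
  have hD1 : 1 ≤ D := Real.one_le_rpow (by norm_num) (by positivity)
  have hD0 : 0 < D := by positivity
  set K : ℝ := 8 * L * (M * C) * (2 / (1 - ρ)) + 4 * L * (M * (C * (D * D)))
    with hK
  have hC0 : 0 < C := by linarith
  have h1ρ : 0 < 1 - ρ := by linarith
  have hL : (1 : ℝ) ≤ L := by exact_mod_cast W.one_le_L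
  have hL0 : (0 : ℝ) < L := by linarith
  refine ⟨K, by positivity, fun f hf hα hβ => ⟨fun z hz => ?_, fun i l hi hl x hx y hy => ?_⟩⟩
  · have hlev : ∀ a, |∑ k ∈ Finset.range (2 ^ (j₀ + a)),
        W.coeffβ f (j₀ + a) k * W.ψ (j₀ + a) k z| ≤ 2 * L * (M * C * ρ ^ Nat.dist a 0) := by
      intro a
      refine abs_sum_le_of_suppInterval (z := z) (by positivity) (fun k hk hz => ?_) fun k hk _ => ?_
      · rw [W.ψ_eq_zero _ k (by omega) hk z hz, mul_zero]
      · rw [abs_mul]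
        have h1 := hβ (j₀ + a) k (by omega) hk
        have h2 := ((hC (j₀ + a) k (by omega) hk).1 z).2
        have h3 : (2 : ℝ) ^ (-((j₀ + a : ℕ) : ℝ)) * (2 : ℝ) ^ (((j₀ + a : ℕ) : ℝ) / 2) ≤
            ρ ^ Nat.dist a 0 := by
          rw [← Real.rpow_add (by norm_num), ← Real.rpow_natCast, hρ, ← Real.rpow_mul (by norm_num)]
          apply Real.rpow_le_rpow_of_exponent_le (by norm_num)
          have : δ ≤ 1 / 2 := min_le_left _ _
          simp [Nat.dist]
          nlinarith [Nat.cast_nonneg (α := ℝ) a, Nat.cast_nonneg (α := ℝ) j₀]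
        calc |W.coeffβ f (j₀ + a) k| * |W.ψ (j₀ + a) k z| ≤
            (M * (2 : ℝ) ^ (-((j₀ + a : ℕ) : ℝ))) *
              (C * (2 : ℝ) ^ (((j₀ + a : ℕ) : ℝ) / 2)) := by gcongr
          _ = M * C * ((2 : ℝ) ^ (-((j₀ + a : ℕ) : ℝ)) *
              (2 : ℝ) ^ (((j₀ + a : ℕ) : ℝ) / 2)) := by ring
          _ ≤ _ := by gcongr
    have h1 := (hf z hz).abs_le_of_abs_sum_range_le
      (B := 2 * L * (M * C) * (2 / (1 - ρ))) (fun n => by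
      refine (Finset.abs_sum_le_sum_abs _ _).trans
        ((Finset.sum_le_sum fun a _ => hlev a).trans ?_)
      rw [← Finset.mul_sum, ← Finset.mul_sum]
      have := sum_pow_dist_le hρ0.le hρ1 0 n
      calc _ ≤ 2 * L * (M * C * (2 / (1 - ρ))) := by gcongr
        _ = _ := by ring)
    have h2 : |∑ k ∈ Finset.range (2 ^ j₀), W.coeffα f j₀ k * W.φ j₀ k z| ≤
        2 * L * (M * (C * D)) := by
      refine abs_sum_le_of_suppInterval (z := z) (by positivity) (fun k hk hz => ?_) fun k hk _ => ?_
      · rw [W.φ_eq_zero _ k le_rfl hk z hz, mul_zero]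
      · rw [abs_mul]
        have h1 := hα k hk
        have h2 := ((hC j₀ k le_rfl hk).1 z).1
        gcongr
    have h3 : |f z| ≤ |f z - ∑ k ∈ Finset.range (2 ^ j₀), W.coeffα f j₀ k * W.φ j₀ k z| +
        |∑ k ∈ Finset.range (2 ^ j₀), W.coeffα f j₀ k * W.φ j₀ k z| := by
      rw [← sub_le_iff_le_add]
      exact abs_sub_abs_le_abs_sub _ _
    have h4 : 0 ≤ L * (M * C) * (2 / (1 - ρ)) := by positivity
    have h5 : L * (M * (C * D)) ≤ L * (M * (C * (D * D))) := by
      gcongr; nlinarith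
    have h6 : 0 ≤ L * (M * (C * D)) := by positivity
    rw [hK]; linarith
  · set q : ℝ := (2 : ℝ) ^ (-(i : ℝ) / 2) with hq
    have hq0 : 0 < q := by positivity
    have hlev : ∀ a, |∑ k ∈ Finset.range (2 ^ (j₀ + a)),
        W.coeffβ f (j₀ + a) k * (W.ψ (j₀ + a) k x - W.ψ (j₀ + a) k y)| ≤
          4 * L * (2 * (M * C) * q * ρ ^ Nat.dist a (i - j₀)) := by
      intro a
      refine abs_sum_le_of_two_suppInterval (x := x) (y := y) (by positivity)
        (fun k hk hx hy => ?_) fun k hk => ?_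
      · rw [W.ψ_eq_zero _ k (by omega) hk x hx, W.ψ_eq_zero _ k (by omega) hk y hy, sub_self,
          mul_zero]
      · rw [abs_mul]
        have h1 := hβ (j₀ + a) k (by omega) hk
        have h2 := hC (j₀ + a) k (by omega) hk
        have hq1 : q * ρ ^ Nat.dist a (i - j₀) =
            (2 : ℝ) ^ (-(i : ℝ) / 2 - δ * (Nat.dist a (i - j₀) : ℕ)) := by
          rw [← Real.rpow_natCast, hρ, ← Real.rpow_mul (by norm_num), hq,
            ← Real.rpow_add (by norm_num)]
          congr 1; ring
        rcases le_total (j₀ + a) i with hai | hai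
        · have h3 := (h2.2 i l hai hl x hx y hy).2
          have h4 : (2 : ℝ) ^ (-((j₀ + a : ℕ) : ℝ)) * ((2 : ℝ) ^ (((j₀ + a : ℕ) : ℝ) / 2) *
              (2 : ℝ) ^ (γ * (((j₀ + a : ℕ) : ℝ) - i))) ≤ q * ρ ^ Nat.dist a (i - j₀) := by
            rw [hq1, ← Real.rpow_add (by norm_num), ← Real.rpow_add (by norm_num)]
            apply Real.rpow_le_rpow_of_exponent_le (by norm_num)
            have hd : ((Nat.dist a (i - j₀) : ℕ) : ℝ) = (i : ℝ) - (j₀ + a : ℕ) := by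
              rw [Nat.dist, Nat.sub_eq_zero_of_le (by omega), zero_add,
                show i - j₀ - a = i - (j₀ + a) by omega, Nat.cast_sub hai]
            rw [hd]
            have h5 : δ ≤ γ - 1 / 2 := min_le_right _ _
            have h6 : (0 : ℝ) ≤ (i : ℝ) - (j₀ + a : ℕ) := by
              rw [sub_nonneg]; exact_mod_cast hai
            nlinarith
          calc _ ≤ (M * (2 : ℝ) ^ (-((j₀ + a : ℕ) : ℝ))) * (C * (2 : ℝ) ^ (((j₀ + a : ℕ) : ℝ) / 2) *
              (2 : ℝ) ^ (γ * (((j₀ + a : ℕ) : ℝ) - i))) := by gcongr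
            _ = M * C * ((2 : ℝ) ^ (-((j₀ + a : ℕ) : ℝ)) * ((2 : ℝ) ^ (((j₀ + a : ℕ) : ℝ) / 2) *
              (2 : ℝ) ^ (γ * (((j₀ + a : ℕ) : ℝ) - i)))) := by ring
            _ ≤ M * C * (q * ρ ^ Nat.dist a (i - j₀)) := by gcongr
            _ ≤ 2 * (M * C) * q * ρ ^ Nat.dist a (i - j₀) := by
              have : 0 ≤ M * C * (q * ρ ^ Nat.dist a (i - j₀)) := by positivity
              linarith
        · have h3 : |W.ψ (j₀ + a) k x - W.ψ (j₀ + a) k y| ≤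
              2 * (C * (2 : ℝ) ^ (((j₀ + a : ℕ) : ℝ) / 2)) := by
            have := (h2.1 x).2
            have := (h2.1 y).2
            exact (abs_sub _ _).trans (by linarith)
          have h4 : (2 : ℝ) ^ (-((j₀ + a : ℕ) : ℝ)) * (2 : ℝ) ^ (((j₀ + a : ℕ) : ℝ) / 2) ≤
              q * ρ ^ Nat.dist a (i - j₀) := by
            rw [hq1, ← Real.rpow_add (by norm_num)]
            apply Real.rpow_le_rpow_of_exponent_le (by norm_num)
            have hd : ((Nat.dist a (i - j₀) : ℕ) : ℝ) = ((j₀ + a : ℕ) : ℝ) - i := by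
              rw [Nat.dist, Nat.sub_eq_zero_of_le (show i - j₀ ≤ a by omega), add_zero,
                show a - (i - j₀) = j₀ + a - i by omega, Nat.cast_sub hai]
            rw [hd]
            have h5 : δ ≤ 1 / 2 := min_le_left _ _
            have h6 : (0 : ℝ) ≤ ((j₀ + a : ℕ) : ℝ) - i := by
              rw [sub_nonneg]; exact_mod_cast hai
            nlinarith
          calc _ ≤ (M * (2 : ℝ) ^ (-((j₀ + a : ℕ) : ℝ))) *
                (2 * (C * (2 : ℝ) ^ (((j₀ + a : ℕ) : ℝ) / 2))) := by gcongr
            _ = 2 * (M * C) * ((2 : ℝ) ^ (-((j₀ + a : ℕ) : ℝ)) *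
                (2 : ℝ) ^ (((j₀ + a : ℕ) : ℝ) / 2)) := by ring
            _ ≤ 2 * (M * C) * (q * ρ ^ Nat.dist a (i - j₀)) := by gcongr
            _ = _ := by ring
    have hsum := (hf x hx.2).sub (hf y hy.2)
    simp_rw [← Finset.sum_sub_distrib, ← mul_sub] at hsum
    have h1 := hsum.abs_le_of_abs_sum_range_le
      (B := 8 * L * (M * C) * q * (2 / (1 - ρ))) (fun n => by
      refine (Finset.abs_sum_le_sum_abs _ _).trans
        ((Finset.sum_le_sum fun a _ => hlev a).trans ?_)
      rw [← Finset.mul_sum, ← Finset.mul_sum]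
      have := sum_pow_dist_le hρ0.le hρ1 (i - j₀) n
      calc _ ≤ 4 * L * (2 * (M * C) * q * (2 / (1 - ρ))) := by gcongr
        _ = _ := by ring)
    have h2 : |∑ k ∈ Finset.range (2 ^ j₀), W.coeffα f j₀ k * (W.φ j₀ k x - W.φ j₀ k y)| ≤
        4 * L * (M * (C * (D * D))) * q := by
      rw [mul_assoc]
      refine abs_sum_le_of_two_suppInterval (x := x) (y := y) (by positivity)
        (fun k hk hx hy => ?_) fun k hk => ?_
      · rw [W.φ_eq_zero _ k le_rfl hk x hx, W.φ_eq_zero _ k le_rfl hk y hy, sub_self, mul_zero]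
      · rw [abs_mul]
        have h1 := hα k hk
        have h2 := ((hC j₀ k le_rfl hk).2 i l hi hl x hx y hy).1
        have h3 : (2 : ℝ) ^ (γ * ((j₀ : ℝ) - i)) ≤ D * q := by
          rw [hD, hq, ← Real.rpow_add (by norm_num)]
          apply Real.rpow_le_rpow_of_exponent_le (by norm_num)
          have : (j₀ : ℝ) ≤ i := by exact_mod_cast hi
          nlinarith
        calc _ ≤ M * (C * D * (D * q)) := by
              refine mul_le_mul h1 (h2.trans ?_) (abs_nonneg _) hM.le
              gcongr
          _ = _ := by ring
    have h3 : f x - f y = (f x - ∑ k ∈ Finset.range (2 ^ j₀), W.coeffα f j₀ k * W.φ j₀ k x -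
        (f y - ∑ k ∈ Finset.range (2 ^ j₀), W.coeffα f j₀ k * W.φ j₀ k y)) +
        ∑ k ∈ Finset.range (2 ^ j₀), W.coeffα f j₀ k * (W.φ j₀ k x - W.φ j₀ k y) := by
      simp_rw [mul_sub]
      rw [Finset.sum_sub_distrib]; ring
    rw [h3, hK]
    refine (abs_add_le _ _).trans ((add_le_add h1 h2).trans (le_of_eq (by ring)))

/-- The error made in replacing scaling coefficients by rescaled function values, in the
coefficient at `g`. -/
theorem exists_bias_bound (W : WaveletBasis j₀ N L) {M : ℝ} (hM : 0 < M) :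
    ∃ C : ℝ, 0 < C ∧ ∀ f : ℝ → ℝ, MemLp f 2 (volume.restrict (Ico (0 : ℝ) 1)) →
      W.IsSumOfSeries f → (∀ k < 2 ^ j₀, |W.coeffα f j₀ k| ≤ M) →
      (∀ j k, j₀ ≤ j → k < 2 ^ j → |W.coeffβ f j k| ≤ M * (2 : ℝ) ^ (-(j : ℝ))) →
      ∀ i, j₀ ≤ i → ∀ g : ℝ → ℝ, Measurable g → (∃ B, ∀ x, |g x| ≤ B) →
        (∀ j k, i ≤ j → k < 2 ^ j → innerL2 g (W.ψ j k) = 0) → innerL2 g g = 1 →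
        |∑ l ∈ Finset.range (2 ^ i),
            (2 : ℝ) ^ (-(i : ℝ) / 2) * f ((l : ℝ) / 2 ^ i) * innerL2 (W.φ i l) g - innerL2 f g| ≤
          C * (2 : ℝ) ^ (-(i : ℝ) / 2) := by
  obtain ⟨γ, -, C, hC1, hC⟩ := W.exists_regular
  obtain ⟨K, hK0, hK⟩ := W.exists_oscillation_bound hM
  have hL1 := W.one_le_L
  have hC0 : 0 < C := by linarith
  have hL0 : (0 : ℝ) < L := by exact_mod_cast hL1
  set A : ℝ := K * C * (2 * L) with hA
  set B : ℝ := K + K * C * (2 * L) with hB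
  refine ⟨√(A ^ 2 + 2 * L * B ^ 2), by positivity,
    fun f hf2 hfs hα hβ i hi g hg ⟨b, hb⟩ hort hone => ?_⟩
  obtain ⟨hbd, hosc⟩ := hK f hfs hα hβ
  have hf : Integrable f (volume.restrict (Ico (0 : ℝ) 1)) := hf2.integrable (by norm_num)
  set q : ℝ := (2 : ℝ) ^ (-(i : ℝ) / 2) with hq
  have hq0 : 0 < q := by positivity
  have hqq : q * q = 1 / 2 ^ i := by
    rw [hq, ← Real.rpow_add (by norm_num), ← Real.rpow_natCast, one_div,
      ← Real.rpow_neg (by norm_num)]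
    congr 1; ring
  have hqi : (2 : ℝ) ^ ((i : ℝ) / 2) * (2 * L / 2 ^ i) = 2 * L * q := by
    rw [hq, ← Real.rpow_natCast, mul_comm, div_mul_eq_mul_div, mul_div_assoc,
      ← Real.rpow_sub (by norm_num)]
    congr 2; ring
  set d : ℕ → ℝ := fun l => q * f ((l : ℝ) / 2 ^ i) - innerL2 f (W.φ i l) with hd
  have hmem : ∀ l < 2 ^ i, (l : ℝ) / 2 ^ i ∈ suppInterval L i l := fun l hl =>
    left_mem_suppInterval hL1 hl
  -- Away from the end points `∫ φ = 2^{-i/2}`, so `d l` is an integral of increments of `f`, of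
  -- order `2^{-i}`.
  have hint : ∀ l, L ≤ l → l + L < 2 ^ i → |d l| ≤ A * (q * q) := by
    intro l hl1 hl2
    have hl : l < 2 ^ i := by omega
    set y := (l : ℝ) / 2 ^ i
    have e : d l = -∫ x in Ico (0 : ℝ) 1, (f x - f y) * W.φ i l x := by
      simp_rw [sub_mul]
      rw [integral_sub (W.integrable_mul_φ hi hl hf) ((W.integrable_φ hi hl).const_mul _),
        integral_const_mul, W.integral_φ i l hi hl1 hl2, hd]
      simp only [innerL2, ← hq]
      ring
    rw [e, abs_neg]
    refine (abs_setIntegral_le_of_suppInterval (L := L) (i := i) (l := l)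
      (B := K * q * (C * (2 : ℝ) ^ ((i : ℝ) / 2))) (by positivity) (fun x hx => ?_)
      fun x hx => ?_).trans (le_of_eq ?_)
    · rw [W.φ_eq_zero i l hi hl x hx, mul_zero]
    · rw [abs_mul]
      have h1 := hosc i l hi hl x hx y (hmem l hl)
      have h2 := ((hC i l hi hl).1 x).1
      gcongr
    · calc _ = K * q * C * ((2 : ℝ) ^ ((i : ℝ) / 2) * (2 * L / 2 ^ i)) := by ring
        _ = _ := by rw [hqi, hA]; ring
  -- Near the end points the integral of `φ` is not prescribed and only the size `2^{-i/2}` is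
  -- available. There are at most `2 L` such indices, so their squares sum to `O(2^{-i})`, like
  -- those of the `2^i` interior ones.
  have hbdry : ∀ l < 2 ^ i, |d l| ≤ B * q := by
    intro l hl
    have h1 : |innerL2 f (W.φ i l)| ≤ K * C * (2 * L) * q := by
      refine (abs_setIntegral_le_of_suppInterval (L := L) (i := i) (l := l)
        (B := K * (C * (2 : ℝ) ^ ((i : ℝ) / 2))) (by positivity) (fun x hx => ?_)
        fun x hx => ?_).trans (le_of_eq ?_)
      · rw [W.φ_eq_zero i l hi hl x hx, mul_zero]
      · rw [abs_mul]
        have h1 := hbd x hx.2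
        have h2 := ((hC i l hi hl).1 x).1
        gcongr
      · rw [mul_assoc, mul_assoc, hqi]; ring
    have h2 := hbd _ (hmem l hl).2
    calc |d l| ≤ |q * f ((l : ℝ) / 2 ^ i)| + |innerL2 f (W.φ i l)| := abs_sub _ _
      _ ≤ q * K + K * C * (2 * L) * q := by
        rw [abs_mul, abs_of_pos hq0]; gcongr
      _ = B * q := by rw [hB]; ring
  have hsq : ∑ l ∈ Finset.range (2 ^ i), d l ^ 2 ≤ (A ^ 2 + 2 * L * B ^ 2) * (q * q) := by
    have h1 : ∀ l ∈ Finset.range (2 ^ i), d l ^ 2 ≤ (A * (q * q)) ^ 2 +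
        (if l ∈ Finset.range L ∪ Finset.Ico (2 ^ i - L) (2 ^ i) then (B * q) ^ 2 else 0) := by
      intro l hl
      rw [Finset.mem_range] at hl
      split_ifs with h
      · have := sq_le_sq' (by linarith [neg_abs_le (d l), hbdry l hl])
          ((le_abs_self _).trans (hbdry l hl))
        linarith [sq_nonneg (A * (q * q))]
      · have h2 : L ≤ l ∧ l + L < 2 ^ i := by
          simp only [Finset.mem_union, Finset.mem_range, Finset.mem_Ico, not_or, not_and] at h
          omega
        have := hint l h2.1 h2.2
        rw [add_zero]
        exact sq_le_sq' (by linarith [neg_abs_le (d l)]) ((le_abs_self _).trans this)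
    refine (Finset.sum_le_sum h1).trans ?_
    rw [Finset.sum_add_distrib, Finset.sum_const, Finset.card_range, nsmul_eq_mul,
      ← Finset.sum_filter, Finset.sum_const, nsmul_eq_mul]
    have h3 : (((Finset.range (2 ^ i)).filter fun l =>
        l ∈ Finset.range L ∪ Finset.Ico (2 ^ i - L) (2 ^ i)).card : ℝ) ≤ 2 * L := by
      have h4 : ((Finset.range (2 ^ i)).filter fun l =>
          l ∈ Finset.range L ∪ Finset.Ico (2 ^ i - L) (2 ^ i)).card ≤ 2 * L := by
        refine (Finset.card_le_card (t := Finset.range L ∪ Finset.Ico (2 ^ i - L) (2 ^ i))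
          fun l hl => (Finset.mem_filter.1 hl).2).trans ((Finset.card_union_le _ _).trans ?_)
        rw [Finset.card_range, Nat.card_Ico]; omega
      exact_mod_cast h4
    have h5 : ((2 ^ i : ℕ) : ℝ) * (A * (q * q)) ^ 2 = A ^ 2 * (q * q) := by
      have : ((2 ^ i : ℕ) : ℝ) * (q * q) = 1 := by
        rw [hqq]; push_cast; field_simp
      calc _ = A ^ 2 * (q * q) * (((2 ^ i : ℕ) : ℝ) * (q * q)) := by ring
        _ = _ := by rw [this, mul_one]
    rw [h5]
    have h6 : 0 ≤ (B * q) ^ 2 := sq_nonneg _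
    nlinarith
  have hcs := Finset.sum_mul_sq_le_sq_mul_sq (Finset.range (2 ^ i)) d
    fun l => innerL2 (W.φ i l) g
  rw [W.sum_sq_innerL2_φ hi hg hb hort, hone, mul_one] at hcs
  have e : ∑ l ∈ Finset.range (2 ^ i), q * f ((l : ℝ) / 2 ^ i) * innerL2 (W.φ i l) g -
      innerL2 f g = ∑ l ∈ Finset.range (2 ^ i), d l * innerL2 (W.φ i l) g := by
    rw [W.innerL2_eq_sum_φ hi hg hb hort hf, ← Finset.sum_sub_distrib]
    exact Finset.sum_congr rfl fun l _ => by rw [hd]; ring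
  rw [e]
  refine abs_le_of_sq_le_sq ?_ (by positivity)
  rw [mul_pow, Real.sq_sqrt (by positivity)]
  calc _ ≤ _ := hcs
    _ ≤ _ := hsq
    _ = _ := by ring

end WaveletBasis

/-! ### Gaussian deviations of noise averages over a sequential design -/

theorem lintegral_exp_gaussianReal (v : NNReal) (t : ℝ) :
    ∫⁻ e, ENNReal.ofReal (Real.exp (t * e - t ^ 2 * v / 2)) ∂gaussianReal 0 v = 1 := by
  have h : ∀ e : ℝ, Real.exp (t * e - t ^ 2 * v / 2) =
      Real.exp (t * e) * Real.exp (-(t ^ 2 * v / 2)) := fun e => by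
    rw [← Real.exp_add]; ring_nf
  simp_rw [h]
  have hi := integrable_exp_mul_gaussianReal (μ := 0) (v := v) t
  rw [← ofReal_integral_eq_lintegral_ofReal (hi.mul_const _)
    (Eventually.of_forall fun e => by positivity), integral_mul_const]
  have := congrFun (mgf_id_gaussianReal (μ := 0) (v := v)) t
  simp only [mgf, id] at this
  rw [this, ← Real.exp_add]
  ring_nf; simp

theorem measurable_exp_sum {Ω : Type*} {m : MeasurableSpace Ω} {wt : ℝ → ℝ} (hwt : Measurable wt)
    {ε x : ℕ → Ω → ℝ} {n : ℕ} (hε : ∀ k < n, Measurable (ε k)) (hx : ∀ k < n, Measurable (x k))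
    (v θ : ℝ) :
    Measurable fun ω => ENNReal.ofReal (Real.exp (∑ k ∈ Finset.range n,
      (θ * wt (x k ω) * ε k ω - (θ * wt (x k ω)) ^ 2 * v / 2))) := by
  refine (Real.measurable_exp.comp (Finset.measurable_fun_sum _ fun k hk => ?_)).ennreal_ofReal
  have h1 := hε k (Finset.mem_range.1 hk)
  have h2 := hwt.comp (hx k (Finset.mem_range.1 hk))
  exact ((h2.const_mul θ).mul h1).sub ((((h2.const_mul θ).pow_const 2).mul_const v).div_const 2)

/-- The exponential martingale. The product of the first `n` factors and the weight `wt (x n)` are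
`ℱ n`-measurable, and `ε n` is independent of `ℱ n`; their joint law is therefore a product, and
Fubini with the Gaussian moment generating function removes the last factor. -/
theorem lintegral_exp_sum_noise {Ω : Type*} [mΩ : MeasurableSpace Ω] {μ : Measure Ω}
    [IsProbabilityMeasure μ] {ε x : ℕ → Ω → ℝ} {ℱ : Filtration ℕ mΩ} {v : NNReal}
    (hlaw : ∀ n, μ.map (ε n) = gaussianReal 0 v) (hε : ∀ n, Measurable[ℱ (n + 1)] (ε n))
    (hind : ∀ n, Indep (MeasurableSpace.comap (ε n) inferInstance) (ℱ n) μ)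
    (hx : ∀ n, Measurable[ℱ n] (x n)) {wt : ℝ → ℝ} (hwt : Measurable wt) (θ : ℝ) (n : ℕ) :
    ∫⁻ ω, ENNReal.ofReal (Real.exp (∑ k ∈ Finset.range n,
      (θ * wt (x k ω) * ε k ω - (θ * wt (x k ω)) ^ 2 * v / 2))) ∂μ = 1 := by
  induction n with
  | zero => simp
  | succ n ih =>
    have hεn : Measurable (ε n) := (hε n).mono (ℱ.le _) le_rfl
    set Z : Ω → ℝ≥0∞ := fun ω => ENNReal.ofReal (Real.exp (∑ k ∈ Finset.range n,
      (θ * wt (x k ω) * ε k ω - (θ * wt (x k ω)) ^ 2 * v / 2))) with hZ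
    have hZm : Measurable[ℱ n] Z := measurable_exp_sum (m := ℱ n) hwt
      (fun k hk => (hε k).mono (ℱ.mono (by omega)) le_rfl)
      (fun k hk => (hx k).mono (ℱ.mono (by omega)) le_rfl) v θ
    have hwm : Measurable[ℱ n] fun ω => wt (x n ω) := hwt.comp (hx n)
    have hXm : Measurable[ℱ n] fun ω => (Z ω, wt (x n ω)) := hZm.prodMk hwm
    have hX : Measurable fun ω => (Z ω, wt (x n ω)) := hXm.mono (ℱ.le _) le_rfl
    have hI : IndepFun (fun ω => (Z ω, wt (x n ω))) (ε n) μ :=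
      indep_of_indep_of_le_left (hind n).symm hXm.comap_le
    have hF : Measurable fun q : (ℝ≥0∞ × ℝ) × ℝ =>
        q.1.1 * ENNReal.ofReal (Real.exp (θ * q.1.2 * q.2 - (θ * q.1.2) ^ 2 * v / 2)) := by
      fun_prop
    calc _ = ∫⁻ ω, (fun q : (ℝ≥0∞ × ℝ) × ℝ => q.1.1 * ENNReal.ofReal
          (Real.exp (θ * q.1.2 * q.2 - (θ * q.1.2) ^ 2 * v / 2))) ((Z ω, wt (x n ω)), ε n ω) ∂μ := by
          refine lintegral_congr fun ω => ?_
          rw [Finset.sum_range_succ, Real.exp_add, ENNReal.ofReal_mul (Real.exp_nonneg _)]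
      _ = ∫⁻ q, (fun q : (ℝ≥0∞ × ℝ) × ℝ => q.1.1 * ENNReal.ofReal
          (Real.exp (θ * q.1.2 * q.2 - (θ * q.1.2) ^ 2 * v / 2))) q
            ∂((μ.map fun ω => (Z ω, wt (x n ω))).prod (μ.map (ε n))) := by
          rw [← (indepFun_iff_map_prod_eq_prod_map_map hX.aemeasurable hεn.aemeasurable).1 hI,
            lintegral_map hF (hX.prodMk hεn)]
      _ = ∫⁻ a, a.1 ∂(μ.map fun ω => (Z ω, wt (x n ω))) := by
          rw [hlaw n, lintegral_prod _ hF.aemeasurable]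
          refine lintegral_congr fun a => ?_
          dsimp only
          rw [lintegral_const_mul _ (by fun_prop), lintegral_exp_gaussianReal, mul_one]
      _ = 1 := by rw [lintegral_map measurable_fst hX]; exact ih

/-- Chernoff's bound with the optimal `θ = a / (v V)`. The weights are random, so their square sum
has to be at most `V` for every outcome; then the event forces the exponential martingale above
`exp(a² / (2 v V))`, and Markov's inequality applies. -/
theorem measure_noise_sum_ge_le {Ω : Type*} [mΩ : MeasurableSpace Ω] {μ : Measure Ω}
    [IsProbabilityMeasure μ] {ε x : ℕ → Ω → ℝ} {ℱ : Filtration ℕ mΩ} {v : NNReal}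
    (hlaw : ∀ n, μ.map (ε n) = gaussianReal 0 v) (hε : ∀ n, Measurable[ℱ (n + 1)] (ε n))
    (hind : ∀ n, Indep (MeasurableSpace.comap (ε n) inferInstance) (ℱ n) μ)
    (hx : ∀ n, Measurable[ℱ n] (x n)) {wt : ℝ → ℝ} (hwt : Measurable wt) {n : ℕ} {V a : ℝ}
    (ha : 0 ≤ a) (hv : 0 < v) (hV : 0 < V) (hwV : ∀ ω, ∑ k ∈ Finset.range n, wt (x k ω) ^ 2 ≤ V) :
    μ {ω | a ≤ ∑ k ∈ Finset.range n, wt (x k ω) * ε k ω} ≤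
      ENNReal.ofReal (Real.exp (-(a ^ 2 / (2 * v * V)))) := by
  set θ : ℝ := a / (v * V) with hθ
  have hv' : (0 : ℝ) < v := by exact_mod_cast hv
  have hθ0 : 0 ≤ θ := by positivity
  have hmeas := measurable_exp_sum hwt (n := n) (fun k _ => (hε k).mono (ℱ.le _) le_rfl)
    (fun k _ => (hx k).mono (ℱ.le _) le_rfl) (v : ℝ) θ
  have hmk := mul_meas_ge_le_lintegral (μ := μ) hmeas
    (ENNReal.ofReal (Real.exp (a ^ 2 / (2 * v * V))))
  rw [lintegral_exp_sum_noise hlaw hε hind hx hwt θ n] at hmk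
  have hsub : {ω | a ≤ ∑ k ∈ Finset.range n, wt (x k ω) * ε k ω} ⊆
      {ω | ENNReal.ofReal (Real.exp (a ^ 2 / (2 * v * V))) ≤
        ENNReal.ofReal (Real.exp (∑ k ∈ Finset.range n,
          (θ * wt (x k ω) * ε k ω - (θ * wt (x k ω)) ^ 2 * v / 2)))} := by
    intro ω hω
    refine ENNReal.ofReal_le_ofReal (Real.exp_le_exp.2 ?_)
    have e : ∑ k ∈ Finset.range n, (θ * wt (x k ω) * ε k ω - (θ * wt (x k ω)) ^ 2 * v / 2) =
        θ * ∑ k ∈ Finset.range n, wt (x k ω) * ε k ω -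
          θ ^ 2 * v / 2 * ∑ k ∈ Finset.range n, wt (x k ω) ^ 2 := by
      rw [Finset.mul_sum, Finset.mul_sum, ← Finset.sum_sub_distrib]
      exact Finset.sum_congr rfl fun k _ => by ring
    have h1 : θ * a ≤ θ * ∑ k ∈ Finset.range n, wt (x k ω) * ε k ω :=
      mul_le_mul_of_nonneg_left hω hθ0
    have h2 : θ ^ 2 * v / 2 * ∑ k ∈ Finset.range n, wt (x k ω) ^ 2 ≤ θ ^ 2 * v / 2 * V :=
      mul_le_mul_of_nonneg_left (hwV ω) (by positivity)
    have h3 : a ^ 2 / (2 * v * V) = θ * a - θ ^ 2 * v / 2 * V := by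
      rw [hθ]; field_simp; ring
    rw [e, h3]; linarith
  refine (measure_mono hsub).trans ?_
  rw [Real.exp_neg, ENNReal.ofReal_inv_of_pos (Real.exp_pos _), ← one_div]
  rwa [ENNReal.le_div_iff_mul_le (Or.inl (by positivity)) (Or.inl ENNReal.ofReal_ne_top), mul_comm]

theorem measure_abs_noise_sum_ge_le {Ω : Type*} [mΩ : MeasurableSpace Ω] {μ : Measure Ω}
    [IsProbabilityMeasure μ] {ε x : ℕ → Ω → ℝ} {ℱ : Filtration ℕ mΩ} {v : NNReal}
    (hlaw : ∀ n, μ.map (ε n) = gaussianReal 0 v) (hε : ∀ n, Measurable[ℱ (n + 1)] (ε n))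
    (hind : ∀ n, Indep (MeasurableSpace.comap (ε n) inferInstance) (ℱ n) μ)
    (hx : ∀ n, Measurable[ℱ n] (x n)) {wt : ℝ → ℝ} (hwt : Measurable wt) {n : ℕ} {V a : ℝ}
    (ha : 0 ≤ a) (hv : 0 < v) (hV : 0 < V)
    (hwV : ∀ ω, ∑ k ∈ Finset.range n, wt (x k ω) ^ 2 ≤ V) :
    μ {ω | a ≤ |∑ k ∈ Finset.range n, wt (x k ω) * ε k ω|} ≤
      2 * ENNReal.ofReal (Real.exp (-(a ^ 2 / (2 * v * V)))) := by
  have h1 := measure_noise_sum_ge_le hlaw hε hind hx hwt ha hv hV hwV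
  have h2 := measure_noise_sum_ge_le hlaw hε hind hx hwt.neg (n := n) ha hv hV (by simpa using hwV)
  rw [two_mul]
  refine (measure_mono (t := _ ∪ _) fun ω hω => ?_).trans ((measure_union_le _ _).trans
    (add_le_add h1 h2))
  rcases le_abs.1 (show a ≤ |_| from hω) with h | h
  · exact Or.inl h
  · refine Or.inr ?_
    simpa using h

/-! ### Linear statistics of the observations -/

/-- The weight that the level `i` estimate of the coefficient at `g` gives to an observation
made at the point `y`. -/
def levelWeight {j₀ N L : ℕ} (W : WaveletBasis j₀ N L) (i : ℕ) (g : ℝ → ℝ) (y : ℝ) : ℝ :=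
  ∑ l ∈ Finset.range (2 ^ i), if y = (l : ℝ) / 2 ^ i then
    (2 : ℝ) ^ (-(i : ℝ) / 2) * innerL2 (W.φ i l) g else 0

theorem dyadic_injective (i : ℕ) {l l' : ℕ} (h : (l : ℝ) / 2 ^ i = (l' : ℝ) / 2 ^ i) : l = l' := by
  have h2 : (2 : ℝ) ^ i ≠ 0 := by positivity
  rw [div_left_inj' h2] at h
  exact_mod_cast h

namespace WaveletBasis

variable {j₀ N L : ℕ}

theorem measurable_levelWeight (W : WaveletBasis j₀ N L) (i : ℕ) (g : ℝ → ℝ) :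
    Measurable (levelWeight W i g) :=
  Finset.measurable_fun_sum _ fun _ _ =>
    Measurable.ite (measurableSet_singleton _) measurable_const measurable_const

/-- The form to which the deviation bound for sequential designs applies: a deterministic function
of the design point times the observation. -/
theorem levelEst_eq_sum_levelWeight (W : WaveletBasis j₀ N L) (x Y : ℕ → ℝ) (n i : ℕ)
    (g : ℝ → ℝ) :
    W.levelEst x Y n i g = ∑ m ∈ Finset.range n, levelWeight W i g (x m) * Y m := by
  unfold levelEst levelWeight obsAt
  simp_rw [Finset.mul_sum, Finset.sum_mul]
  rw [Finset.sum_comm]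
  refine Finset.sum_congr rfl fun m _ => Finset.sum_congr rfl fun l _ => ?_
  split_ifs <;> ring

theorem levelEst_add (W : WaveletBasis j₀ N L) (x Y Y' : ℕ → ℝ) (n i : ℕ) (g : ℝ → ℝ) :
    W.levelEst x (fun m => Y m + Y' m) n i g = W.levelEst x Y n i g + W.levelEst x Y' n i g := by
  simp_rw [levelEst_eq_sum_levelWeight, mul_add, Finset.sum_add_distrib]

theorem levelWeight_dyadic (W : WaveletBasis j₀ N L) {i l : ℕ} (hl : l < 2 ^ i) (g : ℝ → ℝ) :
    levelWeight W i g ((l : ℝ) / 2 ^ i) = (2 : ℝ) ^ (-(i : ℝ) / 2) * innerL2 (W.φ i l) g := by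
  unfold levelWeight
  rw [Finset.sum_eq_single l]
  · simp
  · intro l' _ h
    rw [if_neg fun e => h (dyadic_injective i e).symm]
  · intro h; exact absurd (Finset.mem_range.2 hl) h

/-- At most one grid point equals `y`, so there are no cross terms. -/
theorem levelWeight_sq (W : WaveletBasis j₀ N L) (i : ℕ) (g : ℝ → ℝ) (y : ℝ) :
    levelWeight W i g y ^ 2 = ∑ l ∈ Finset.range (2 ^ i), if y = (l : ℝ) / 2 ^ i then
      ((2 : ℝ) ^ (-(i : ℝ) / 2) * innerL2 (W.φ i l) g) ^ 2 else 0 := by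
  by_cases h : ∃ l : ℕ, l < 2 ^ i ∧ y = (l : ℝ) / 2 ^ i
  · obtain ⟨l, hl, rfl⟩ := h
    rw [W.levelWeight_dyadic hl, Finset.sum_eq_single l]
    · simp
    · intro l' _ h
      rw [if_neg fun e => h (dyadic_injective i e).symm]
    · intro h; exact absurd (Finset.mem_range.2 hl) h
  · push Not at h
    have h' : ∀ l ∈ Finset.range (2 ^ i), ¬ y = (l : ℝ) / 2 ^ i := fun l hl =>
      h l (Finset.mem_range.1 hl)
    unfold levelWeight
    rw [Finset.sum_eq_zero fun l hl => if_neg (h' l hl),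
      Finset.sum_eq_zero fun l hl => if_neg (h' l hl)]
    simp

/-- Each grid point is observed at most once, and Parseval sums the rest. Grid points not yet
observed only lower the sum, so the bound needs no assumption on how much of level `i` is in the
design. -/
theorem sum_levelWeight_sq_le (W : WaveletBasis j₀ N L) {i : ℕ} (hi : j₀ ≤ i) {g : ℝ → ℝ}
    (hg : Measurable g) {B : ℝ} (hB : ∀ x, |g x| ≤ B)
    (hort : ∀ j k, i ≤ j → k < 2 ^ j → innerL2 g (W.ψ j k) = 0) (h1 : innerL2 g g = 1)
    {x : ℕ → ℝ} (hx : Function.Injective x) (n : ℕ) :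
    ∑ m ∈ Finset.range n, levelWeight W i g (x m) ^ 2 ≤ (2 : ℝ) ^ (-(i : ℝ)) := by
  simp_rw [levelWeight_sq]
  rw [Finset.sum_comm]
  have h2 : ∀ l ∈ Finset.range (2 ^ i), (∑ m ∈ Finset.range n, if x m = (l : ℝ) / 2 ^ i then
      ((2 : ℝ) ^ (-(i : ℝ) / 2) * innerL2 (W.φ i l) g) ^ 2 else 0) ≤
      (2 : ℝ) ^ (-(i : ℝ)) * innerL2 (W.φ i l) g ^ 2 := by
    intro l _
    have hsq : ((2 : ℝ) ^ (-(i : ℝ) / 2) * innerL2 (W.φ i l) g) ^ 2 =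
        (2 : ℝ) ^ (-(i : ℝ)) * innerL2 (W.φ i l) g ^ 2 := by
      rw [mul_pow, ← Real.rpow_natCast ((2 : ℝ) ^ _), ← Real.rpow_mul (by norm_num)]
      congr 2; push_cast; ring
    rw [← hsq, ← Finset.sum_filter, Finset.sum_const]
    have hc : ((Finset.range n).filter fun m => x m = (l : ℝ) / 2 ^ i).card ≤ 1 := by
      rw [Finset.card_le_one]
      intro a ha b hb
      exact hx ((Finset.mem_filter.1 ha).2.trans (Finset.mem_filter.1 hb).2.symm)
    exact (nsmul_le_nsmul_left (sq_nonneg _) hc).trans (by simp)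
  refine (Finset.sum_le_sum h2).trans ?_
  rw [← Finset.mul_sum, W.sum_sq_innerL2_φ hi hg hB hort, h1, mul_one]

/-- If all relevant points of level `i` are in the design, the noiseless level `i` estimate uses
exactly the values at these points. -/
theorem levelEst_comp (W : WaveletBasis j₀ N L) {x : ℕ → ℝ} (hx : Function.Injective x)
    (f : ℝ → ℝ) {n i : ℕ} {g : ℝ → ℝ}
    (hobs : ∀ l : ℕ, l < 2 ^ i → (l : ℝ) / 2 ^ i ∉ design x n → innerL2 (W.φ i l) g = 0) :
    W.levelEst x (fun m => f (x m)) n i g = ∑ l ∈ Finset.range (2 ^ i),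
      (2 : ℝ) ^ (-(i : ℝ) / 2) * f ((l : ℝ) / 2 ^ i) * innerL2 (W.φ i l) g := by
  refine Finset.sum_congr rfl fun l hl => ?_
  by_cases h : (l : ℝ) / 2 ^ i ∈ design x n
  · obtain ⟨m, hm, hml⟩ := h
    have : obsAt x (fun m => f (x m)) n ((l : ℝ) / 2 ^ i) = f ((l : ℝ) / 2 ^ i) := by
      unfold obsAt
      rw [Finset.sum_eq_single m]
      · simp [hml]
      · intro m' _ h'
        rw [if_neg fun e => h' (hx (e.trans hml.symm))]
      · intro h'; exact absurd (Finset.mem_range.2 hm) h'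
    rw [this]
  · rw [hobs l (Finset.mem_range.1 hl) h, mul_zero, mul_zero]

/-- All level estimates of noise are small, simultaneously, with high probability. -/
theorem measure_exists_noise_ge_le (W : WaveletBasis j₀ N L) {Ω : Type*}
    [mΩ : MeasurableSpace Ω] {μ : Measure Ω}
    [IsProbabilityMeasure μ] {ε x : ℕ → Ω → ℝ} {ℱ : Filtration ℕ mΩ} {σ : ℝ} (hσ : 0 < σ)
    (hlaw : ∀ n, μ.map (ε n) = gaussianReal 0 (σ ^ 2).toNNReal)
    (hε : ∀ n, Measurable[ℱ (n + 1)] (ε n))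
    (hind : ∀ n, Indep (MeasurableSpace.comap (ε n) inferInstance) (ℱ n) μ)
    (hx : ∀ n, Measurable[ℱ n] (x n)) (hinj : ∀ ω, Function.Injective fun n => x n ω)
    {n J : ℕ} (hn : 1 ≤ n) {κ : ℝ} (hκ : 0 ≤ κ) :
    μ {ω | ∃ j k i, j₀ ≤ j ∧ j < J ∧ k < 2 ^ j ∧ j < i ∧ i ≤ j + Nat.log 2 n ∧
        ∃ g, (g = W.φ j k ∨ g = W.ψ j k) ∧
        κ * (σ * (2 : ℝ) ^ (-(i : ℝ) / 2) * √(2 * Real.log n)) ≤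
          |W.levelEst (fun m => x m ω) (fun m => ε m ω) n i g|} ≤
      ENNReal.ofReal (4 * 2 ^ J * Nat.log 2 n * (n : ℝ) ^ (-κ ^ 2)) := by
  have hn' : (1 : ℝ) ≤ n := by exact_mod_cast hn
  have hlog : 0 ≤ Real.log n := Real.log_nonneg hn'
  set b : ℝ≥0∞ := ENNReal.ofReal ((n : ℝ) ^ (-κ ^ 2)) with hb
  have single : ∀ (i : ℕ) (g : ℝ → ℝ), j₀ ≤ i → Measurable g → (∃ B, ∀ x, |g x| ≤ B) →
      (∀ j k, i ≤ j → k < 2 ^ j → innerL2 g (W.ψ j k) = 0) → innerL2 g g = 1 →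
      μ {ω | κ * (σ * (2 : ℝ) ^ (-(i : ℝ) / 2) * √(2 * Real.log n)) ≤
          |W.levelEst (fun m => x m ω) (fun m => ε m ω) n i g|} ≤ 2 * b := by
    intro i g hi hg ⟨B, hB⟩ hort hone
    simp_rw [levelEst_eq_sum_levelWeight]
    refine (measure_abs_noise_sum_ge_le hlaw hε hind hx (W.measurable_levelWeight i g)
      (by positivity) (by simpa using pow_pos hσ 2)
      (Real.rpow_pos_of_pos two_pos (-(i : ℝ)))
      fun ω => W.sum_levelWeight_sq_le hi hg hB hort hone (hinj ω) n).trans (le_of_eq ?_)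
    rw [hb, Real.rpow_def_of_pos (show (0 : ℝ) < n by linarith)]
    congr 3
    rw [Real.coe_toNNReal _ (sq_nonneg σ), mul_pow, mul_pow, mul_pow, Real.sq_sqrt (by positivity),
      ← Real.rpow_natCast ((2 : ℝ) ^ _), ← Real.rpow_mul (by norm_num)]
    have : -(i : ℝ) / 2 * (2 : ℕ) = -(i : ℝ) := by push_cast; ring
    rw [this]
    have h2 : (0 : ℝ) < (2 : ℝ) ^ (-(i : ℝ)) := by positivity
    field_simp
  -- The observation level is random, so the union runs over all deterministic levels that it can
  -- take, of which there are at most `log₂ n` above each `j`.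
  set A : ℕ → ℕ → ℕ → (ℝ → ℝ) → Set Ω := fun j k d g =>
    {ω | κ * (σ * (2 : ℝ) ^ (-((j + 1 + d : ℕ) : ℝ) / 2) * √(2 * Real.log n)) ≤
          |W.levelEst (fun m => x m ω) (fun m => ε m ω) n (j + 1 + d) g|} with hA
  have hsub : {ω | ∃ j k i, j₀ ≤ j ∧ j < J ∧ k < 2 ^ j ∧ j < i ∧ i ≤ j + Nat.log 2 n ∧
        ∃ g, (g = W.φ j k ∨ g = W.ψ j k) ∧
        κ * (σ * (2 : ℝ) ^ (-(i : ℝ) / 2) * √(2 * Real.log n)) ≤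
          |W.levelEst (fun m => x m ω) (fun m => ε m ω) n i g|} ⊆
      ⋃ j ∈ Finset.Ico j₀ J, ⋃ k ∈ Finset.range (2 ^ j), ⋃ d ∈ Finset.range (Nat.log 2 n),
        (A j k d (W.φ j k) ∪ A j k d (W.ψ j k)) := by
    rintro ω ⟨j, k, i, hj, hjJ, hk, hji, hi, g, hg, h⟩
    simp only [mem_iUnion, Finset.mem_Ico, Finset.mem_range]
    obtain ⟨d, rfl⟩ : ∃ d, i = j + 1 + d := ⟨i - (j + 1), by omega⟩
    refine ⟨j, ⟨hj, hjJ⟩, k, hk, d, by omega, ?_⟩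
    rcases hg with rfl | rfl
    · exact Or.inl h
    · exact Or.inr h
  refine (measure_mono hsub).trans ?_
  calc _ ≤ ∑ j ∈ Finset.Ico j₀ J, ∑ k ∈ Finset.range (2 ^ j), ∑ d ∈ Finset.range (Nat.log 2 n),
        (2 * b + 2 * b) := by
        refine (measure_biUnion_finset_le _ _).trans (Finset.sum_le_sum fun j hj => ?_)
        refine (measure_biUnion_finset_le _ _).trans (Finset.sum_le_sum fun k hk => ?_)
        refine (measure_biUnion_finset_le _ _).trans (Finset.sum_le_sum fun d hd => ?_)
        rw [Finset.mem_Ico] at hj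
        rw [Finset.mem_range] at hk
        refine (measure_union_le _ _).trans (add_le_add ?_ ?_)
        · refine single _ _ (by omega) (W.measurable_φ j k hj.1 hk) (W.exists_bound_φ hj.1 hk)
            (fun j' k' hj' hk' => W.φ_ψ j j' k k' hj.1 (by omega) hk hk') ?_
          rw [W.φ_φ j k k hj.1 hk hk, if_pos rfl]
        · refine single _ _ (by omega) (W.measurable_ψ j k hj.1 hk) (W.exists_bound_ψ hj.1 hk)
            (fun j' k' hj' hk' => ?_) ?_
          · rw [W.ψ_ψ j j' k k' hj.1 (by omega) hk hk', if_neg (by omega)]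
          · rw [W.ψ_ψ j j k k hj.1 hj.1 hk hk, if_pos ⟨rfl, rfl⟩]
    _ ≤ ∑ j ∈ Finset.range J, ∑ k ∈ Finset.range (2 ^ j), ∑ d ∈ Finset.range (Nat.log 2 n),
        (2 * b + 2 * b) := Finset.sum_le_sum_of_subset fun j hj => by
          rw [Finset.mem_Ico] at hj; exact Finset.mem_range.2 hj.2
    _ = (∑ j ∈ Finset.range J, (2 ^ j : ℕ)) * (Nat.log 2 n * (4 * b)) := by
        simp only [Finset.sum_const, Finset.card_range, nsmul_eq_mul, ← Finset.sum_mul]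
        push_cast
        ring
    _ ≤ ((2 ^ J : ℕ) : ℝ≥0∞) * (Nat.log 2 n * (4 * b)) := by
        gcongr
        have := Nat.geomSum_eq (le_refl 2) J
        have h2 : ∑ j ∈ Finset.range J, 2 ^ j ≤ 2 ^ J := by rw [this]; simp
        exact_mod_cast h2
    _ = _ := by
        rw [hb, ENNReal.ofReal_mul (by positivity), ENNReal.ofReal_mul (by positivity),
          ENNReal.ofReal_mul (by positivity)]
        simp [ENNReal.ofReal_pow]
        ring

end WaveletBasis

/-! ### Designs and dyadic grids -/

theorem dyadicGrid_mono {i i' : ℕ} (h : i ≤ i') : dyadicGrid i ⊆ dyadicGrid i' := by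
  rintro _ ⟨k, rfl⟩
  refine ⟨k * 2 ^ (i' - i), ?_⟩
  have : (2 : ℝ) ^ i' = 2 ^ i * 2 ^ (i' - i) := by rw [← pow_add]; congr 1; omega
  rw [this]; push_cast; field_simp

theorem design_mono (x : ℕ → ℝ) {n n' : ℕ} (h : n ≤ n') : design x n ⊆ design x n' :=
  image_mono (Iio_subset_Iio h)

theorem exists_of_mem_grid_cell {I J c : ℕ} (hJ : J ≤ I) {y : ℝ}
    (hy : y ∈ dyadicGrid I ∩ dyadicCell J c) :
    ∃ d : ℕ, d < 2 ^ (I - J) ∧ y = (c : ℝ) / 2 ^ J + (d : ℝ) / 2 ^ I := by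
  obtain ⟨⟨k, rfl⟩, h1, h2⟩ := hy
  have hp : (2 : ℝ) ^ I = 2 ^ J * 2 ^ (I - J) := by rw [← pow_add]; congr 1; omega
  have e : ∀ a : ℝ, a / 2 ^ J = a * 2 ^ (I - J) / 2 ^ I := fun a => by rw [hp]; field_simp
  rw [e, div_le_div_iff_of_pos_right (by positivity)] at h1
  rw [e, div_lt_div_iff_of_pos_right (by positivity)] at h2
  have h1' : (c : ℤ) * 2 ^ (I - J) ≤ k := by exact_mod_cast h1
  have h2' : k < (c + 1 : ℤ) * 2 ^ (I - J) := by exact_mod_cast h2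
  refine ⟨(k - c * 2 ^ (I - J)).toNat, ?_, ?_⟩
  · rw [Int.toNat_lt (by linarith)]
    push_cast; linarith
  · have : (((k - c * 2 ^ (I - J)).toNat : ℕ) : ℝ) = (k : ℝ) - c * 2 ^ (I - J) := by
      have h3 : (((k - c * 2 ^ (I - J)).toNat : ℕ) : ℤ) = k - c * 2 ^ (I - J) :=
        Int.toNat_of_nonneg (by linarith)
      exact_mod_cast congrArg (fun z : ℤ => (z : ℝ)) h3
    rw [this, e]; ring

theorem mem_grid_cell {I J c d : ℕ} (hJ : J ≤ I) (hd : d < 2 ^ (I - J)) :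
    (c : ℝ) / 2 ^ J + (d : ℝ) / 2 ^ I ∈ dyadicGrid I ∩ dyadicCell J c := by
  have hp : (2 : ℝ) ^ I = 2 ^ J * 2 ^ (I - J) := by rw [← pow_add]; congr 1; omega
  refine ⟨⟨c * 2 ^ (I - J) + d, ?_⟩, ?_, ?_⟩
  · rw [hp]; push_cast; field_simp
  · simp; positivity
  · rw [add_div]
    refine (add_lt_add_iff_left _).2 ?_
    rw [div_lt_div_iff₀ (by positivity) (by positivity), hp]
    have : (d : ℝ) < 2 ^ (I - J) := by exact_mod_cast hd
    nlinarith [show (0 : ℝ) < 2 ^ J by positivity]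

/-- A cell whose level `i` grid points are all in the design contains many design points. -/
theorem two_pow_le_of_grid_subset_design {x : ℕ → ℝ} {n i J c : ℕ} {S : Set ℝ}
    (hS : dyadicCell J c ⊆ S) (h : dyadicGrid i ∩ S ⊆ design x n) (hJ : J ≤ i) :
    2 ^ (i - J) ≤ n := by
  have h1 : ∀ d ∈ Finset.range (2 ^ (i - J)),
      (c : ℝ) / 2 ^ J + (d : ℝ) / 2 ^ i ∈ (Finset.range n).image x := by
    intro d hd
    have := mem_grid_cell (c := c) hJ (Finset.mem_range.1 hd)
    obtain ⟨m, hm, hmd⟩ := h ⟨this.1, hS this.2⟩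
    exact Finset.mem_image.2 ⟨m, Finset.mem_range.2 hm, hmd⟩
  have h2 := Finset.card_le_card_of_injOn _ h1 fun d _ d' _ hdd =>
    dyadic_injective i (add_left_cancel hdd)
  rw [Finset.card_range] at h2
  exact h2.trans (Finset.card_image_le.trans (by simp))

theorem le_of_grid_subset_design {x : ℕ → ℝ} {n i J c : ℕ} {S : Set ℝ}
    (hS : dyadicCell J c ⊆ S) (h : dyadicGrid i ∩ S ⊆ design x n) : i ≤ J + Nat.log 2 n := by
  rcases le_or_gt i J with hi | hi
  · omega
  · have := Nat.le_log_of_pow_le (b := 2) (by norm_num)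
      (two_pow_le_of_grid_subset_design hS h hi.le)
    omega

theorem bddAbove_gridLevels {x : ℕ → ℝ} {n J c : ℕ} {S : Set ℝ} (hS : dyadicCell J c ⊆ S) :
    BddAbove {i | dyadicGrid i ∩ S ⊆ design x n} :=
  ⟨J + Nat.log 2 n, fun _ hi => le_of_grid_subset_design hS hi⟩

/-- The supremum is attained: a full grid in the cell inside `S_{j,k}` consists of design points,
which bounds the admissible levels by `j + log₂ n`. The hypothesis `j < obsLevel` excludes the empty
set, whose `sSup` is `0`. -/
theorem obsLevel_spec {L : ℕ} (hL : 1 ≤ L) {x : ℕ → ℝ} {n j k : ℕ} (hk : k < 2 ^ j)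
    (h : j < obsLevel L x n j k) :
    suppInterval L j k ∩ dyadicGrid (obsLevel L x n j k) ⊆ design x n ∧
      obsLevel L x n j k ≤ j + Nat.log 2 n := by
  have hS : dyadicCell j k ⊆ suppInterval L j k := cell_subset_suppInterval hL hk
  have hne : {i | j < i ∧ suppInterval L j k ∩ dyadicGrid i ⊆ design x n}.Nonempty := by
    by_contra hne
    rw [not_nonempty_iff_eq_empty] at hne
    simp [obsLevel, hne] at h
  have hb : BddAbove {i | j < i ∧ suppInterval L j k ∩ dyadicGrid i ⊆ design x n} :=
    ⟨j + Nat.log 2 n, fun i hi => le_of_grid_subset_design hS (by rw [inter_comm]; exact hi.2)⟩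
  have := (Nat.sSup_mem hne hb).2
  exact ⟨this, le_of_grid_subset_design hS (by rw [inter_comm]; exact this)⟩

theorem le_obsLevel {L : ℕ} (hL : 1 ≤ L) {x : ℕ → ℝ} {n i j k : ℕ} (hk : k < 2 ^ j)
    (hi : j < i) (h : suppInterval L j k ∩ dyadicGrid i ⊆ design x n) :
    i ≤ obsLevel L x n j k :=
  le_csSup ⟨j + Nat.log 2 n, fun i hi => le_of_grid_subset_design
    (cell_subset_suppInterval hL hk) (by rw [inter_comm]; exact hi.2)⟩ ⟨hi, h⟩

/-! ### Stage sizes -/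

namespace Tuning

variable {j₀ : ℕ}

theorem size_zero_pos (T : Tuning j₀) : 0 < T.size 0 := by
  obtain ⟨a, ha⟩ := T.size_zero
  rw [ha]; positivity

theorem size_strictMono (T : Tuning j₀) : StrictMono T.size := by
  obtain ⟨C, D, hC, h⟩ := T.size_ratio
  have hpos : ∀ m, 0 < T.size m := by
    intro m
    induction m with
    | zero => exact T.size_zero_pos
    | succ m ih =>
      have h1 : (0 : ℝ) < T.size m := by exact_mod_cast ih
      have h2 := (h m).1
      have : (0 : ℝ) < T.size (m + 1) := by nlinarith
      exact_mod_cast this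
  refine strictMono_nat_of_lt_succ fun m => ?_
  have h1 : (0 : ℝ) < T.size m := by exact_mod_cast hpos m
  have h2 := (h m).1
  have : (T.size m : ℝ) < T.size (m + 1) := by nlinarith
  exact_mod_cast this

theorem exists_stage (T : Tuning j₀) {n : ℕ} (hn : T.size 0 ≤ n) :
    ∃ m, T.size m ≤ n ∧ n < T.size (m + 1) := by
  have h := T.size_strictMono.tendsto_atTop
  obtain ⟨m', hm'⟩ := ((tendsto_atTop.1 h (n + 1)).exists)
  classical
  have hex : ∃ m, n < T.size m := ⟨m', hm'⟩
  have h1 := Nat.find_spec hex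
  have h0 : Nat.find hex ≠ 0 := fun h0 => by rw [h0] at h1; omega
  refine ⟨Nat.find hex - 1, ?_, ?_⟩
  · have := Nat.find_min hex (m := Nat.find hex - 1) (by omega)
    omega
  · rwa [Nat.sub_add_cancel (by omega)]

end Tuning

/-! ### Design points are distinct. -/

namespace IsRun

variable {j₀ N L : ℕ} {W : WaveletBasis j₀ N L} {T : Tuning j₀} {x Y : ℕ → ℝ}

theorem notMem_design (h : IsRun W T x Y) {n : ℕ} (hn : T.size 0 ≤ n) : x n ∉ design x n := by
  obtain ⟨-, rank, cell, h⟩ := h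
  obtain ⟨m, hm1, hm2⟩ := T.exists_stage hn
  obtain ⟨h1, h2⟩ := (h m).2 n hm1 hm2
  by_cases hd : dyadicGrid (T.jmax (T.size (m + 1))) ∩ Ico 0 1 ⊆ design x n
  · exact (h2 hd).2.2.1.2
  · exact (h1 hd).2

/-- The initial points are distinct by their formula, and each later point is chosen outside the
current design. -/
theorem injective (h : IsRun W T x Y) : Function.Injective x := by
  have key : ∀ m n, m < n → x m ≠ x n := by
    intro m n hmn he
    by_cases hn : T.size 0 ≤ n
    · exact h.notMem_design hn ⟨m, hmn, he⟩
    · push Not at hn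
      rw [h.1 m (hmn.trans hn), h.1 n hn] at he
      have : (T.size 0 : ℝ) ≠ 0 := by exact_mod_cast T.size_zero_pos.ne'
      rw [div_left_inj' this] at he
      exact hmn.ne (by exact_mod_cast he)
  intro m n he
  rcases lt_trichotomy m n with hmn | hmn | hmn
  · exact absurd he (key m n hmn)
  · exact hmn
  · exact absurd he.symm (key n m hmn)

end IsRun

/-! ### Target densities -/

open Classical in
theorem card_cell_subset_le {L J j k : ℕ} :
    (((Finset.range (2 ^ J)).filter fun l => dyadicCell J l ⊆ suppInterval L j k).card : ℝ) ≤
      2 * L * 2 ^ J / 2 ^ j := by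
  rcases Nat.eq_zero_or_pos L with hL | hL
  · subst hL
    rw [Finset.filter_false_of_mem]
    · simp
    · intro l _ h
      have h1 : (l : ℝ) / 2 ^ J ∈ dyadicCell J l := ⟨le_rfl, by gcongr; linarith⟩
      have h2 := (h h1).1
      simp only [mem_Ico] at h2
      have h3 := h2.1.trans_lt h2.2
      rw [div_lt_div_iff_of_pos_right (by positivity)] at h3
      norm_num at h3
  · set a : ℝ := ((k : ℝ) - L + 1) * 2 ^ J / 2 ^ j
    set b : ℝ := ((k : ℝ) + L) * 2 ^ J / 2 ^ j
    have hb : 0 ≤ b := by positivity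
    have hL' : (1 : ℝ) ≤ L := by exact_mod_cast hL
    have hab : b - a ≤ 2 * L * 2 ^ J / 2 ^ j := by
      rw [← sub_div, ← sub_mul]; gcongr; linarith
    have hab0 : 0 ≤ b - a := by
      rw [← sub_div, ← sub_mul]
      have : 0 ≤ (k : ℝ) + L - (k - L + 1) := by linarith
      positivity
    refine le_trans ?_ hab
    have hsub : ((Finset.range (2 ^ J)).filter fun l => dyadicCell J l ⊆ suppInterval L j k) ⊆
        Finset.Ico ⌈a⌉₊ ⌊b⌋₊ := by
      intro l hl
      have hl := (Finset.mem_filter.1 hl).2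
      have h1 := hl.trans inter_subset_left
      unfold dyadicCell at h1
      rw [Ico_subset_Ico_iff (by gcongr; linarith)] at h1
      obtain ⟨h1, h2⟩ := h1
      rw [div_le_div_iff₀ (by positivity) (by positivity)] at h1 h2
      rw [Finset.mem_Ico]
      constructor
      · refine Nat.ceil_le.2 ?_
        rw [div_le_iff₀ (by positivity)]; exact h1
      · refine Nat.lt_of_succ_le (Nat.le_floor ?_)
        rw [le_div_iff₀ (by positivity)]; push_cast; exact h2
    have hc := Finset.card_le_card hsub
    rw [Nat.card_Ico] at hc
    have hc' : (((Finset.range (2 ^ J)).filter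
        fun l => dyadicCell J l ⊆ suppInterval L j k).card : ℝ) ≤ (⌊b⌋₊ - ⌈a⌉₊ : ℕ) := by
      exact_mod_cast hc
    refine hc'.trans ?_
    rcases le_total ⌈a⌉₊ ⌊b⌋₊ with h | h
    · rw [Nat.cast_sub h]
      linarith [Nat.floor_le hb, Nat.le_ceil a]
    · rw [Nat.sub_eq_zero_of_le h]; simpa using hab0

/-- A ranking is a bijection onto `1, …, 2^j`, so this is a harmonic number, at most `1 + j log 2`.
-/
theorem sum_inv_rank_le {j : ℕ} {b : ℕ → ℝ} {rank : ℕ → ℕ} (h : IsRanking (2 ^ j) b rank) :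
    ∑ k ∈ Finset.range (2 ^ j), (1 : ℝ) / rank k ≤ j + 1 := by
  have h1 : ∑ k ∈ Finset.range (2 ^ j), (1 : ℝ) / rank k =
      ∑ i ∈ Finset.Icc 1 (2 ^ j), (1 : ℝ) / (i : ℕ) := by
    refine Finset.sum_nbij rank (fun k hk => ?_) (fun a ha b hb => ?_) (fun i hi => ?_)
      fun _ _ => rfl
    · have := h.1.mapsTo (show k ∈ Iio (2 ^ j) from Finset.mem_range.1 hk)
      simpa using this
    · exact h.1.injOn (by simpa using ha) (by simpa using hb)
    · obtain ⟨k, hk, rfl⟩ := h.1.surjOn (show i ∈ Icc 1 (2 ^ j) by simpa using hi)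
      exact ⟨k, by simpa using hk, rfl⟩
  rw [h1]
  have h2 := harmonic_le_one_add_log (2 ^ j)
  rw [harmonic_eq_sum_Icc] at h2
  push_cast at h2
  simp_rw [one_div]
  refine h2.trans ?_
  rw [Real.log_pow]
  have : Real.log 2 ≤ 1 := by linarith [Real.log_two_lt_d9]
  nlinarith [Nat.cast_nonneg (α := ℝ) j]

/-- The ranks `1, …, rank k` belong to coefficients at least as large as the one at `k`, so a rank
is bounded by counting large coefficients. -/
theorem IsRanking.le_card {K : ℕ} {b : ℕ → ℝ} {rank : ℕ → ℕ} (h : IsRanking K b rank) {k : ℕ}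
    (hk : k < K) : rank k ≤ ((Finset.range K).filter fun k' => |b k| ≤ |b k'|).card := by
  classical
  have hsub : Finset.Icc 1 (rank k) ⊆
      ((Finset.range K).filter fun k' => |b k| ≤ |b k'|).image rank := by
    intro i hi
    rw [Finset.mem_Icc] at hi
    have hk' : rank k ∈ Icc 1 K := h.1.mapsTo hk
    obtain ⟨k', hk', rfl⟩ := h.1.surjOn (show i ∈ Icc 1 K from ⟨hi.1, hi.2.trans hk'.2⟩)
    exact Finset.mem_image.2 ⟨k', Finset.mem_filter.2 ⟨Finset.mem_range.2 hk',
      h.2 k' hk' k hk hi.2⟩, rfl⟩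
  have := (Finset.card_le_card hsub).trans Finset.card_image_le
  simpa using this

namespace WaveletBasis

variable {j₀ N L : ℕ} (W : WaveletBasis j₀ N L) (T : Tuning j₀) (x Y : ℕ → ℝ)
  (rank : ℕ → ℕ → ℕ) (m l : ℕ)

open Classical in
/-- An upper bound for the target density, obtained by summing over all contributing wavelets. -/
def densityBound : ℝ :=
  T.lam + ∑ j ∈ Finset.Ico j₀ (T.jmax (T.size m)), ∑ k ∈ Finset.range (2 ^ j),
    if dyadicCell (T.jmax (T.size (m + 1))) l ⊆ suppInterval L j k then
      (2 : ℝ) ^ j / ((rank j k : ℝ) * (T.jmax (T.size m) : ℝ) ^ 2) else 0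

/-- Replacing the maximum by a sum loses nothing in the order of the total mass. It also shows that
the set is bounded above, which the lower bounds on its `sSup` require. -/
theorem le_densityBound : ∀ y ∈ {T.lam} ∪ {y | ∃ j k, j₀ ≤ j ∧ j < T.jmax (T.size m) ∧ k < 2 ^ j ∧
    dyadicCell (T.jmax (T.size (m + 1))) l ⊆ suppInterval L j k ∧
    W.betaThr T x Y (T.size m) j k ≠ 0 ∧
    y = (2 : ℝ) ^ j / ((rank j k : ℝ) * (T.jmax (T.size m) : ℝ) ^ 2)},
    y ≤ densityBound (L := L) T rank m l := by
  classical
  unfold densityBound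
  have h0 : ∀ j k, 0 ≤ if dyadicCell (T.jmax (T.size (m + 1))) l ⊆ suppInterval L j k then
      (2 : ℝ) ^ j / ((rank j k : ℝ) * (T.jmax (T.size m) : ℝ) ^ 2) else 0 := fun j k => by
    split_ifs <;> positivity
  rintro y (rfl | ⟨j, k, hj, hj', hk, hc, -, rfl⟩)
  · exact le_add_of_nonneg_right (Finset.sum_nonneg fun j _ => Finset.sum_nonneg fun k _ => h0 j k)
  · refine le_trans ?_ (le_add_of_nonneg_left T.lam_pos.le)
    refine le_trans ?_ (Finset.single_le_sum
      (fun j _ => Finset.sum_nonneg fun k _ => h0 j k) (Finset.mem_Ico.2 ⟨hj, hj'⟩))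
    refine le_trans ?_ (Finset.single_le_sum (fun k _ => h0 j k) (Finset.mem_range.2 hk))
    rw [if_pos hc]

theorem targetDensity_le : W.targetDensity T x Y rank m l ≤ densityBound (L := L) T rank m l :=
  csSup_le ⟨T.lam, Or.inl rfl⟩ (W.le_densityBound T x Y rank m l)

theorem lam_le_targetDensity : T.lam ≤ W.targetDensity T x Y rank m l :=
  le_csSup ⟨_, W.le_densityBound T x Y rank m l⟩ (Or.inl rfl)

theorem le_targetDensity {j k : ℕ} (hj : j₀ ≤ j) (hj' : j < T.jmax (T.size m)) (hk : k < 2 ^ j)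
    (hc : dyadicCell (T.jmax (T.size (m + 1))) l ⊆ suppInterval L j k)
    (hb : W.betaThr T x Y (T.size m) j k ≠ 0) :
    (2 : ℝ) ^ j / ((rank j k : ℝ) * (T.jmax (T.size m) : ℝ) ^ 2) ≤
      W.targetDensity T x Y rank m l :=
  le_csSup ⟨_, W.le_densityBound T x Y rank m l⟩ (Or.inr ⟨j, k, hj, hj', hk, hc, hb, rfl⟩)

variable {W T x Y rank m}

/-- A wavelet on level `j` covers at most `2 L 2^{J-j}` cells, which cancels the numerator `2^j`.
The harmonic sum over ranks costs a factor `J'` and there are at most `J'` levels; the normalisation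
`J'²` pays for both. -/
theorem sum_targetDensity_le (hrank : ∀ j, j₀ ≤ j → j < T.jmax (T.size m) →
      IsRanking (2 ^ j) (W.betaThr T x Y (T.size m) j) (rank j)) :
    ∑ l ∈ Finset.range (2 ^ T.jmax (T.size (m + 1))), W.targetDensity T x Y rank m l ≤
      (T.lam + 2 * L) * 2 ^ T.jmax (T.size (m + 1)) := by
  classical
  refine (Finset.sum_le_sum fun l _ => W.targetDensity_le T x Y rank m l).trans ?_
  unfold densityBound
  set J := T.jmax (T.size (m + 1))
  set J' := T.jmax (T.size m)
  have hJ' : (0 : ℝ) < J' := by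
    have := T.lt_jmax (T.size m)
    exact_mod_cast (by omega : 0 < J')
  rw [Finset.sum_add_distrib, Finset.sum_const, Finset.card_range, nsmul_eq_mul, add_mul,
    Finset.sum_comm]
  push_cast
  refine add_le_add (by rw [mul_comm]) ?_
  have hj : ∀ j ∈ Finset.Ico j₀ J', ∑ l ∈ Finset.range (2 ^ J), ∑ k ∈ Finset.range (2 ^ j),
      (if dyadicCell J l ⊆ suppInterval L j k then
        (2 : ℝ) ^ j / ((rank j k : ℝ) * (J' : ℝ) ^ 2) else 0) ≤ 2 * L * 2 ^ J / J' := by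
    intro j hj
    rw [Finset.mem_Ico] at hj
    rw [Finset.sum_comm]
    calc _ ≤ ∑ k ∈ Finset.range (2 ^ j), 2 * L * 2 ^ J / (J' : ℝ) ^ 2 * (1 / rank j k) := by
          refine Finset.sum_le_sum fun k _ => ?_
          rw [← Finset.sum_filter, Finset.sum_const, nsmul_eq_mul]
          calc _ ≤ 2 * L * 2 ^ J / 2 ^ j * ((2 : ℝ) ^ j / ((rank j k : ℝ) * (J' : ℝ) ^ 2)) := by
                gcongr; exact card_cell_subset_le
            _ = _ := by field_simp
      _ = 2 * L * 2 ^ J / (J' : ℝ) ^ 2 * ∑ k ∈ Finset.range (2 ^ j), (1 : ℝ) / rank j k := by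
          rw [Finset.mul_sum]
      _ ≤ 2 * L * 2 ^ J / (J' : ℝ) ^ 2 * J' := by
          gcongr
          refine (sum_inv_rank_le (hrank j hj.1 hj.2)).trans ?_
          exact_mod_cast hj.2
      _ = _ := by field_simp
  refine (Finset.sum_le_sum hj).trans ?_
  rw [Finset.sum_const, Nat.card_Ico, nsmul_eq_mul]
  calc _ ≤ (J' : ℝ) * (2 * L * 2 ^ J / J') := by
        gcongr; exact_mod_cast Nat.sub_le _ _
    _ = _ := by field_simp

end WaveletBasis

/-! ### The design produced by one stage -/

theorem dyadicCell_subset_Ico {J l : ℕ} (hl : l < 2 ^ J) : dyadicCell J l ⊆ Ico 0 1 := by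
  intro y ⟨h1, h2⟩
  have : (l : ℝ) + 1 ≤ 2 ^ J := by exact_mod_cast hl
  refine ⟨le_trans (by positivity) h1, h2.trans_le ?_⟩
  rw [div_le_one (by positivity)]; exact this

theorem exists_mem_dyadicCell {J : ℕ} {y : ℝ} (hy : y ∈ Ico (0 : ℝ) 1) :
    ∃ l : ℕ, l < 2 ^ J ∧ y ∈ dyadicCell J l := by
  have h0 : 0 ≤ y * 2 ^ J := mul_nonneg hy.1 (by positivity)
  refine ⟨⌊y * 2 ^ J⌋₊, ?_, ?_, ?_⟩
  · rw [Nat.floor_lt h0]; push_cast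
    exact mul_lt_of_lt_one_left (by positivity) hy.2
  · rw [div_le_iff₀ (by positivity)]; exact Nat.floor_le h0
  · rw [lt_div_iff₀ (by positivity)]; exact Nat.lt_floor_add_one _

/-- Always refining a cell that maximises `p / q` leaves every cell with a density of design
points that is at least of the order of its target density. -/
theorem grid_subset_design_of_selection {x p : ℕ → ℝ} {cell : ℕ → ℕ} {n₀ n' J : ℕ} {A : ℝ}
    (hinj : Function.Injective x) (hp : ∀ l, 0 < p l) (hn₀ : 0 < n₀)
    (hle : n₀ ≤ n')
    (hsum : ∑ l ∈ Finset.range (2 ^ J), p l ≤ A * 2 ^ J)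
    (h1 : ∀ n, n₀ ≤ n → n < n' → ¬ dyadicGrid J ∩ Ico 0 1 ⊆ design x n →
      x n ∈ dyadicGrid J ∩ Ico 0 1)
    (h2 : ∀ n, n₀ ≤ n → n < n' → dyadicGrid J ∩ Ico 0 1 ⊆ design x n → cell n < 2 ^ J ∧
      (∀ l < 2 ^ J, p l / effectiveDensity (design x n) n J l ≤
        p (cell n) / effectiveDensity (design x n) n J (cell n)) ∧
      x n ∈ missingPoints (design x n) J (cell n) (nextLevel (design x n) J (cell n)))
    {l₀ i : ℕ} (hl₀ : l₀ < 2 ^ J) (hi : 2 ^ i * A < p l₀ * (n' - n₀ - 2 ^ J)) :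
    dyadicGrid i ∩ dyadicCell J l₀ ⊆ design x n' := by
  classical
  -- If `l₀` is still incomplete on level `i` at the end, its effective level stays below `i`
  -- throughout. Maximality of `p / q` then allows a cell `c` to be refined only up to levels `h`
  -- with `2^h ≤ B c`, so the points added to `c` lie in `Q c`, which has at most `B c / 2^J`
  -- elements. Summing over the cells contradicts the number of points added.
  by_contra hcon
  set B : ℕ → ℝ := fun c => p c * 2 ^ i / p l₀ with hB
  have hB0 : ∀ c, 0 ≤ B c := fun c => by have := hp c; have := hp l₀; positivity
  set Q : ℕ → Finset ℝ := fun c => if J < Nat.log 2 ⌊B c⌋₊ then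
    (Finset.range (2 ^ (Nat.log 2 ⌊B c⌋₊ - J))).image
      (fun d : ℕ => (c : ℝ) / 2 ^ J + (d : ℝ) / 2 ^ Nat.log 2 ⌊B c⌋₊) else ∅ with hQ
  have hQcard : ∀ c, ((Q c).card : ℝ) ≤ B c / 2 ^ J := by
    intro c
    simp only [hQ]
    split_ifs with h
    · have hne : ⌊B c⌋₊ ≠ 0 := fun h0 => by simp [h0] at h
      have h3 : ((2 ^ Nat.log 2 ⌊B c⌋₊ : ℕ) : ℝ) ≤ B c :=
        (Nat.cast_le.2 (Nat.pow_log_le_self 2 hne)).trans (Nat.floor_le (hB0 c))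
      have h4 : (((Finset.range (2 ^ (Nat.log 2 ⌊B c⌋₊ - J))).image
        (fun d : ℕ => (c : ℝ) / 2 ^ J + (d : ℝ) / 2 ^ Nat.log 2 ⌊B c⌋₊)).card : ℝ) ≤
          ((2 ^ (Nat.log 2 ⌊B c⌋₊ - J) : ℕ) : ℝ) := by
        exact_mod_cast Finset.card_image_le.trans (by simp)
      refine h4.trans ?_
      rw [le_div_iff₀ (by positivity)]
      refine le_trans (le_of_eq ?_) h3
      push_cast
      rw [← pow_add]; congr 1; omega
    · simpa using div_nonneg (hB0 c) (by positivity)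
  -- While the grid of level `J` is incomplete the new point lies on that grid; afterwards it lies
  -- in some `Q c`.
  have hmem : ∀ n ∈ Finset.Ico n₀ n', x n ∈
      ((Finset.range (2 ^ J)).image fun l : ℕ => (l : ℝ) / 2 ^ J) ∪
        (Finset.range (2 ^ J)).biUnion Q := by
    intro n hn
    rw [Finset.mem_Ico] at hn
    rw [Finset.mem_union]
    by_cases hd : dyadicGrid J ∩ Ico 0 1 ⊆ design x n
    · right
      obtain ⟨hc, hmax, hx⟩ := h2 n hn.1 hn.2 hd
      set c := cell n with hcdef
      have hJmem : ∀ l < 2 ^ J, J ∈ {i | dyadicGrid i ∩ dyadicCell J l ⊆ design x n} :=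
        fun l hl y hy => hd ⟨hy.1, dyadicCell_subset_Ico hl hy.2⟩
      have hbdd : ∀ l, BddAbove {i | dyadicGrid i ∩ dyadicCell J l ⊆ design x n} := fun l =>
        bddAbove_gridLevels (Subset.refl _)
      set s : ℕ → ℕ := fun l => sSup {i | dyadicGrid i ∩ dyadicCell J l ⊆ design x n} with hs
      have hsl : s l₀ < i := by
        by_contra hcon'
        push Not at hcon'
        refine hcon fun y hy => design_mono x hn.2.le ?_
        exact Nat.sSup_mem ⟨J, hJmem l₀ hl₀⟩ (hbdd l₀) ⟨dyadicGrid_mono hcon' hy.1, hy.2⟩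
      have hsJ : J ≤ s c := le_csSup (hbdd c) (hJmem c hc)
      have hsB : ((2 ^ (s c + 1) : ℕ) : ℝ) ≤ B c := by
        have hm := hmax l₀ hl₀
        unfold effectiveDensity at hm
        have hn0 : (0 : ℝ) < n := by exact_mod_cast hn₀.trans_le hn.1
        rw [div_div_eq_mul_div, div_div_eq_mul_div,
          div_le_div_iff₀ (by positivity) (by positivity)] at hm
        have hm' : p l₀ * 2 ^ s c ≤ p c * 2 ^ s l₀ := by
          have : n * (p l₀ * 2 ^ s c) ≤ n * (p c * 2 ^ s l₀) := by
            calc _ = p l₀ * n * 2 ^ s c := by ring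
              _ ≤ _ := hm
              _ = _ := by ring
          exact le_of_mul_le_mul_left this hn0
        have h3 : (2 : ℝ) ^ (s l₀ + 1) ≤ 2 ^ i := pow_le_pow_right₀ (by norm_num) hsl
        rw [hB]
        dsimp only
        rw [le_div_iff₀ (hp l₀)]
        push_cast
        have := hp c
        calc (2 : ℝ) ^ (s c + 1) * p l₀ = 2 * (p l₀ * 2 ^ s c) := by ring
          _ ≤ 2 * (p c * 2 ^ s l₀) := by gcongr
          _ = p c * 2 ^ (s l₀ + 1) := by ring
          _ ≤ _ := by gcongr
      have hlog : s c + 1 ≤ Nat.log 2 ⌊B c⌋₊ :=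
        Nat.le_log_of_pow_le (by norm_num) (Nat.le_floor hsB)
      have hnext : nextLevel (design x n) J c ≤ s c + 1 := by
        refine Nat.sInf_le ?_
        show (missingPoints (design x n) J c (s c + 1)).Nonempty
        unfold missingPoints
        rw [sdiff_nonempty]
        intro hsub
        have := le_csSup (hbdd c) hsub
        change s c + 1 ≤ s c at this
        omega
      have hx' : x n ∈ dyadicGrid (Nat.log 2 ⌊B c⌋₊) ∩ dyadicCell J c :=
        ⟨dyadicGrid_mono (hnext.trans hlog) hx.1.1, hx.1.2⟩
      obtain ⟨d, hd, hxd⟩ := exists_of_mem_grid_cell (by omega) hx'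
      refine Finset.mem_biUnion.2 ⟨c, Finset.mem_range.2 hc, ?_⟩
      simp only [hQ]
      rw [if_pos (by omega)]
      exact Finset.mem_image.2 ⟨d, Finset.mem_range.2 hd, hxd.symm⟩
    · left
      obtain ⟨hg, hI⟩ := h1 n hn.1 hn.2 hd
      obtain ⟨l, hl, hc⟩ := exists_mem_dyadicCell (J := J) hI
      obtain ⟨d, hd, hxd⟩ := exists_of_mem_grid_cell le_rfl ⟨hg, hc⟩
      have : d = 0 := by simpa using hd
      refine Finset.mem_image.2 ⟨l, Finset.mem_range.2 hl, ?_⟩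
      rw [hxd, this]; simp
  have hcard := Finset.card_le_card_of_injOn x hmem hinj.injOn
  rw [Nat.card_Ico] at hcard
  have h3 : ((n' - n₀ : ℕ) : ℝ) ≤ 2 ^ J + A * 2 ^ i / p l₀ := by
    have h4 : (n' - n₀ : ℕ) ≤ 2 ^ J + ∑ c ∈ Finset.range (2 ^ J), (Q c).card := by
      refine hcard.trans ((Finset.card_union_le _ _).trans
        (add_le_add (Finset.card_image_le.trans (by simp)) Finset.card_biUnion_le))
    calc ((n' - n₀ : ℕ) : ℝ) ≤ 2 ^ J + ∑ c ∈ Finset.range (2 ^ J), ((Q c).card : ℝ) := by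
          exact_mod_cast h4
      _ ≤ 2 ^ J + ∑ c ∈ Finset.range (2 ^ J), p c * (2 ^ i / p l₀ / 2 ^ J) := by
          gcongr with c _
          refine (hQcard c).trans (le_of_eq ?_)
          rw [hB]; ring
      _ ≤ 2 ^ J + A * 2 ^ J * (2 ^ i / p l₀ / 2 ^ J) := by
          rw [← Finset.sum_mul]
          have := hp l₀
          gcongr
      _ = _ := by field_simp
  rw [Nat.cast_sub hle] at h3
  have h5 := hp l₀
  have h6 : p l₀ * ((n' : ℝ) - n₀ - 2 ^ J) ≤ A * 2 ^ i := by
    have : (n' : ℝ) - n₀ - 2 ^ J ≤ A * 2 ^ i / p l₀ := by linarith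
    rw [le_div_iff₀ h5] at this
    linarith
  linarith

/-! ### Observation levels -/

theorem Tuning.exists_jmax_bounds {j₀ : ℕ} (T : Tuning j₀) : ∃ c₁ > 0, ∃ c₂ > 0, ∃ n₁ : ℕ,
    3 ≤ n₁ ∧ ∀ n, n₁ ≤ n → c₁ * (n / Real.log n) ≤ (2 : ℝ) ^ T.jmax n ∧
      (2 : ℝ) ^ T.jmax n ≤ c₂ * (n / Real.log n) := by
  obtain ⟨c₂, hc₂, h2⟩ := T.jmax_order.1.exists_pos
  obtain ⟨c₁, hc₁, h1⟩ := T.jmax_order.2.exists_pos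
  rw [isBigOWith_iff] at h1 h2
  obtain ⟨n₁, hn₁⟩ := eventually_atTop.1 (h1.and h2)
  refine ⟨c₁⁻¹, by positivity, c₂, hc₂, max n₁ 3, le_max_right _ _, fun n hn => ?_⟩
  obtain ⟨h3, h4⟩ := hn₁ n ((le_max_left _ _).trans hn)
  have hn3 : (3 : ℝ) ≤ n := by exact_mod_cast (le_max_right _ _).trans hn
  have hlog : 0 ≤ Real.log n := Real.log_nonneg (by linarith)
  rw [Real.norm_of_nonneg (by positivity), Real.norm_of_nonneg (by positivity)] at h3 h4
  refine ⟨?_, h4⟩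
  rw [inv_mul_le_iff₀ hc₁]; exact h3

theorem Tuning.tendsto_size {j₀ : ℕ} (T : Tuning j₀) : Tendsto T.size atTop atTop :=
  T.size_strictMono.tendsto_atTop

/-- From some stage on, the number of points added in a stage exceeds the size of the initial
grid of that stage by a fraction of the total. -/
theorem Tuning.exists_stage_gap {j₀ : ℕ} (T : Tuning j₀) : ∃ c > 0, ∃ m₀ : ℕ, ∀ m, m₀ ≤ m →
    c * (T.size (m + 1) : ℝ) ≤
      (T.size (m + 1) : ℝ) - T.size m - 2 ^ T.jmax (T.size (m + 1)) := by
  obtain ⟨C, D, hC, hCD⟩ := T.size_ratio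
  obtain ⟨c₁, hc₁, c₂, hc₂, n₁, hn₁, hj⟩ := T.exists_jmax_bounds
  -- A stage adds at least the fraction `1 - 1 / C = 2 g` of the final number of points, and the
  -- initial grid, of size `O(n / log n)`, eventually takes at most the fraction `g`.
  set g := (1 - 1 / C) / 2 with hg
  have hg0 : 0 < g := by
    have : 1 / C < 1 := by rw [div_lt_one (by linarith)]; exact hC
    rw [hg]; linarith
  have hlog : ∀ᶠ m in atTop, c₂ / g ≤ Real.log (T.size (m + 1)) :=
    ((Real.tendsto_log_atTop.comp tendsto_natCast_atTop_atTop).comp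
      (T.tendsto_size.comp (tendsto_add_atTop_nat 1))).eventually_ge_atTop _
  have hn : ∀ᶠ m in atTop, n₁ ≤ T.size (m + 1) :=
    (T.tendsto_size.comp (tendsto_add_atTop_nat 1)).eventually_ge_atTop _
  obtain ⟨m₀, hm₀⟩ := eventually_atTop.1 (hlog.and hn)
  refine ⟨g, hg0, m₀, fun m hm => ?_⟩
  obtain ⟨h1, h2⟩ := hm₀ m hm
  have h3 := (hj _ h2).2
  have h4 : (0 : ℝ) ≤ T.size (m + 1) := Nat.cast_nonneg _
  have hl0 : 0 < Real.log (T.size (m + 1)) := lt_of_lt_of_le (by positivity) h1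
  have h5 : c₂ * (T.size (m + 1) / Real.log (T.size (m + 1))) ≤ g * T.size (m + 1) := by
    rw [← mul_div_assoc, div_le_iff₀ hl0]
    rw [div_le_iff₀ hg0] at h1
    nlinarith
  have h6 : (T.size m : ℝ) ≤ T.size (m + 1) / C := by
    rw [le_div_iff₀ (by linarith)]; linarith [(hCD m).1]
  have h7 : (T.size (m + 1) : ℝ) / C = T.size (m + 1) * (1 / C) := by ring
  have h8 : 1 / C = 1 - 2 * g := by rw [hg]; ring
  rw [h7, h8] at h6
  linarith

/-- For `J ≥ j` the end points `2^{-j}(k - L + 1)` and `2^{-j}(k + L)` lie in `2^{-J} ℤ`, so a cell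
in `[0,1)` that meets the interval is contained in it. -/
theorem suppInterval_cover {L J j k : ℕ} (hj : j ≤ J) {y : ℝ} (hy : y ∈ suppInterval L j k) :
    ∃ l : ℕ, l < 2 ^ J ∧ y ∈ dyadicCell J l ∧ dyadicCell J l ⊆ suppInterval L j k := by
  obtain ⟨l, hl, hyl⟩ := exists_mem_dyadicCell (J := J) hy.2
  refine ⟨l, hl, hyl, subset_inter ?_ (dyadicCell_subset_Ico hl)⟩
  obtain ⟨h1, h2⟩ := hy.1
  obtain ⟨h3, h4⟩ := hyl
  have hp : (2 : ℝ) ^ J = 2 ^ j * 2 ^ (J - j) := by rw [← pow_add]; congr 1; omega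
  have e : ∀ a : ℝ, a / 2 ^ j = a * 2 ^ (J - j) / 2 ^ J := fun a => by rw [hp]; field_simp
  have h5 := h1.trans_lt h4
  have h6 := h3.trans_lt h2
  rw [e, div_lt_div_iff_of_pos_right (by positivity)] at h5 h6
  have h5' : ((k : ℤ) - L + 1) * 2 ^ (J - j) < l + 1 := by exact_mod_cast h5
  have h6' : (l : ℤ) < (k + L) * 2 ^ (J - j) := by exact_mod_cast h6
  refine Ico_subset_Ico ?_ ?_
  · rw [e]; gcongr
    exact_mod_cast Int.lt_add_one_iff.1 h5'
  · rw [e]; gcongr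
    exact_mod_cast Int.add_one_le_iff.2 h6'

/-- After a (late) stage, all observation levels are of the order of the sample size, and those
below a detected coefficient are increased according to its rank. -/
theorem exists_obsLevel_bound {j₀ N L : ℕ} (W : WaveletBasis j₀ N L) (T : Tuning j₀) :
    ∃ c > 0, c ≤ 1 ∧ ∃ m₀ : ℕ, ∀ x Y : ℕ → ℝ, IsRun W T x Y → ∀ m, m₀ ≤ m → ∀ n, T.size (m + 1) ≤ n →
      (∀ j k, k < 2 ^ j → (2 : ℝ) * 2 ^ j ≤ c * T.size (m + 1) →
        j < obsLevel L x n j k ∧ c * T.size (m + 1) ≤ (2 : ℝ) ^ obsLevel L x n j k) ∧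
      ∀ j' k', j₀ ≤ j' → j' < T.jmax (T.size m) → j' ≤ T.jmax (T.size (m + 1)) → k' < 2 ^ j' →
        W.betaThr T x Y (T.size m) j' k' ≠ 0 →
        ∀ j k, k < 2 ^ j → (2 : ℝ) * 2 ^ j ≤ c * T.size (m + 1) →
          suppInterval L j k ⊆ suppInterval L j' k' →
          c * T.size (m + 1) * 2 ^ j' / (((Finset.range (2 ^ j')).filter fun k =>
            |W.betaThr T x Y (T.size m) j' k'| ≤ |W.betaThr T x Y (T.size m) j' k|).card *
              (T.jmax (T.size m) : ℝ) ^ 2) ≤ (2 : ℝ) ^ obsLevel L x n j k := by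
  obtain ⟨g, hg, m₀, hgap⟩ := T.exists_stage_gap
  have hL1 := W.one_le_L
  set A : ℝ := T.lam + 2 * L with hA
  have hlam := T.lam_pos
  have hA0 : 0 < A := by positivity
  set c₀ : ℝ := g / (2 * A) with hc₀
  have hc₀0 : 0 < c₀ := by positivity
  -- A cell `l` is filled on all levels with `2^i ≤ c₀ n' p l`; rounding down to a power of two
  -- costs the factor `1/2`. The last two entries serve the densities of detected coefficients and
  -- the floor `lam`.
  set c : ℝ := min 1 (min (c₀ / 2) (c₀ * T.lam / 2)) with hc
  have hc0 : 0 < c := by positivity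
  refine ⟨c, hc0, min_le_left _ _, m₀, fun x Y hrun m hm n hn => ?_⟩
  have hinj := hrun.injective
  obtain ⟨-, rank, cell, hrun⟩ := hrun
  obtain ⟨hrank, hsel⟩ := hrun m
  set n' := T.size (m + 1) with hn'
  set J := T.jmax n' with hJ
  set p := W.targetDensity T x Y (rank m) m with hp
  have hplam : ∀ l, T.lam ≤ p l := fun l => W.lam_le_targetDensity T x Y (rank m) m l
  have hp0 : ∀ l, 0 < p l := fun l => hlam.trans_le (hplam l)
  have hn'0 : (0 : ℝ) < n' := by
    have := T.size_strictMono.le_apply (x := m + 1)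
    exact_mod_cast (by omega : 0 < n')
  have key : ∀ l < 2 ^ J, ∀ i : ℕ, (2 : ℝ) ^ i ≤ c₀ * n' * p l →
      dyadicGrid i ∩ dyadicCell J l ⊆ design x n := by
    intro l hl i hi
    refine (grid_subset_design_of_selection (cell := cell) (n₀ := T.size m) (A := A) hinj hp0 ?_
      (T.size_strictMono.monotone (Nat.le_succ m)) (WaveletBasis.sum_targetDensity_le hrank)
      (fun n h1 h2 h3 => ((hsel n h1 h2).1 h3).1) (fun n h1 h2 h3 => ?_) hl ?_).trans
      (design_mono x hn)
    · exact T.size_zero_pos.trans_le (T.size_strictMono.monotone (Nat.zero_le m))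
    · obtain ⟨h4, h5, h6, -⟩ := (hsel n h1 h2).2 h3
      exact ⟨h4, h5, h6⟩
    · have h1 := hgap m hm
      have h2 := hp0 l
      calc (2 : ℝ) ^ i * A ≤ c₀ * n' * p l * A := by gcongr
        _ = p l * (g * n') / 2 := by rw [hc₀]; field_simp
        _ < p l * (g * n') := half_lt_self (by positivity)
        _ ≤ _ := by gcongr
  have hlog2 : ∀ X : ℝ, 1 ≤ X → ∃ i : ℕ, (2 : ℝ) ^ i ≤ X ∧ X < 2 * (2 : ℝ) ^ i := by
    intro X hX
    obtain ⟨i, h1, h2⟩ := exists_nat_pow_near hX (show (1 : ℝ) < 2 by norm_num)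
    exact ⟨i, h1, by rw [pow_succ] at h2; linarith⟩
  have part1 : ∀ j k, k < 2 ^ j → (2 : ℝ) * 2 ^ j ≤ c * n' →
      j < obsLevel L x n j k ∧ c * n' ≤ (2 : ℝ) ^ obsLevel L x n j k := by
    intro j k hk hj
    have h2j : (1 : ℝ) ≤ 2 ^ j := one_le_pow₀ (by norm_num)
    have hcn : c * n' ≤ c₀ * n' * T.lam / 2 := by
      have : c ≤ c₀ * T.lam / 2 := (min_le_right _ _).trans (min_le_right _ _)
      calc _ ≤ c₀ * T.lam / 2 * n' := by gcongr
        _ = _ := by ring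
    obtain ⟨i, hi1, hi2⟩ := hlog2 (c₀ * n' * T.lam) (by linarith)
    have hji : j < i := by
      have : (2 : ℝ) ^ j < 2 ^ i := by linarith
      exact (pow_lt_pow_iff_right₀ (by norm_num)).1 this
    have hle : i ≤ obsLevel L x n j k := by
      refine le_obsLevel hL1 hk hji fun y hy => ?_
      obtain ⟨l, hl, hyl⟩ := exists_mem_dyadicCell (J := J) hy.1.2
      refine key l hl i (hi1.trans ?_) ⟨hy.2, hyl⟩
      gcongr; exact hplam l
    refine ⟨hji.trans_le hle, ?_⟩
    have : (2 : ℝ) ^ i ≤ 2 ^ obsLevel L x n j k := pow_le_pow_right₀ (by norm_num) hle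
    linarith
  refine ⟨part1, fun j' k' hj' hj'' hjJ hk' hb j k hk hj hsub => ?_⟩
  set ρ := rank m j' k' with hρ
  have hρK := (hrank j' hj' hj'').le_card hk'
  have hρ1 : 1 ≤ ρ := ((hrank j' hj' hj'').1.mapsTo (show k' ∈ Iio (2 ^ j') from hk')).1
  set J' := T.jmax (T.size m)
  have hJ'0 : (0 : ℝ) < J' := by exact_mod_cast (by omega : 0 < J')
  set X : ℝ := c₀ * n' * (2 ^ j' / (ρ * (J' : ℝ) ^ 2)) with hX
  have hρ0 : (0 : ℝ) < ρ := by exact_mod_cast hρ1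
  have hXle : X / 2 ≤ (2 : ℝ) ^ obsLevel L x n j k := by
    have h1 : (1 : ℝ) ≤ 2 ^ obsLevel L x n j k := one_le_pow₀ (by norm_num)
    by_cases hX1 : X < 1
    · linarith
    push Not at hX1
    obtain ⟨i, hi1, hi2⟩ := hlog2 X hX1
    have hle : i ≤ obsLevel L x n j k := by
      -- `obsLevel` only records levels above `j`; for `i ≤ j` the first part already gives enough.
      by_cases hji : i ≤ j
      · exact hji.trans (part1 j k hk hj).1.le
      push Not at hji
      refine le_obsLevel hL1 hk hji fun y hy => ?_
      obtain ⟨l, hl, hyl, hlc⟩ := suppInterval_cover hjJ (hsub hy.1)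
      refine key l hl i (hi1.trans ?_) ⟨hy.2, hyl⟩
      rw [hX]
      gcongr
      exact W.le_targetDensity T x Y (rank m) m l hj' hj'' hk' hlc hb
    have : (2 : ℝ) ^ i ≤ 2 ^ obsLevel L x n j k := pow_le_pow_right₀ (by norm_num) hle
    linarith
  refine le_trans ?_ hXle
  have hcc : c ≤ c₀ / 2 := (min_le_right _ _).trans (min_le_left _ _)
  calc _ ≤ c₀ / 2 * n' * 2 ^ j' / (ρ * (J' : ℝ) ^ 2) := by
        gcongr
    _ = _ := by rw [hX]; ring

/-! ### Accuracy of the coefficient estimates -/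

namespace WaveletBasis

variable {j₀ N L : ℕ}

/-- All level estimates of the noise at time `n` are at most `κ` times their typical maximum. -/
def NoiseGood (W : WaveletBasis j₀ N L) (T : Tuning j₀) (κ : ℝ) (x ε : ℕ → ℝ) (n : ℕ) : Prop :=
  ∀ j k i, j₀ ≤ j → j < T.jmax n → k < 2 ^ j → j < i → i ≤ j + Nat.log 2 n →
    ∀ g, (g = W.φ j k ∨ g = W.ψ j k) →
      |W.levelEst x ε n i g| < κ * (T.σ * (2 : ℝ) ^ (-(i : ℝ) / 2) * √(2 * Real.log n))

/-- The regularity of `f` that the accuracy of the estimates depends on. -/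
structure Controlled (W : WaveletBasis j₀ N L) (M : ℝ) (f : ℝ → ℝ) : Prop where
  memLp : MemLp f 2 (volume.restrict (Ico (0 : ℝ) 1))
  series : W.IsSumOfSeries f
  coeffα_le : ∀ k < 2 ^ j₀, |W.coeffα f j₀ k| ≤ M
  coeffβ_le : ∀ j k, j₀ ≤ j → k < 2 ^ j → |W.coeffβ f j k| ≤ M * (2 : ℝ) ^ (-(j : ℝ))

/-- With `2^J = O(n / log n)` and `O(log n)` levels per coefficient, the union bound is
`O(n^{1-κ²})`, which tends to `0` since `κ > 1`. -/
theorem exists_measure_not_noiseGood_le (W : WaveletBasis j₀ N L) (T : Tuning j₀) {κ : ℝ}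
    (hκ : 1 < κ) {η : ℝ} (hη : 0 < η) : ∃ n₁ : ℕ, ∀ n, n₁ ≤ n → ∀ f : ℝ → ℝ,
      ∀ (Ω : Type*) [mΩ : MeasurableSpace Ω] (μ : Measure Ω) [IsProbabilityMeasure μ]
        (ε x Y : ℕ → Ω → ℝ) (ℱ : Filtration ℕ mΩ), SensingExperiment W T f μ ε x Y ℱ →
        μ {ω | ¬ W.NoiseGood T κ (fun i => x i ω) (fun i => ε i ω) n} ≤ ENNReal.ofReal η := by
  obtain ⟨c₁, -, c₂, hc₂, n₀, hn₀, hj⟩ := T.exists_jmax_bounds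
  have ht : Tendsto (fun n : ℕ => 4 * c₂ / Real.log 2 * ((n : ℝ) ^ (-(κ ^ 2 - 1)))) atTop
      (𝓝 (4 * c₂ / Real.log 2 * 0)) :=
    ((tendsto_rpow_neg_atTop (by nlinarith)).comp tendsto_natCast_atTop_atTop).const_mul _
  rw [mul_zero] at ht
  obtain ⟨n₁, hn₁⟩ := eventually_atTop.1 (ht.eventually_le_const hη)
  refine ⟨max n₀ n₁, fun n hn f Ω mΩ μ _ ε x Y ℱ hE => ?_⟩
  have h0 : n₀ ≤ n := (le_max_left _ _).trans hn
  have hn3 : (3 : ℝ) ≤ n := by exact_mod_cast hn₀.trans h0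
  have hlog : 0 < Real.log n := Real.log_pos (by linarith)
  have hlog2 : 0 < Real.log 2 := Real.log_pos (by norm_num)
  have hm := W.measure_exists_noise_ge_le (J := T.jmax n) (n := n) (κ := κ) T.σ_pos hE.noise_law
    hE.noise_adapted hE.noise_indep
    hE.design_adapted (fun ω => (hE.run ω).injective) (by omega) (by linarith)
  refine le_trans (measure_mono fun ω hω => ?_) (hm.trans (ENNReal.ofReal_le_ofReal ?_))
  · simp only [mem_ofPred_eq, NoiseGood] at hω ⊢
    push Not at hω
    obtain ⟨j, k, i, h1, h2, h3, h4, h5, g, h6, h7⟩ := hω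
    exact ⟨j, k, i, h1, h2, h3, h4, h5, g, h6, h7⟩
  · refine le_trans ?_ (hn₁ n ((le_max_right _ _).trans hn))
    have h1 := (hj n h0).2
    have h2 : (Nat.log 2 n : ℝ) ≤ Real.log n / Real.log 2 := by
      rw [le_div_iff₀ hlog2, ← Real.log_pow]
      refine Real.log_le_log (by positivity) ?_
      exact_mod_cast Nat.pow_log_le_self 2 (by omega)
    have h3 : (n : ℝ) ^ (-(κ ^ 2 - 1)) = n * (n : ℝ) ^ (-κ ^ 2) := by
      rw [show -(κ ^ 2 - 1) = 1 + -κ ^ 2 by ring, Real.rpow_add (by linarith), Real.rpow_one]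
    rw [h3]
    calc _ ≤ 4 * (c₂ * (n / Real.log n)) * (Real.log n / Real.log 2) * (n : ℝ) ^ (-κ ^ 2) := by
          gcongr
      _ = _ := by field_simp

/-- The error is bias plus noise. The bias is smaller than the noise bound by the factor `√log n`,
so for large `n` it fits into the gap `κ₂ - κ₁`. -/
theorem exists_coeff_close (W : WaveletBasis j₀ N L) (T : Tuning j₀) {M : ℝ} (hM : 0 < M)
    {κ₁ κ₂ : ℝ} (hκ : κ₁ < κ₂) : ∃ n₁ : ℕ, ∀ n, n₁ ≤ n → ∀ f : ℝ → ℝ, W.Controlled M f →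
      ∀ x Y ε : ℕ → ℝ, IsRun W T x Y → (∀ m, Y m = f (x m) + ε m) → W.NoiseGood T κ₁ x ε n →
      (∀ k < 2 ^ j₀, j₀ < obsLevel L x n j₀ k →
        |W.alphaHat x Y n k - W.coeffα f j₀ k| ≤ κ₂ * noiseBound L T.σ x n j₀ k) ∧
      ∀ j k, j₀ ≤ j → j < T.jmax n → k < 2 ^ j → j < obsLevel L x n j k →
        |W.betaHat x Y n j k - W.coeffβ f j k| ≤ κ₂ * noiseBound L T.σ x n j k := by
  obtain ⟨C, hC0, hC⟩ := W.exists_bias_bound hM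
  have hL := W.one_le_L
  have hκ' : 0 < κ₂ - κ₁ := by linarith
  have hσ := T.σ_pos
  have ht : Tendsto (fun n : ℕ => (κ₂ - κ₁) * T.σ * √(2 * Real.log n)) atTop atTop :=
    Tendsto.const_mul_atTop (by positivity) (Real.tendsto_sqrt_atTop.comp
      ((Real.tendsto_log_atTop.comp tendsto_natCast_atTop_atTop).const_mul_atTop two_pos))
  obtain ⟨n₁, hn₁⟩ := eventually_atTop.1 (ht.eventually_ge_atTop C)
  refine ⟨n₁, fun n hn f hf x Y ε hrun hY hgood => ?_⟩
  have hinj := hrun.injective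
  have main : ∀ j k i, j₀ ≤ j → j < T.jmax n → k < 2 ^ j → j < i → i ≤ j + Nat.log 2 n →
      suppInterval L j k ∩ dyadicGrid i ⊆ design x n →
      ∀ g, (g = W.φ j k ∨ g = W.ψ j k) → |W.levelEst x Y n i g - innerL2 f g| ≤
        κ₂ * (T.σ * (2 : ℝ) ^ (-(i : ℝ) / 2) * √(2 * Real.log n)) := by
    intro j k i hj hjJ hk hji hi hobs g hg
    have h1 := hgood j k i hj hjJ hk hji hi g hg
    have hYe : Y = fun m => f (x m) + ε m := funext hY
    -- The finite refinement filters make the coefficient depend only on grid points in `S_{j,k}`,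
    -- all of which have been observed.
    have hzero : ∀ l : ℕ, l < 2 ^ i → (l : ℝ) / 2 ^ i ∉ design x n → innerL2 (W.φ i l) g = 0 := by
      intro l hl hn
      have hns : (l : ℝ) / 2 ^ i ∉ suppInterval L j k := fun hs =>
        hn (hobs ⟨hs, (l : ℤ), by push_cast; rfl⟩)
      rcases hg with rfl | rfl
      · exact W.filter_φ i j k l hj hji hk hl hns
      · exact W.filter_ψ i j k l hj hji hk hl hns
    have h2 : |∑ l ∈ Finset.range (2 ^ i), (2 : ℝ) ^ (-(i : ℝ) / 2) * f ((l : ℝ) / 2 ^ i) *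
        innerL2 (W.φ i l) g - innerL2 f g| ≤ C * (2 : ℝ) ^ (-(i : ℝ) / 2) := by
      refine hC f hf.memLp hf.series hf.coeffα_le hf.coeffβ_le i (by omega) g ?_ ?_ ?_ ?_
      · rcases hg with rfl | rfl
        · exact W.measurable_φ j k hj hk
        · exact W.measurable_ψ j k hj hk
      · rcases hg with rfl | rfl
        · exact W.exists_bound_φ hj hk
        · exact W.exists_bound_ψ hj hk
      · intro j' k' hj' hk'
        rcases hg with rfl | rfl
        · exact W.φ_ψ j j' k k' hj (by omega) hk hk'
        · rw [W.ψ_ψ j j' k k' hj (by omega) hk hk', if_neg (by omega)]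
      · rcases hg with rfl | rfl
        · rw [W.φ_φ j k k hj hk hk, if_pos rfl]
        · rw [W.ψ_ψ j j k k hj hj hk hk, if_pos ⟨rfl, rfl⟩]
    rw [hYe, W.levelEst_add x (fun m => f (x m)) ε, W.levelEst_comp hinj f hzero]
    set S := ∑ l ∈ Finset.range (2 ^ i), (2 : ℝ) ^ (-(i : ℝ) / 2) * f ((l : ℝ) / 2 ^ i) *
        innerL2 (W.φ i l) g
    have h3 : S + W.levelEst x ε n i g - innerL2 f g =
        (S - innerL2 f g) + W.levelEst x ε n i g := by ring
    rw [h3]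
    have h4 := hn₁ n hn
    have hq : 0 < (2 : ℝ) ^ (-(i : ℝ) / 2) := by positivity
    have h5 : C * (2 : ℝ) ^ (-(i : ℝ) / 2) ≤
        (κ₂ - κ₁) * T.σ * √(2 * Real.log n) * (2 : ℝ) ^ (-(i : ℝ) / 2) := by gcongr
    refine (abs_add_le _ _).trans ((add_le_add h2 h1.le).trans ?_)
    linarith
  refine ⟨fun k hk hobs => ?_, fun j k hj hjJ hk hobs => ?_⟩
  · obtain ⟨h1, h2⟩ := obsLevel_spec hL hk hobs
    unfold alphaHat
    rw [if_pos hobs]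
    exact main j₀ k _ le_rfl (T.lt_jmax n) hk hobs h2 h1 _ (Or.inl rfl)
  · obtain ⟨h1, h2⟩ := obsLevel_spec hL hk hobs
    unfold betaHat
    rw [if_pos hobs]
    exact main j k _ hj hjJ hk hobs h2 h1 _ (Or.inr rfl)

end WaveletBasis

/-- Hard thresholding of an accurate estimate. -/
theorem threshold_bounds {κ κ₂ e b bh bt : ℝ} (h1 : 0 < κ₂) (h2 : κ₂ < κ) (he : 0 ≤ e)
    (hbt : bt = if κ * e ≤ |bh| then bh else 0) (hb : |bh - b| ≤ κ₂ * e) :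
    |bt - b| ≤ (κ + κ₂ / (κ - κ₂) + κ₂ + 1) * min |b| e ∧
      |bt| ≤ (1 + κ₂ / (κ - κ₂)) * |b| ∧
      (|b| ≤ (κ + κ₂) * e ∨ (bt ≠ 0 ∧ κ / (κ + κ₂) * |b| ≤ |bt|)) := by
  have h3 : 0 < κ - κ₂ := by linarith
  have h0 : 0 < κ := by linarith
  have h4 : |bh| ≤ |b| + κ₂ * e := by
    have := abs_add_le (bh - b) b
    rw [sub_add_cancel] at this; linarith
  have h5 : |b| ≤ |bh| + κ₂ * e := by
    have := abs_add_le (b - bh) bh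
    rw [sub_add_cancel, abs_sub_comm] at this; linarith
  have hK : 0 ≤ κ₂ / (κ - κ₂) := by positivity
  split_ifs at hbt with h
  · subst hbt
    -- Passing the threshold forces `(κ - κ₂) e ≤ |b|`; the strict gap between `κ₂` and `κ` is
    -- needed here.
    have h6 : e ≤ |b| / (κ - κ₂) := by
      rw [le_div_iff₀ h3]; linarith
    have h7 : κ₂ * e ≤ κ₂ / (κ - κ₂) * |b| := by
      calc κ₂ * e ≤ κ₂ * (|b| / (κ - κ₂)) := by gcongr
        _ = _ := by ring
    refine ⟨?_, by linarith, ?_⟩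
    · rcases min_choice |b| e with hm | hm <;> rw [hm]
      · have := abs_nonneg b; nlinarith
      · have : 0 ≤ (κ + κ₂ / (κ - κ₂) + 1) * e := by positivity
        linarith
    · by_cases h8 : |b| ≤ (κ + κ₂) * e
      · exact Or.inl h8
      push Not at h8
      refine Or.inr ⟨fun h9 => ?_, ?_⟩
      · rw [h9, abs_zero, zero_add] at h5
        have : 0 ≤ κ * e := by positivity
        linarith
      · rw [div_mul_eq_mul_div, div_le_iff₀ (by linarith)]
        nlinarith
  · subst hbt
    push Not at h
    have h8 : |b| ≤ (κ + κ₂) * e := by linarith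
    refine ⟨?_, by simp; positivity, Or.inl h8⟩
    rw [zero_sub, abs_neg]
    rcases min_choice |b| e with hm | hm <;> rw [hm]
    · have := abs_nonneg b; nlinarith
    · have : 0 ≤ (κ₂ / (κ - κ₂) + 1) * e := by positivity
      linarith

/-! ### Noise levels along the stages of the algorithm -/

theorem noiseBound_nonneg {L : ℕ} {σ : ℝ} (hσ : 0 ≤ σ) (x : ℕ → ℝ) (n j k : ℕ) :
    0 ≤ noiseBound L σ x n j k := by
  unfold noiseBound; positivity

theorem noiseBound_sq {L : ℕ} (σ : ℝ) (x : ℕ → ℝ) {n : ℕ} (hn : 1 ≤ n) (j k : ℕ) :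
    noiseBound L σ x n j k ^ 2 = σ ^ 2 * (2 * Real.log n) / 2 ^ obsLevel L x n j k := by
  have hlog : 0 ≤ Real.log n := Real.log_nonneg (by exact_mod_cast hn)
  unfold noiseBound
  rw [mul_pow, mul_pow, Real.sq_sqrt (by positivity), ← Real.rpow_natCast ((2 : ℝ) ^ _),
    ← Real.rpow_mul (by norm_num), ← Real.rpow_natCast 2 (obsLevel L x n j k),
    div_eq_mul_inv (σ ^ 2 * _), ← Real.rpow_neg (by norm_num)]
  have : -(obsLevel L x n j k : ℝ) / 2 * (2 : ℕ) = -(obsLevel L x n j k : ℝ) := by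
    push_cast; ring
  rw [this]; ring

/-- Applied with `l = log n`, `a = 2^{j'}`, `J` the maximal level of the stage, `S` the number of
coefficients ranked at least as high, and `b` the `P`-th power of the detected coefficient. One
logarithm comes from the noise bound and two from the `J²` in the target density. -/
theorem noise_sq_mul_le {s l c n D a S J q b E g O : ℝ} (hs : 0 < s) (hl : 0 < l) (hn : 0 < n)
    (hc : 0 < c) (hD : 0 < D) (ha : 0 < a) (hS : 0 < S) (hJ : 0 < J) (hq : 0 < q) (hb : 0 ≤ b)
    (hO : c * (n / D) * a / (S * J ^ 2) ≤ O) (hJl : J ≤ 2 * l) (hSb : S * b ≤ E * g)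
    (hgq : g * q = a) :
    s * (2 * l) / O * (q * b) ≤ 2 * s * D / c * (4 * E) * (l ^ 3 / n) := by
  have hO' : 0 < c * (n / D) * a / (S * J ^ 2) := by positivity
  calc s * (2 * l) / O * (q * b) ≤ s * (2 * l) / (c * (n / D) * a / (S * J ^ 2)) * (q * b) := by
        gcongr
    _ = 2 * s * D / c * (l / n * J ^ 2 / a) * q * (S * b) := by field_simp
    _ ≤ 2 * s * D / c * (l / n * (2 * l) ^ 2 / a) * q * (E * g) := by gcongr
    _ = 2 * s * D / c * (l / n * (2 * l) ^ 2 / a) * E * (g * q) := by ring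
    _ = _ := by rw [hgq]; field_simp; ring

namespace WaveletBasis

variable {j₀ N L : ℕ}

/-- The midpoint `κ₂` of `κ` and `T.κ` leaves room for the bias below it and for thresholding above
it. Besides the error bound, the two-sided comparison of thresholded and true coefficients is what
turns empirical ranks into counts of true coefficients. The condition `n ≤ D * T.size m` makes all
times involved comparable to `n`. -/
theorem exists_estimates (W : WaveletBasis j₀ N L) (T : Tuning j₀) {M : ℝ} (hM : 0 < M)
    {κ : ℝ} (hκ1 : 1 < κ) (hκ : κ < T.κ) {D : ℝ} (hD : 1 ≤ D) :
    ∃ C : ℝ, 1 ≤ C ∧ ∃ n₁ : ℕ, ∀ n, n₁ ≤ n → ∀ f : ℝ → ℝ, W.Controlled M f →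
      ∀ x Y ε : ℕ → ℝ, IsRun W T x Y → (∀ m, Y m = f (x m) + ε m) →
      ∀ m ν, T.size (m + 1) ≤ ν → ν ≤ n → (n : ℝ) ≤ D * T.size m →
      (∀ j k, j < T.jmax n → k < 2 ^ j →
        noiseBound L T.σ x ν j k ^ 2 ≤ C * (Real.log n / n)) ∧
      (W.NoiseGood T κ x ε ν →
      (∀ k < 2 ^ j₀, |W.alphaHat x Y ν k - W.coeffα f j₀ k| ≤
        C * noiseBound L T.σ x ν j₀ k) ∧
      ∀ j k, j₀ ≤ j → j < T.jmax n → j < T.jmax ν → k < 2 ^ j →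
        |W.betaThr T x Y ν j k - W.coeffβ f j k| ≤
          C * min |W.coeffβ f j k| (noiseBound L T.σ x ν j k) ∧
        |W.betaThr T x Y ν j k| ≤ C * |W.coeffβ f j k| ∧
        (|W.coeffβ f j k| ≤ C * noiseBound L T.σ x ν j k ∨
          (W.betaThr T x Y ν j k ≠ 0 ∧ |W.coeffβ f j k| ≤ C * |W.betaThr T x Y ν j k|))) := by
  obtain ⟨c, hc, -, m₀, hobs⟩ := exists_obsLevel_bound W T
  obtain ⟨c₁, -, c₂, hc₂, n₀, hn₀, hj⟩ := T.exists_jmax_bounds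
  set κ₂ := (κ + T.κ) / 2 with hκ₂
  have hκκ : κ < κ₂ := by linarith
  have hκ₂T : κ₂ < T.κ := by linarith
  have hκ₂0 : 0 < κ₂ := by linarith
  have hκ₂d : 0 < T.κ - κ₂ := by linarith
  have hTκ : 0 < T.κ := by linarith
  obtain ⟨n₂, hclose⟩ := W.exists_coeff_close T hM hκκ
  have hσ := T.σ_pos
  have hD0 : 0 < D := by linarith
  set C : ℝ := (T.κ + κ₂ / (T.κ - κ₂) + κ₂ + 1) + (T.κ + κ₂) / T.κ + 2 * T.σ ^ 2 * D / c with hC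
  have hC0 : 0 ≤ κ₂ / (T.κ - κ₂) := by positivity
  have hC1 : 0 ≤ (T.κ + κ₂) / T.κ := by positivity
  have hC2 : 0 ≤ 2 * T.σ ^ 2 * D / c := by positivity
  have hlogt : Tendsto (fun n : ℕ => Real.log n) atTop atTop :=
    Real.tendsto_log_atTop.comp tendsto_natCast_atTop_atTop
  obtain ⟨n₁, hn₁⟩ := eventually_atTop.1
    ((hlogt.eventually_ge_atTop (c₂ * D / c)).and
      (tendsto_natCast_atTop_atTop.eventually_ge_atTop
        (D * ((T.size m₀ : ℝ) + n₀ + n₂ + 1))))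
  refine ⟨C, by linarith, max n₁ n₀, fun n hn f hf x Y ε hrun hY m ν hν hνn hnD => ?_⟩
  obtain ⟨h1, h2⟩ := hn₁ n ((le_max_left _ _).trans hn)
  have hn0 := (le_max_right _ _).trans hn
  have hm₀ : (T.size m₀ : ℝ) + n₀ + n₂ + 1 ≤ T.size m := by
    have := h2.trans hnD
    exact le_of_mul_le_mul_left this hD0
  have hm₀' : T.size m₀ + n₀ + n₂ + 1 ≤ T.size m := by exact_mod_cast hm₀
  have hmm : m₀ ≤ m := by
    have : T.size m₀ ≤ T.size m := by omega
    exact (T.size_strictMono.le_iff_le).1 this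
  have hsz : T.size m ≤ T.size (m + 1) := T.size_strictMono.monotone (Nat.le_succ m)
  obtain ⟨hb1, -⟩ := hobs x Y hrun m hmm ν hν
  have hn3 : (3 : ℝ) ≤ n := by exact_mod_cast hn₀.trans hn0
  have hln : 0 < Real.log n := Real.log_pos (by linarith)
  have hν1 : 1 ≤ ν := by omega
  have hsz' : (n : ℝ) / D ≤ T.size (m + 1) := by
    rw [div_le_iff₀ hD0, mul_comm]
    refine hnD.trans ?_
    gcongr
  have hlevel : ∀ j, j < T.jmax n → (2 : ℝ) * 2 ^ j ≤ c * T.size (m + 1) := by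
    intro j hjn
    calc (2 : ℝ) * 2 ^ j = 2 ^ (j + 1) := by ring
      _ ≤ 2 ^ T.jmax n := pow_le_pow_right₀ (by norm_num) hjn
      _ ≤ c₂ * (n / Real.log n) := (hj n hn0).2
      _ ≤ c * (n / D) := by
        rw [div_le_iff₀ hc] at h1
        rw [← mul_div_assoc, ← mul_div_assoc, div_le_div_iff₀ hln hD0]
        have : (0 : ℝ) ≤ n := by linarith
        nlinarith
      _ ≤ _ := by gcongr
  refine ⟨fun j k hjn hk => ?_, fun hgood => ⟨fun k hk => ?_, fun j k hj₀ hjn hjν hk => ?_⟩⟩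
  · obtain ⟨h3, h4⟩ := hb1 j k hk (hlevel j hjn)
    rw [noiseBound_sq T.σ x hν1]
    have h5 : c * (n / D) ≤ (2 : ℝ) ^ obsLevel L x ν j k := le_trans (by gcongr) h4
    calc _ ≤ T.σ ^ 2 * (2 * Real.log n) / (c * (n / D)) := by gcongr
      _ = 2 * T.σ ^ 2 * D / c * (Real.log n / n) := by field_simp
      _ ≤ C * (Real.log n / n) := by
        gcongr; linarith
  · obtain ⟨h3, -⟩ := hb1 j₀ k hk (hlevel j₀ (T.lt_jmax n))
    refine ((hclose ν (by omega) f hf x Y ε hrun hY hgood).1 k hk h3).trans ?_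
    have := noiseBound_nonneg (L := L) hσ.le x ν j₀ k
    gcongr; linarith
  · obtain ⟨h3, -⟩ := hb1 j k hk (hlevel j hjn)
    have h4 := (hclose ν (by omega) f hf x Y ε hrun hY hgood).2 j k hj₀ hjν hk h3
    have he := noiseBound_nonneg (L := L) hσ.le x ν j k
    obtain ⟨h5, h6, h7⟩ := threshold_bounds (bt := W.betaThr T x Y ν j k) hκ₂0 hκ₂T he rfl h4
    refine ⟨h5.trans ?_, h6.trans ?_, ?_⟩
    · have : 0 ≤ min |W.coeffβ f j k| (noiseBound L T.σ x ν j k) := le_min (abs_nonneg _) he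
      gcongr; linarith
    · gcongr; linarith
    · rcases h7 with h7 | ⟨h7, h8⟩
      · left
        refine h7.trans ?_
        gcongr; linarith
      · right
        refine ⟨h7, ?_⟩
        rw [div_mul_eq_mul_div, div_le_iff₀ (by linarith)] at h8
        calc |W.coeffβ f j k| ≤ (T.κ + κ₂) / T.κ * |W.betaThr T x Y ν j k| := by
              rw [div_mul_eq_mul_div, le_div_iff₀ hTκ]; linarith
          _ ≤ _ := by gcongr; linarith

set_option maxHeartbeats 1000000 in
/-- Either a coefficient is below the noise level after a stage, or the noise level of all
coefficients supported inside its support is reduced during the next stage. -/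
theorem exists_adaptive_noiseBound (W : WaveletBasis j₀ N L) (T : Tuning j₀) {M : ℝ} (hM : 0 < M)
    {κ : ℝ} (hκ1 : 1 < κ) (hκ : κ < T.κ) {D : ℝ} (hD : 1 ≤ D) {P r B : ℝ} (hP : 0 < P)
    (hB : 0 < B) :
    ∃ C : ℝ, 1 ≤ C ∧ ∃ c > 0, ∃ n₁ : ℕ, ∀ n, n₁ ≤ n → ∀ f : ℝ → ℝ, W.Controlled M f →
      (∀ j, j₀ ≤ j → ∑ k ∈ Finset.range (2 ^ j), |W.coeffβ f j k| ^ P ≤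
        B * (2 : ℝ) ^ (-((j : ℝ) * (P * (r + 1 / 2) - 1)))) →
      ∀ x Y ε : ℕ → ℝ, IsRun W T x Y → (∀ m, Y m = f (x m) + ε m) →
      ∀ m ν, T.size (m + 2) ≤ ν → ν ≤ n → (n : ℝ) ≤ D * T.size m →
      W.NoiseGood T κ x ε (T.size (m + 1)) →
      ∀ j k j' k', j₀ ≤ j' → (2 : ℝ) ^ j' ≤ c * (n / Real.log n) → k' < 2 ^ j' → j < T.jmax n →
        k < 2 ^ j → suppInterval L j k ⊆ suppInterval L j' k' →
        |W.coeffβ f j' k'| ≤ C * noiseBound L T.σ x (T.size (m + 1)) j' k' ∨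
        noiseBound L T.σ x ν j k ^ 2 * ((2 : ℝ) ^ ((j' : ℝ) * (r + 1 / 2)) *
          |W.coeffβ f j' k'|) ^ P ≤ C * (Real.log n ^ 3 / n) := by
  obtain ⟨K, hK, n₂, hest⟩ := W.exists_estimates T hM hκ1 hκ hD
  obtain ⟨c, hc, -, m₀, hobs⟩ := exists_obsLevel_bound W T
  obtain ⟨c₁, hc₁, c₂, hc₂, n₀, hn₀, hj⟩ := T.exists_jmax_bounds
  have hσ := T.σ_pos
  have hD0 : 0 < D := by linarith
  have hK0 : 0 < K := by linarith
  set C : ℝ := K + 2 * T.σ ^ 2 * D / c * (4 * ((K * K) ^ P * B)) with hC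
  have hC2 : 0 ≤ 2 * T.σ ^ 2 * D / c * (4 * ((K * K) ^ P * B)) := by positivity
  have hlogt : Tendsto (fun n : ℕ => Real.log n) atTop atTop :=
    Real.tendsto_log_atTop.comp tendsto_natCast_atTop_atTop
  obtain ⟨n₁, hn₁⟩ := eventually_atTop.1
    ((hlogt.eventually_ge_atTop (c₂ * D / c)).and
      (tendsto_natCast_atTop_atTop.eventually_ge_atTop
        (D * ((T.size m₀ : ℝ) + n₀ + Real.exp c₂ + 1))))
  -- The constant `c₁ / (2 D)` keeps `j'` below the maximal level already at the time when the ranks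
  -- are computed, where the sample size may be smaller than `n` by the factor `D`.
  refine ⟨C, by linarith, c₁ / (2 * D), by positivity, max (max n₁ n₀) n₂,
    fun n hn f hf hbes x Y ε hrun hY m ν hν hνn hnD hgood j k j' k' hj' hjc hk' hjn hk hsub => ?_⟩
  obtain ⟨h1, h2⟩ := hn₁ n ((le_max_left _ _).trans ((le_max_left _ _).trans hn))
  have hn0 := (le_max_right _ _).trans ((le_max_left _ _).trans hn)
  have hm₀ : (T.size m₀ : ℝ) + n₀ + Real.exp c₂ + 1 ≤ T.size m := by
    have := h2.trans hnD
    exact le_of_mul_le_mul_left this hD0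
  have hexp := Real.exp_pos c₂
  have hm₀' : T.size m₀ + n₀ ≤ T.size m := by
    have : (T.size m₀ : ℝ) + n₀ ≤ T.size m := by linarith
    exact_mod_cast this
  have hmm : m₀ ≤ m := by
    have : T.size m₀ ≤ T.size m := by omega
    exact (T.size_strictMono.le_iff_le).1 this
  have hsz : T.size m ≤ T.size (m + 1) := T.size_strictMono.monotone (Nat.le_succ m)
  have hsz2 : T.size (m + 1) ≤ T.size (m + 2) := T.size_strictMono.monotone (Nat.le_succ _)
  have hn3 : (3 : ℝ) ≤ n := by exact_mod_cast hn₀.trans hn0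
  have hln : 0 < Real.log n := Real.log_pos (by linarith)
  have hnD2 : (n : ℝ) ≤ D * T.size (m + 1) := hnD.trans (by gcongr)
  have hjm : ∀ ν' : ℕ, T.size m ≤ ν' → ν' ≤ n → j' < T.jmax ν' := by
    intro ν' hν1 hν2
    have h3 := (hj ν' (by omega)).1
    have hν0 : (1 : ℝ) < ν' := by
      have : (T.size m : ℝ) ≤ ν' := by exact_mod_cast hν1
      have : (0 : ℝ) ≤ T.size m₀ := Nat.cast_nonneg _
      have : (3 : ℝ) ≤ n₀ := by exact_mod_cast hn₀
      linarith
    have h4 : (n : ℝ) / D ≤ ν' := by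
      rw [div_le_iff₀ hD0, mul_comm]
      exact hnD.trans (by gcongr)
    have h5 : c₁ * (n / D / Real.log n) ≤ 2 ^ T.jmax ν' := by
      refine le_trans ?_ h3
      have := Real.log_pos hν0
      gcongr
    have h6 : (2 : ℝ) ^ j' < 2 ^ T.jmax ν' := by
      refine lt_of_lt_of_le (hjc.trans_lt ?_) h5
      have : c₁ / (2 * D) * (n / Real.log n) = c₁ * (n / D / Real.log n) / 2 := by field_simp
      rw [this]
      exact half_lt_self (by positivity)
    exact (pow_lt_pow_iff_right₀ (by norm_num)).1 h6
  have hnm1 : T.size (m + 1) ≤ n := by omega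
  have hest' := ((hest n ((le_max_right _ _).trans hn) f hf x Y ε hrun hY m (T.size (m + 1))
    le_rfl hnm1 hnD).2 hgood).2
  have hj'n : j' < T.jmax n := hjm n (by omega) le_rfl
  have hj'1 : j' < T.jmax (T.size (m + 1)) := hjm _ hsz hnm1
  have hj'2 : j' < T.jmax (T.size (m + 2)) := hjm _ (by omega) (by omega)
  obtain ⟨-, -, h3⟩ := hest' j' k' hj' hj'n hj'1 hk'
  rcases h3 with h3 | ⟨h3, h4⟩
  · left
    refine h3.trans ?_
    have := noiseBound_nonneg (L := L) hσ.le x (T.size (m + 1)) j' k'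
    gcongr; linarith
  right
  have hlevel : (2 : ℝ) * 2 ^ j ≤ c * T.size (m + 2) := by
    calc (2 : ℝ) * 2 ^ j = 2 ^ (j + 1) := by ring
      _ ≤ 2 ^ T.jmax n := pow_le_pow_right₀ (by norm_num) hjn
      _ ≤ c₂ * (n / Real.log n) := (hj n hn0).2
      _ ≤ c * (n / D) := by
        rw [div_le_iff₀ hc] at h1
        rw [← mul_div_assoc, ← mul_div_assoc, div_le_div_iff₀ hln hD0]
        have : (0 : ℝ) ≤ n := by linarith
        nlinarith
      _ ≤ c * T.size (m + 2) := by
        gcongr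
        rw [div_le_iff₀ hD0, mul_comm]
        exact hnD2.trans (by gcongr)
  have h5 := (hobs x Y hrun (m + 1) (by omega) ν hν).2 j' k' hj' hj'1 hj'2.le hk' h3 j k hk hlevel
    hsub
  set S := (Finset.range (2 ^ j')).filter fun k =>
            |W.betaThr T x Y (T.size (m + 1)) j' k'| ≤ |W.betaThr T x Y (T.size (m + 1)) j' k|
    with hS
  set b := |W.coeffβ f j' k'| with hb
  have hb0 : 0 ≤ b := abs_nonneg _
  -- Each index counted in `S` has a true coefficient of size at least `b / K²`, so the `ℓ^P` bound
  -- on level `j'` limits their number, as in Chebyshev's inequality.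
  have hScard : (S.card : ℝ) * b ^ P ≤
      (K * K) ^ P * (B * (2 : ℝ) ^ (-((j' : ℝ) * (P * (r + 1 / 2) - 1)))) := by
    have h6 : ∀ k ∈ S, b ^ P ≤ (K * K) ^ P * |W.coeffβ f j' k| ^ P := by
      intro k hk
      rw [hS, Finset.mem_filter, Finset.mem_range] at hk
      have h7 := (hest' j' k hj' hj'n hj'1 hk.1).2.1
      rw [← Real.mul_rpow (by positivity) (abs_nonneg _)]
      refine Real.rpow_le_rpow hb0 ?_ hP.le
      calc b ≤ K * |W.betaThr T x Y (T.size (m + 1)) j' k'| := h4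
        _ ≤ K * |W.betaThr T x Y (T.size (m + 1)) j' k| := mul_le_mul_of_nonneg_left hk.2 hK0.le
        _ ≤ K * (K * |W.coeffβ f j' k|) := mul_le_mul_of_nonneg_left h7 hK0.le
        _ = _ := by ring
    calc (S.card : ℝ) * b ^ P = ∑ k ∈ S, b ^ P := by simp
      _ ≤ ∑ k ∈ S, (K * K) ^ P * |W.coeffβ f j' k| ^ P := Finset.sum_le_sum h6
      _ ≤ ∑ k ∈ Finset.range (2 ^ j'), (K * K) ^ P * |W.coeffβ f j' k| ^ P :=
          Finset.sum_le_sum_of_subset_of_nonneg (Finset.filter_subset _ _)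
            fun _ _ _ => by positivity
      _ ≤ _ := by
          rw [← Finset.mul_sum]; gcongr; exact hbes j' hj'
  have hS0 : (0 : ℝ) < S.card := by
    have : 0 < S.card := Finset.card_pos.2 ⟨k', by
      rw [hS, Finset.mem_filter]; exact ⟨Finset.mem_range.2 hk', le_rfl⟩⟩
    exact_mod_cast this
  set J' := T.jmax (T.size (m + 1)) with hJ'
  have hJ'0 : (0 : ℝ) < J' := by exact_mod_cast (by omega : 0 < J')
  have hJ'log : (J' : ℝ) ≤ 2 * Real.log n := by
    have h6 := (hj (T.size (m + 1)) (by omega)).2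
    have h7 : c₂ ≤ Real.log (T.size (m + 1)) := by
      have : Real.exp c₂ ≤ T.size (m + 1) := by
        have : (T.size m : ℝ) ≤ T.size (m + 1) := by exact_mod_cast hsz
        have : (0 : ℝ) ≤ T.size m₀ := Nat.cast_nonneg _
        have : (0 : ℝ) ≤ n₀ := Nat.cast_nonneg _
        linarith
      rw [← Real.log_exp c₂]
      exact Real.log_le_log hexp this
    have h8 : (2 : ℝ) ^ J' ≤ n := by
      refine h6.trans ?_
      have h9 : 0 < Real.log (T.size (m + 1)) := hc₂.trans_le h7
      have h10 : (T.size (m + 1) : ℝ) ≤ n := by exact_mod_cast hnm1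
      rw [← mul_div_assoc, div_le_iff₀ h9]
      nlinarith [show (0 : ℝ) ≤ T.size (m + 1) from Nat.cast_nonneg _]
    have h9 := Real.log_le_log (by positivity) h8
    rw [Real.log_pow] at h9
    nlinarith [Real.log_two_gt_d9]
  have hν1 : 1 ≤ ν := by omega
  rw [noiseBound_sq T.σ x hν1, Real.mul_rpow (by positivity) hb0]
  have hsz3 : (n : ℝ) / D ≤ T.size (m + 2) := by
    rw [div_le_iff₀ hD0, mul_comm]
    exact hnD2.trans (by gcongr)
  -- The summand `-1` in the Besov exponent leaves `2^{j'}`, the numerator of the target density.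
  have h2j : (2 : ℝ) ^ (-((j' : ℝ) * (P * (r + 1 / 2) - 1))) *
      ((2 : ℝ) ^ ((j' : ℝ) * (r + 1 / 2))) ^ P = 2 ^ j' := by
    rw [← Real.rpow_mul (by norm_num), ← Real.rpow_add (by norm_num), ← Real.rpow_natCast]
    congr 1; ring
  have h6 : c * (n / D) * 2 ^ j' / (S.card * (J' : ℝ) ^ 2) ≤ 2 ^ obsLevel L x ν j k :=
    le_trans (by gcongr) h5
  have hq : (0 : ℝ) < ((2 : ℝ) ^ ((j' : ℝ) * (r + 1 / 2))) ^ P := by positivity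
  rw [← mul_assoc] at hScard
  have hσ2 : 0 < T.σ ^ 2 := by positivity
  have hνlog : Real.log ν ≤ Real.log n :=
    Real.log_le_log (by exact_mod_cast hν1) (by exact_mod_cast hνn)
  have hw : 0 ≤ Real.log n ^ 3 / n := by positivity
  calc _ ≤ T.σ ^ 2 * (2 * Real.log n) / 2 ^ obsLevel L x ν j k *
        (((2 : ℝ) ^ ((j' : ℝ) * (r + 1 / 2))) ^ P * b ^ P) := by gcongr
    _ ≤ 2 * T.σ ^ 2 * D / c * (4 * ((K * K) ^ P * B)) * (Real.log n ^ 3 / n) :=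
        noise_sq_mul_le hσ2 hln (by linarith) hc hD0 (by positivity) hS0 hJ'0 hq
          (by positivity) h6 hJ'log hScard h2j
    _ ≤ _ := mul_le_mul_of_nonneg_right (by linarith) hw

end WaveletBasis

/-! ### Propagation of detectability through the stages -/

/-- Detectability of a family `b` of absolute values of wavelet coefficients. -/
def Detectable (L j₀ : ℕ) (I : Set ℝ) (s t : ℝ) (b : ℕ → ℕ → ℝ) : Prop :=
  ∀ j k, ⌈(j₀ : ℝ) / t⌉₊ ≤ j → k < 2 ^ j → (suppInterval L j k ∩ I).Nonempty →
      ∃ j' k', ⌊t * (j : ℝ)⌋₊ ≤ j' ∧ j' < j ∧ k' < 2 ^ j' ∧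
        suppInterval L j k ⊆ suppInterval L j' k' ∧
        ((j' : ℝ) / j) * (2 : ℝ) ^ (((j : ℝ) - j') * (s + 1 / 2)) * b j k ≤ b j' k'

/-- A level above which all parents considered below are admissible. -/
theorem exists_base_level (j₀ : ℕ) {t : ℝ} (ht : 0 < t) : ∃ J : ℕ, 1 ≤ J ∧ ∀ j : ℕ, J ≤ j →
    4 ≤ t ^ 2 * j ∧ 2 ≤ t * j ∧ ⌈(j₀ : ℝ) / t⌉₊ ≤ ⌊t * (j : ℝ)⌋₊ ∧ ⌈(j₀ : ℝ) / t⌉₊ ≤ j := by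
  obtain ⟨J, hJ⟩ := exists_nat_ge (4 / t ^ 2 + (2 + ⌈(j₀ : ℝ) / t⌉₊) / t + ⌈(j₀ : ℝ) / t⌉₊ + 1)
  have h1 : 0 ≤ 4 / t ^ 2 := by positivity
  have h2 : 0 ≤ (2 + (⌈(j₀ : ℝ) / t⌉₊ : ℝ)) / t := by positivity
  have h3 : (0 : ℝ) ≤ ⌈(j₀ : ℝ) / t⌉₊ := by positivity
  refine ⟨J, by exact_mod_cast (by linarith : (1 : ℝ) ≤ J), fun j hj => ?_⟩
  have hj' : (J : ℝ) ≤ j := by exact_mod_cast hj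
  have h4 : 4 / t ^ 2 ≤ j := by linarith
  have h5 : (2 + (⌈(j₀ : ℝ) / t⌉₊ : ℝ)) / t ≤ j := by linarith
  rw [div_le_iff₀ (by positivity)] at h4 h5
  refine ⟨by linarith, by linarith, Nat.le_floor (by linarith), ?_⟩
  exact_mod_cast (by linarith : ((⌈(j₀ : ℝ) / t⌉₊ : ℕ) : ℝ) ≤ j)

theorem two_rpow_pos (x : ℝ) : (0 : ℝ) < (2 : ℝ) ^ x := by positivity

/-- Detectable coefficients decay at the rate of the local Hölder class, up to a factor `j`. -/
theorem Detectable.exists_decay {L j₀ : ℕ} {s t M : ℝ} (ht : 0 < t)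
    (hM : 0 < M) (hs : 0 ≤ s) : ∃ C : ℝ, 0 < C ∧ ∀ (I : Set ℝ) (b : ℕ → ℕ → ℝ),
    Detectable L j₀ I s t b → (∀ j k, j₀ ≤ j → k < 2 ^ j → b j k ≤ M) →
    ∀ j k, j₀ ≤ j → k < 2 ^ j → (suppInterval L j k ∩ I).Nonempty →
      b j k ≤ C * (j + 1) * (2 : ℝ) ^ (-((j : ℝ) * (s + 1 / 2))) := by
  obtain ⟨J, hJ1, hJ⟩ := exists_base_level j₀ ht
  refine ⟨M * (2 : ℝ) ^ ((J : ℝ) * (s + 1 / 2)), by positivity, fun I b hb hbM => ?_⟩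
  set C := M * (2 : ℝ) ^ ((J : ℝ) * (s + 1 / 2)) with hC
  have hC0 : 0 < C := by positivity
  -- Along a chain of ancestors the ratios `j' / j` telescope, which produces the factor `j`; the
  -- chain is followed until it falls below `J`, where `b ≤ M` suffices.
  have key : ∀ j k, j₀ ≤ j → k < 2 ^ j → (suppInterval L j k ∩ I).Nonempty →
      b j k ≤ C * max (j : ℝ) 1 * (2 : ℝ) ^ (-((j : ℝ) * (s + 1 / 2))) := by
    intro j
    induction j using Nat.strong_induction_on with
    | _ j ih =>
      intro k hj hk hI
      rcases lt_or_ge j J with hjJ | hjJ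
      · have h1 : (1 : ℝ) ≤ max (j : ℝ) 1 := le_max_right _ _
        have h2 : 1 ≤ (2 : ℝ) ^ ((J : ℝ) * (s + 1 / 2)) * (2 : ℝ) ^ (-((j : ℝ) * (s + 1 / 2))) := by
          rw [← Real.rpow_add (by norm_num)]
          refine Real.one_le_rpow (by norm_num) ?_
          have : (j : ℝ) ≤ J := by exact_mod_cast hjJ.le
          nlinarith
        calc b j k ≤ M * 1 * 1 := by simpa using hbM j k hj hk
          _ ≤ M * max (j : ℝ) 1 * ((2 : ℝ) ^ ((J : ℝ) * (s + 1 / 2)) *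
              (2 : ℝ) ^ (-((j : ℝ) * (s + 1 / 2)))) := by gcongr
          _ = _ := by rw [hC]; ring
      · obtain ⟨h4, h2, hcf, hcj⟩ := hJ j hjJ
        obtain ⟨j', k', h5, h6, h7, h8, h9⟩ := hb j k hcj hk hI
        have h10 : (⌈(j₀ : ℝ) / t⌉₊ : ℕ) ≤ j' := hcf.trans h5
        have hj'0 : (1 : ℕ) ≤ j' := le_trans (Nat.le_floor (by push_cast; linarith)) h5
        have hj'0' : (1 : ℝ) ≤ j' := by exact_mod_cast hj'0
        have hj₀ : j₀ ≤ j' := by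
          refine le_trans (Nat.le_floor ?_) h5
          have := Nat.le_ceil ((j₀ : ℝ) / t)
          rw [div_le_iff₀ ht] at this
          have h11 : ((⌈(j₀ : ℝ) / t⌉₊ : ℕ) : ℝ) ≤ j := by exact_mod_cast hcj
          nlinarith
        have h12 := ih j' h6 k' hj₀ h7 (hI.mono (inter_subset_inter_left _ h8))
        rw [max_eq_left hj'0'] at h12
        have hj0 : (1 : ℝ) ≤ j := by
          have : (j' : ℝ) ≤ j := by exact_mod_cast h6.le
          linarith
        rw [max_eq_left hj0]
        have h13 := h9.trans h12
        have hq := two_rpow_pos (((j : ℝ) - j') * (s + 1 / 2))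
        have h14 : (2 : ℝ) ^ (-((j : ℝ) * (s + 1 / 2))) =
            (2 : ℝ) ^ (-((j' : ℝ) * (s + 1 / 2))) / (2 : ℝ) ^ (((j : ℝ) - j') * (s + 1 / 2)) := by
          rw [← Real.rpow_sub (by norm_num)]; congr 1; ring
        rw [h14, mul_div_assoc', le_div_iff₀ hq]
        have h15 : b j k * (2 : ℝ) ^ (((j : ℝ) - j') * (s + 1 / 2)) =
            (j : ℝ) / j' * ((j' : ℝ) / j * (2 : ℝ) ^ (((j : ℝ) - j') * (s + 1 / 2)) * b j k) := by
          field_simp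
        rw [h15]
        calc _ ≤ (j : ℝ) / j' * (C * j' * (2 : ℝ) ^ (-((j' : ℝ) * (s + 1 / 2)))) := by gcongr
          _ = _ := by field_simp
  intro j k hj hk hI
  refine (key j k hj hk hI).trans ?_
  gcongr
  exact max_le (by linarith) (by linarith [Nat.cast_nonneg (α := ℝ) j])

/-- The relation between the noise levels of the successive stages and the coefficients. -/
structure Cascade (L j₀ jc A : ℕ) (I : Set ℝ) (s u t P C w : ℝ) (b : ℕ → ℕ → ℝ)
    (e : ℕ → ℕ → ℕ → ℝ) : Prop where
  b_nonneg : ∀ j k, 0 ≤ b j k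
  e_nonneg : ∀ a j k, 0 ≤ e a j k
  w_pos : 0 < w
  e_le : ∀ a ≤ A, ∀ j k, j₀ ≤ j → j ≤ jc → k < 2 ^ j → e a j k ^ 2 ≤ C * w
  step : ∀ a < A, ∀ j k j' k', j₀ ≤ j → j ≤ jc → k < 2 ^ j → j₀ ≤ j' → j' ≤ jc → k' < 2 ^ j' →
    suppInterval L j k ⊆ suppInterval L j' k' → b j' k' ≤ C * e (a + 1) j' k' ∨
      e a j k ^ 2 * ((2 : ℝ) ^ ((j' : ℝ) * (s + u + 1 / 2)) * b j' k') ^ P ≤ C * w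
  detect : Detectable L j₀ I s t b

/-- Of the `P + 2` factors, `P` are bounded by `b` and two by `e`. This is the origin of the
exponent `1 / (P + 2)` in the level bounds. -/
theorem rpow_min_le {b e P Q : ℝ} (hP : 0 < P) (hb : 0 ≤ b) (he : 0 ≤ e)
    (h : e ^ 2 * b ^ P ≤ Q) : min b e ^ (P + 2) ≤ Q := by
  have hm : 0 ≤ min b e := le_min hb he
  rw [Real.rpow_add_of_nonneg hm hP.le (by norm_num), mul_comm]
  refine le_trans ?_ h
  have h1 : min b e ^ (2 : ℝ) ≤ e ^ 2 := by
    rw [Real.rpow_two]; exact pow_le_pow_left₀ hm (min_le_right _ _) 2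
  have h2 : min b e ^ P ≤ b ^ P := Real.rpow_le_rpow hm (min_le_left _ _) hP.le
  gcongr

/-! ### Recursion over ancestors and stages. -/

section

variable {s u t P : ℝ}

/-- Transfer of a bound from a parent coefficient. -/
theorem transfer_bound (hP : 0 < P) (hu : P * t * u ≤ 2 * s + 1) {w R K b z j j' : ℝ}
    (hjj : j' ≤ j) (hw : 0 < w) (hb : 0 ≤ b) (hR : 0 ≤ R) (hz : 0 ≤ z)
    (hbz : b ≤ R * (2 : ℝ) ^ (-((j - j') * (s + 1 / 2))) * z)
    (hzK : z ^ (P + 2) ≤ K * w * (2 : ℝ) ^ (-(j' * (P * (s + t * u + 1 / 2))))) (hK : 0 ≤ K) :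
    b ^ (P + 2) ≤ R ^ (P + 2) * K * w * (2 : ℝ) ^ (-(j * (P * (s + t * u + 1 / 2)))) := by
  have h1 := Real.rpow_le_rpow hb hbz (show 0 ≤ P + 2 by linarith)
  rw [Real.mul_rpow (by positivity) hz, Real.mul_rpow hR (by positivity),
    ← Real.rpow_mul (by norm_num)] at h1
  calc _ ≤ _ := h1
    _ ≤ R ^ (P + 2) * (2 : ℝ) ^ (-((j - j') * (s + 1 / 2)) * (P + 2)) *
        (K * w * (2 : ℝ) ^ (-(j' * (P * (s + t * u + 1 / 2))))) := by gcongr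
    _ = R ^ (P + 2) * K * w * ((2 : ℝ) ^ (-((j - j') * (s + 1 / 2)) * (P + 2)) *
        (2 : ℝ) ^ (-(j' * (P * (s + t * u + 1 / 2))))) := by ring
    _ ≤ _ := by
        rw [← Real.rpow_add (by norm_num)]
        refine mul_le_mul_of_nonneg_left ?_ (by positivity)
        refine Real.rpow_le_rpow_of_exponent_le (by norm_num) ?_
        -- The two exponents differ by `(j - j') (P t u - 2 s - 1) ≤ 0`.
        nlinarith [mul_nonneg (sub_nonneg.2 hjj) (sub_nonneg.2 hu)]

/-- The bound implied by the detection of a parent coefficient. -/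
theorem detected_bound (hP : 0 < P) (hu : 0 ≤ u) {w R C b b' e j j' : ℝ}
    (hb : 0 ≤ b) (hR : 0 ≤ R) (hb' : 0 ≤ b') (he : 0 ≤ e)
    (hj : t * j ≤ j' + 1)
    (hbb : b ≤ R * (2 : ℝ) ^ (-((j - j') * (s + 1 / 2))) * b')
    (h : e ^ 2 * ((2 : ℝ) ^ (j' * (s + u + 1 / 2)) * b') ^ P ≤ C * w) :
    min b e ^ (P + 2) ≤
      R ^ P * (2 : ℝ) ^ (P * u) * C * w * (2 : ℝ) ^ (-(j * (P * (s + t * u + 1 / 2)))) := by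
  refine rpow_min_le hP hb he ?_
  have h1 := Real.rpow_le_rpow hb hbb hP.le
  rw [Real.mul_rpow (by positivity) hb', Real.mul_rpow hR (by positivity),
    ← Real.rpow_mul (by norm_num)] at h1
  rw [Real.mul_rpow (by positivity) hb', ← Real.rpow_mul (by norm_num)] at h
  set q := (2 : ℝ) ^ (j' * (s + u + 1 / 2) * P) with hq
  have hq0 : 0 < q := two_rpow_pos _
  have h2 : (2 : ℝ) ^ (-((j - j') * (s + 1 / 2)) * P) / q ≤
      (2 : ℝ) ^ (P * u) * (2 : ℝ) ^ (-(j * (P * (s + t * u + 1 / 2)))) := by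
    rw [hq, ← Real.rpow_sub (by norm_num), ← Real.rpow_add (by norm_num)]
    refine Real.rpow_le_rpow_of_exponent_le (by norm_num) ?_
    -- The detected ancestor gains `P j' u ≥ P (t j - 1) u`; the loss of one level through the
    -- integer part is the constant `2^{P u}`.
    nlinarith [mul_nonneg (sub_nonneg.2 hj) (mul_nonneg hP.le hu)]
  calc e ^ 2 * b ^ P ≤ e ^ 2 * (R ^ P * (2 : ℝ) ^ (-((j - j') * (s + 1 / 2)) * P) * b' ^ P) := by
        gcongr
    _ = R ^ P * ((2 : ℝ) ^ (-((j - j') * (s + 1 / 2)) * P) / q) * (e ^ 2 * (q * b' ^ P)) := by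
        field_simp
    _ ≤ R ^ P * ((2 : ℝ) ^ (P * u) * (2 : ℝ) ^ (-(j * (P * (s + t * u + 1 / 2))))) * (C * w) := by
        gcongr
    _ = _ := by ring

/-- End of the recursion: if `w` is at most `2^{-2j(s+tu+1/2)}`, the uniform noise bound suffices,
since `w^{(P+2)/2} = w · w^{P/2}` and the second factor already has the required decay. -/
theorem trivial_bound (hP : 0 < P) {w C b e j : ℝ} (hw : 0 < w) (hC : 1 ≤ C) (hb : 0 ≤ b)
    (he : 0 ≤ e) (h : e ^ 2 ≤ C * w)
    (hj : (2 : ℝ) ^ (j * (2 * (s + t * u + 1 / 2))) * w ≤ 1) :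
    min b e ^ (P + 2) ≤ C ^ ((P + 2) / 2) * w * (2 : ℝ) ^ (-(j * (P * (s + t * u + 1 / 2)))) := by
  have hm : 0 ≤ min b e := le_min hb he
  have h1 : min b e ^ 2 ≤ C * w := (pow_le_pow_left₀ hm (min_le_right _ _) 2).trans h
  have h2 : min b e ^ (P + 2) = (min b e ^ 2) ^ ((P + 2) / 2) := by
    rw [← Real.rpow_natCast, ← Real.rpow_mul hm]; congr 1; push_cast; ring
  have h3 : w ≤ (2 : ℝ) ^ (-(j * (2 * (s + t * u + 1 / 2)))) := by
    rw [Real.rpow_neg (by norm_num), ← one_div, le_div_iff₀ (two_rpow_pos _)]; linarith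
  have h4 : w ^ (P / 2) ≤ (2 : ℝ) ^ (-(j * (P * (s + t * u + 1 / 2)))) := by
    refine (Real.rpow_le_rpow hw.le h3 (by positivity)).trans (le_of_eq ?_)
    rw [← Real.rpow_mul (by norm_num)]; congr 1; ring
  have h5 : w ^ ((P + 2) / 2) = w * w ^ (P / 2) := by
    rw [show (P + 2) / 2 = 1 + P / 2 by ring, Real.rpow_add hw, Real.rpow_one]
  calc _ = (min b e ^ 2) ^ ((P + 2) / 2) := h2
    _ ≤ (C * w) ^ ((P + 2) / 2) := Real.rpow_le_rpow (by positivity) h1 (by positivity)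
    _ = C ^ ((P + 2) / 2) * (w * w ^ (P / 2)) := by rw [Real.mul_rpow (by linarith) hw.le, h5]
    _ ≤ C ^ ((P + 2) / 2) * (w * (2 : ℝ) ^ (-(j * (P * (s + t * u + 1 / 2))))) := by gcongr
    _ = _ := by ring

/-- After sufficiently many stages, every coefficient or its noise level is small. -/
theorem Cascade.exists_bound (L j₀ : ℕ) (hP : 0 < P) (hu : 0 ≤ u)
    (hPu : P * t * u ≤ 2 * s + 1) (ht : 0 < t) {C : ℝ} (hC : 1 ≤ C) :
    ∃ J : ℕ, ∀ a : ℕ, ∃ K : ℝ, 1 ≤ K ∧ ∀ (jc A : ℕ) (I : Set ℝ) (w : ℝ) (b : ℕ → ℕ → ℝ)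
      (e : ℕ → ℕ → ℕ → ℝ), Cascade L j₀ jc A I s u t P C w b e →
      (∀ j : ℕ, j ≤ J → (2 : ℝ) ^ ((j : ℝ) * (2 * (s + t * u + 1 / 2))) * w ≤ 1) →
      ∀ τ, τ + 2 * a ≤ A → ∀ j k, j₀ ≤ j → j ≤ jc → k < 2 ^ j → (suppInterval L j k ∩ I).Nonempty →
        (∀ j' : ℕ, (j' : ℝ) ≤ t ^ a * j → (2 : ℝ) ^ ((j' : ℝ) * (2 * (s + t * u + 1 / 2))) * w ≤ 1) →
        min (b j k) (e τ j k) ^ (P + 2) ≤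
          K * w * (2 : ℝ) ^ (-((j : ℝ) * (P * (s + t * u + 1 / 2)))) := by
  obtain ⟨J, hJ1, hJ⟩ := exists_base_level j₀ ht
  refine ⟨J, fun a => ?_⟩
  set K₀ := C ^ ((P + 2) / 2) with hK₀
  have hK₀1 : 1 ≤ K₀ := Real.one_le_rpow hC (by positivity)
  induction a with
  | zero =>
    refine ⟨K₀, hK₀1, fun jc A I w b e h hw τ hτ j k hj hjc hk _ hlev => ?_⟩
    exact trivial_bound hP h.w_pos hC (h.b_nonneg _ _) (h.e_nonneg _ _ _)
      (h.e_le τ (by omega) j k hj hjc hk) (hlev j (by simp))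
  | succ a ih =>
    obtain ⟨Ka, hKa1, ih⟩ := ih
    set R := 2 / t with hR
    have hR0 : 0 < R := by positivity
    set K₁ := R ^ P * (2 : ℝ) ^ (P * u) * C with hK₁
    have hK₁0 : 0 < K₁ := by positivity
    set K₂ := (C * R) ^ (P + 2) * K₁
    set K₃ := (C * (R * R)) ^ (P + 2) * Ka
    have hK₂0 : 0 < K₂ := by positivity
    have hK₃0 : 0 < K₃ := by positivity
    refine ⟨K₀ + K₁ + K₂ + K₃, by linarith,
      fun jc A I w b e h hw τ hτ j k hj hjc hk hI hlev => ?_⟩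
    have hwp := h.w_pos
    have weaken : ∀ K, K ≤ K₀ + K₁ + K₂ + K₃ → min (b j k) (e τ j k) ^ (P + 2) ≤
          K * w * (2 : ℝ) ^ (-((j : ℝ) * (P * (s + t * u + 1 / 2)))) →
        min (b j k) (e τ j k) ^ (P + 2) ≤ (K₀ + K₁ + K₂ + K₃) * w *
          (2 : ℝ) ^ (-((j : ℝ) * (P * (s + t * u + 1 / 2)))) := by
      intro K hK h'
      refine h'.trans ?_
      have := two_rpow_pos (-((j : ℝ) * (P * (s + t * u + 1 / 2))))
      gcongr
    rcases le_or_gt j J with hjJ | hjJ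
    · refine weaken K₀ (by linarith) ?_
      exact trivial_bound hP hwp hC (h.b_nonneg _ _) (h.e_nonneg _ _ _)
        (h.e_le τ (by omega) j k hj hjc hk) (hw j hjJ)
    obtain ⟨h4, h2, hcf, hcj⟩ := hJ j hjJ.le
    have hj0 : (0 : ℝ) < j := by exact_mod_cast (by omega : 0 < j)
    classical
    -- Let `jp` be the lowest level from `⌊t j⌋` to `j` that carries an ancestor dominating `(j,
    -- k)`, with `j` itself allowed. Domination composes, because the ratios and the powers of two
    -- telescope, so by minimality the parent level `jq` of `jp` lies below `⌊t j⌋`. Two steps of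
    -- the recursion thus lower the level by the factor `t`.
    have hex : ∃ j', ⌊t * (j : ℝ)⌋₊ ≤ j' ∧ j' ≤ j ∧ ∃ k', k' < 2 ^ j' ∧
        suppInterval L j k ⊆ suppInterval L j' k' ∧
        ((j' : ℝ) / j) * (2 : ℝ) ^ (((j : ℝ) - j') * (s + 1 / 2)) * b j k ≤ b j' k' := by
      obtain ⟨j', k', h5, h6, h7, h8, h9⟩ := h.detect j k hcj hk hI
      exact ⟨j', h5, h6.le, k', h7, h8, h9⟩
    obtain ⟨hp1, hp2, kp, hkp, hsp, hbp⟩ := Nat.find_spec hex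
    set jp := Nat.find hex with hjp
    have hIp := hI.mono (inter_subset_inter_left _ hsp)
    obtain ⟨jq, kq, hq1, hq2, hkq, hsq, hbq⟩ := h.detect jp kp (hcf.trans hp1) hkp hIp
    have hIq := hIp.mono (inter_subset_inter_left _ hsq)
    have hjp1 : t * j ≤ jp + 1 := by
      have h5 := Nat.lt_floor_add_one (t * (j : ℝ))
      have h6 : ((⌊t * (j : ℝ)⌋₊ : ℕ) : ℝ) ≤ jp := by exact_mod_cast hp1
      linarith
    have hjq1 : t * jp ≤ jq + 1 := by
      have h5 := Nat.lt_floor_add_one (t * (jp : ℝ))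
      have h6 : ((⌊t * (jp : ℝ)⌋₊ : ℕ) : ℝ) ≤ jq := by exact_mod_cast hq1
      linarith
    have hjpR : t * j / 2 ≤ jp := by linarith
    have hjqR : t * jp / 2 ≤ jq := by
      have : t ^ 2 * j / 2 ≤ t * jp := by nlinarith
      linarith
    have hjp0 : (0 : ℝ) < jp := lt_of_lt_of_le (by positivity) hjpR
    have hjq0 : (0 : ℝ) < jq := lt_of_lt_of_le (by positivity) hjqR
    have hjpj : (jp : ℝ) ≤ j := by exact_mod_cast hp2
    have hjqp : (jq : ℝ) ≤ jp := by exact_mod_cast hq2.le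
    have hj₀q : j₀ ≤ jq := by
      refine le_trans (Nat.le_floor ?_) hq1
      have := Nat.le_ceil ((j₀ : ℝ) / t)
      rw [div_le_iff₀ ht] at this
      have h11 : ((⌈(j₀ : ℝ) / t⌉₊ : ℕ) : ℝ) ≤ jp := by exact_mod_cast hcf.trans hp1
      nlinarith
    have hj₀p : j₀ ≤ jp := hj₀q.trans hq2.le
    have hqlt : jq < ⌊t * (j : ℝ)⌋₊ := by
      by_contra hcon
      push Not at hcon
      refine Nat.find_min hex hq2 ⟨hcon, hq2.le.trans hp2, kq, hkq, hsp.trans hsq, ?_⟩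
      refine le_trans (le_of_eq ?_) ((mul_le_mul_of_nonneg_left hbp
        (show 0 ≤ (jq : ℝ) / jp * (2 : ℝ) ^ (((jp : ℝ) - jq) * (s + 1 / 2)) by positivity)).trans
        hbq)
      have e1 : (2 : ℝ) ^ (((j : ℝ) - jq) * (s + 1 / 2)) =
          (2 : ℝ) ^ (((jp : ℝ) - jq) * (s + 1 / 2)) * (2 : ℝ) ^ (((j : ℝ) - jp) * (s + 1 / 2)) := by
        rw [← Real.rpow_add (by norm_num)]; congr 1; ring
      rw [e1]; field_simp
    have hjqt : (jq : ℝ) ≤ t * j := by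
      have h5 := Nat.floor_le (show 0 ≤ t * (j : ℝ) by positivity)
      have h6 : (jq : ℝ) ≤ (⌊t * (j : ℝ)⌋₊ : ℕ) := by exact_mod_cast hqlt.le
      linarith
    have cmp : ∀ (x y bx bY : ℝ), 0 < x → 0 < y → t * x / 2 ≤ y → 0 ≤ bx →
        (y / x) * (2 : ℝ) ^ ((x - y) * (s + 1 / 2)) * bx ≤ bY →
        bx ≤ R * (2 : ℝ) ^ (-((x - y) * (s + 1 / 2))) * bY := by
      intro x y bx bY hx hy hxy hbx hle
      have hqq := two_rpow_pos ((x - y) * (s + 1 / 2))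
      have hbY : 0 ≤ bY := le_trans (by positivity) hle
      rw [Real.rpow_neg (by norm_num)]
      have e1 : bx = x / y * ((2 : ℝ) ^ ((x - y) * (s + 1 / 2)))⁻¹ *
          ((y / x) * (2 : ℝ) ^ ((x - y) * (s + 1 / 2)) * bx) := by field_simp
      rw [e1]
      gcongr
      rw [hR, div_le_div_iff₀ hy ht]; linarith
    have c1 := cmp j jp _ _ hj0 hjp0 hjpR (h.b_nonneg j k) hbp
    have c2 := cmp jp jq _ _ hjp0 hjq0 hjqR (h.b_nonneg jp kp) hbq
    -- The first index of `e` counts stages backwards. If `(jp, kp)` was detected one stage earlier,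
    -- the noise at `(j, k)` is controlled directly; otherwise `b jp kp` is below that earlier noise
    -- level and the parent `(jq, kq)` is examined.
    rcases h.step τ (by omega) j k jp kp hj hjc hk hj₀p (hp2.trans hjc) hkp hsp with hs1 | hs1
    swap
    · refine weaken K₁ (by linarith) ?_
      exact detected_bound hP hu (h.b_nonneg _ _) hR0.le (h.b_nonneg _ _)
        (h.e_nonneg _ _ _) hjp1 c1 hs1
    have hpc : jp ≤ jc := hp2.trans hjc
    have undet : ∀ a' j' k', b j' k' ≤ C * e a' j' k' →
        b j' k' ≤ C * min (b j' k') (e a' j' k') := by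
      intro a' j' k' hle
      rcases min_choice (b j' k') (e a' j' k') with hm | hm <;> rw [hm]
      · exact le_mul_of_one_le_left (h.b_nonneg _ _) hC
      · exact hle
    have hmb : min (b j k) (e τ j k) ^ (P + 2) ≤ b j k ^ (P + 2) :=
      Real.rpow_le_rpow (le_min (h.b_nonneg _ _) (h.e_nonneg _ _ _)) (min_le_left _ _)
        (by positivity)
    rcases h.step (τ + 1) (by omega) jp kp jq kq hj₀p hpc hkp hj₀q (hq2.le.trans hpc) hkq hsq
      with hs2 | hs2
    -- Neither ancestor was detected: the induction hypothesis applies at `jq ≤ t j`, two stages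
    -- further back, and the bound is transferred up to `(j, k)`.
    · refine weaken K₃ (by linarith) (hmb.trans ?_)
      have hih := ih jc A I w b e h hw (τ + 2) (by omega) jq kq hj₀q (hq2.le.trans hpc) hkq hIq
        (fun j' hj' => hlev j' (hj'.trans (by
          rw [pow_succ, mul_assoc]; gcongr)))
      refine transfer_bound hP hPu (hjqp.trans hjpj) hwp (h.b_nonneg _ _) (by positivity)
        (le_min (h.b_nonneg jq kq) (h.e_nonneg (τ + 2) jq kq)) ?_ hih (by linarith)
      calc b j k ≤ R * (2 : ℝ) ^ (-(((j : ℝ) - jp) * (s + 1 / 2))) * b jp kp := c1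
        _ ≤ R * (2 : ℝ) ^ (-(((j : ℝ) - jp) * (s + 1 / 2))) *
            (R * (2 : ℝ) ^ (-(((jp : ℝ) - jq) * (s + 1 / 2))) *
              (C * min (b jq kq) (e (τ + 2) jq kq))) := by
            gcongr
            refine c2.trans ?_
            gcongr
            exact undet _ _ _ hs2
        _ = C * (R * R) * ((2 : ℝ) ^ (-(((j : ℝ) - jp) * (s + 1 / 2))) *
            (2 : ℝ) ^ (-(((jp : ℝ) - jq) * (s + 1 / 2)))) * min (b jq kq) (e (τ + 2) jq kq) := by
            ring
        _ = _ := by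
            rw [← Real.rpow_add (by norm_num)]; congr 3; ring
    -- Detection of `(jq, kq)` bounds the minimum at `(jp, kp)`. As `(jp, kp)` was not detected,
    -- that minimum is of the order of `b jp kp` itself, which dominates `b j k`.
    · refine weaken K₂ (by linarith) (hmb.trans ?_)
      have hd := detected_bound hP hu (h.b_nonneg _ _) hR0.le (h.b_nonneg _ _)
        (h.e_nonneg (τ + 1) jp kp) hjq1 c2 hs2
      refine transfer_bound hP hPu hjpj hwp (h.b_nonneg _ _) (by positivity)
        (le_min (h.b_nonneg jp kp) (h.e_nonneg (τ + 1) jp kp)) ?_ hd hK₁0.le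
      calc b j k ≤ R * (2 : ℝ) ^ (-(((j : ℝ) - jp) * (s + 1 / 2))) * b jp kp := c1
        _ ≤ R * (2 : ℝ) ^ (-(((j : ℝ) - jp) * (s + 1 / 2))) *
            (C * min (b jp kp) (e (τ + 1) jp kp)) := by
            gcongr
            exact undet _ _ _ hs1
        _ = _ := by ring

end

/-! ### Sums over resolution levels -/

theorem exists_sum_two_rpow_abs_le {a : ℝ} (ha : 0 < a) : ∃ G : ℝ, 0 < G ∧ ∀ x : ℝ, 0 ≤ x →
    ∀ n : ℕ, ∑ j ∈ Finset.range n, (2 : ℝ) ^ (-(a * |(j : ℝ) - x|)) ≤ G := by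
  set ρ : ℝ := (2 : ℝ) ^ (-a) with hρ
  have hρ0 : 0 < ρ := by positivity
  have hρ1 : ρ < 1 := Real.rpow_lt_one_of_one_lt_of_neg (by norm_num) (by linarith)
  have h1ρ : 0 < 1 - ρ := by linarith
  refine ⟨(2 : ℝ) ^ a * (2 / (1 - ρ)), by positivity, fun x hx n => ?_⟩
  have key : ∀ j ∈ Finset.range n, (2 : ℝ) ^ (-(a * |(j : ℝ) - x|)) ≤
      (2 : ℝ) ^ a * ρ ^ Nat.dist j ⌊x⌋₊ := by
    intro j _
    rw [hρ, ← Real.rpow_natCast, ← Real.rpow_mul (by norm_num), ← Real.rpow_add (by norm_num)]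
    refine Real.rpow_le_rpow_of_exponent_le (by norm_num) ?_
    have h1 := Nat.floor_le hx
    have h2 := Nat.lt_floor_add_one x
    have h3 : ((Nat.dist j ⌊x⌋₊ : ℕ) : ℝ) ≤ |(j : ℝ) - x| + 1 := by
      rcases le_total j ⌊x⌋₊ with h | h
      · rw [Nat.dist_eq_sub_of_le h, Nat.cast_sub h]
        linarith [neg_abs_le ((j : ℝ) - x)]
      · rw [Nat.dist_eq_sub_of_le_right h, Nat.cast_sub h]
        linarith [le_abs_self ((j : ℝ) - x)]
    nlinarith
  refine (Finset.sum_le_sum key).trans ?_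
  rw [← Finset.mul_sum]
  exact mul_le_mul_of_nonneg_left (sum_pow_dist_le hρ0.le hρ1 _ n) (by positivity)

theorem exists_add_one_le_two_rpow {a : ℝ} (ha : 0 < a) : ∃ G : ℝ, 0 < G ∧ ∀ j : ℕ,
    (j : ℝ) + 1 ≤ G * (2 : ℝ) ^ (a * (j : ℝ)) := by
  have hl : 0 < Real.log 2 := Real.log_pos (by norm_num)
  refine ⟨1 + 1 / (a * Real.log 2), by positivity, fun j => ?_⟩
  have h1 := Real.add_one_le_exp (a * Real.log 2 * j)
  have h2 : (2 : ℝ) ^ (a * (j : ℝ)) = Real.exp (a * Real.log 2 * j) := by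
    rw [Real.rpow_def_of_pos (by norm_num)]; congr 1; ring
  have h3 : (1 : ℝ) ≤ Real.exp (a * Real.log 2 * j) := Real.one_le_exp (by positivity)
  rw [h2, add_mul, one_mul]
  have h4 : (j : ℝ) ≤ 1 / (a * Real.log 2) * Real.exp (a * Real.log 2 * j) := by
    rw [div_mul_eq_mul_div, one_mul, le_div_iff₀ (by positivity)]; linarith
  linarith

theorem exists_sum_tail_le {a : ℝ} (ha : 0 < a) : ∃ G : ℝ, 0 < G ∧ ∀ J n : ℕ,
    ∑ j ∈ Finset.range n, (if j ≤ J then 0 else (2 : ℝ) ^ (-(a * (j : ℝ)))) ≤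
      G * ((2 : ℝ) ^ (J + 1))⁻¹ ^ a := by
  obtain ⟨G, hG, h⟩ := exists_sum_two_rpow_abs_le ha
  refine ⟨G, hG, fun J n => ?_⟩
  have hJ : ((2 : ℝ) ^ (J + 1))⁻¹ ^ a = (2 : ℝ) ^ (-(a * ((J + 1 : ℕ) : ℝ))) := by
    rw [← Real.rpow_natCast, ← Real.rpow_neg (by norm_num), ← Real.rpow_mul (by norm_num)]
    congr 1; ring
  rw [hJ]
  calc _ ≤ ∑ j ∈ Finset.range n, (2 : ℝ) ^ (-(a * |(j : ℝ) - ((J + 1 : ℕ) : ℝ)|)) *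
        (2 : ℝ) ^ (-(a * ((J + 1 : ℕ) : ℝ))) := by
        refine Finset.sum_le_sum fun j _ => ?_
        split_ifs with hj
        · positivity
        · have h1 : ((J + 1 : ℕ) : ℝ) ≤ j := by exact_mod_cast not_le.1 hj
          rw [← Real.rpow_add (by norm_num), abs_of_nonneg (by linarith)]
          refine le_of_eq ?_
          congr 1; ring
    _ ≤ _ := by
        rw [← Finset.sum_mul]
        gcongr
        exact h _ (Nat.cast_nonneg _) n

/-! ### The error of the estimator -/

/-- At a point `z` of `I` at most `2 L` wavelets per level are nonzero, each `O(2^{j/2})`, and their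
supports meet `I`. Extending the thresholded coefficients by zero above `jmax` makes truncation one
more coefficient error. -/
theorem WaveletBasis.exists_error_bound {j₀ N L : ℕ} (W : WaveletBasis j₀ N L) :
    ∃ C : ℝ, 0 < C ∧ ∀ (T : Tuning j₀) (x Y : ℕ → ℝ) (n : ℕ) (f : ℝ → ℝ) (I : Set ℝ) (E G : ℝ)
      (H : ℕ → ℝ), W.IsSumOfSeries f → 0 ≤ E → (∀ j, 0 ≤ H j) →
      (∀ k < 2 ^ j₀, |W.alphaHat x Y n k - W.coeffα f j₀ k| ≤ E) →
      (∀ j k, j₀ ≤ j → k < 2 ^ j → (suppInterval L j k ∩ I).Nonempty →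
        (2 : ℝ) ^ ((j : ℝ) / 2) *
          |(if j < T.jmax n then W.betaThr T x Y n j k else 0) - W.coeffβ f j k| ≤ H j) →
      (∀ n', ∑ j ∈ Finset.range n', H j ≤ G) →
      ∀ z ∈ I ∩ Ico 0 1, |W.estimator T x Y n z - f z| ≤ C * (E + G) := by
  obtain ⟨γ, -, C, hC1, hC⟩ := W.exists_regular
  have hC0 : 0 < C := by linarith
  have hL0 : (0 : ℝ) < L := by exact_mod_cast W.one_le_L
  refine ⟨2 * L * (C * (2 : ℝ) ^ ((j₀ : ℝ) / 2)) + 2 * L * C, by positivity,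
    fun T x Y n f I E G H hf hE hH hα hβ hG z hz => ?_⟩
  set bt : ℕ → ℕ → ℝ := fun j k => if j < T.jmax n then W.betaThr T x Y n j k else 0 with hbt
  have hG0 : 0 ≤ G := by simpa using hG 0
  have hv : HasSum (fun a : ℕ => ∑ k ∈ Finset.range (2 ^ (j₀ + a)),
      bt (j₀ + a) k * W.ψ (j₀ + a) k z)
      (∑ a ∈ Finset.range (T.jmax n - j₀), ∑ k ∈ Finset.range (2 ^ (j₀ + a)),
        bt (j₀ + a) k * W.ψ (j₀ + a) k z) := by
    refine hasSum_sum_of_ne_finset_zero fun a ha => Finset.sum_eq_zero fun k _ => ?_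
    rw [Finset.mem_range] at ha
    simp only [hbt]
    rw [if_neg (by omega), zero_mul]
  have hest : W.estimator T x Y n z = ∑ k ∈ Finset.range (2 ^ j₀), W.alphaHat x Y n k * W.φ j₀ k z +
      ∑ a ∈ Finset.range (T.jmax n - j₀), ∑ k ∈ Finset.range (2 ^ (j₀ + a)),
        bt (j₀ + a) k * W.ψ (j₀ + a) k z := by
    unfold estimator
    rw [Finset.sum_Ico_eq_sum_range]
    congr 1
    refine Finset.sum_congr rfl fun a ha => Finset.sum_congr rfl fun k _ => ?_
    rw [Finset.mem_range] at ha
    simp only [hbt]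
    rw [if_pos (by omega)]
  have hd := hv.sub (hf z hz.2)
  simp_rw [← Finset.sum_sub_distrib, ← sub_mul] at hd
  have h1 := hd.abs_le_of_abs_sum_range_le (B := 2 * L * C * G) (fun n' => by
    have hlev : ∀ a, |∑ k ∈ Finset.range (2 ^ (j₀ + a)),
        (bt (j₀ + a) k - W.coeffβ f (j₀ + a) k) * W.ψ (j₀ + a) k z| ≤
          2 * L * (C * H (j₀ + a)) := by
      intro a
      refine abs_sum_le_of_suppInterval (z := z) (mul_nonneg hC0.le (hH _)) (fun k hk hz => ?_)
        fun k hk hzk => ?_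
      · rw [W.ψ_eq_zero _ k (by omega) hk z hz, mul_zero]
      · rw [abs_mul]
        have h2 := ((hC (j₀ + a) k (by omega) hk).1 z).2
        have h3 := hβ (j₀ + a) k (by omega) hk ⟨z, hzk, hz.1⟩
        calc _ ≤ |bt (j₀ + a) k - W.coeffβ f (j₀ + a) k| *
              (C * (2 : ℝ) ^ (((j₀ + a : ℕ) : ℝ) / 2)) := by gcongr
          _ = C * ((2 : ℝ) ^ (((j₀ + a : ℕ) : ℝ) / 2) *
              |bt (j₀ + a) k - W.coeffβ f (j₀ + a) k|) := by ring
          _ ≤ _ := by gcongr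
    refine (Finset.abs_sum_le_sum_abs _ _).trans ((Finset.sum_le_sum fun a _ => hlev a).trans ?_)
    have hs : ∑ a ∈ Finset.range n', H (j₀ + a) ≤ G := le_trans
      (by rw [Finset.sum_range_add]
          exact le_add_of_nonneg_left (Finset.sum_nonneg fun _ _ => hH _)) (hG (j₀ + n'))
    rw [← Finset.mul_sum, ← Finset.mul_sum]
    calc 2 * L * (C * ∑ a ∈ Finset.range n', H (j₀ + a)) ≤ 2 * L * (C * G) := by gcongr
      _ = 2 * L * C * G := by ring)
  have h2 : |∑ k ∈ Finset.range (2 ^ j₀), (W.alphaHat x Y n k - W.coeffα f j₀ k) * W.φ j₀ k z| ≤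
      2 * L * (E * (C * (2 : ℝ) ^ ((j₀ : ℝ) / 2))) := by
    refine abs_sum_le_of_suppInterval (z := z) (by positivity) (fun k hk hz => ?_) fun k hk _ => ?_
    · rw [W.φ_eq_zero _ k le_rfl hk z hz, mul_zero]
    · rw [abs_mul]
      have h1 := hα k hk
      have h2 := ((hC j₀ k le_rfl hk).1 z).1
      gcongr
  have e : W.estimator T x Y n z - f z =
      (∑ a ∈ Finset.range (T.jmax n - j₀), ∑ k ∈ Finset.range (2 ^ (j₀ + a)),
        bt (j₀ + a) k * W.ψ (j₀ + a) k z -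
        (f z - ∑ k ∈ Finset.range (2 ^ j₀), W.coeffα f j₀ k * W.φ j₀ k z)) +
      ∑ k ∈ Finset.range (2 ^ j₀), (W.alphaHat x Y n k - W.coeffα f j₀ k) * W.φ j₀ k z := by
    rw [hest]
    simp_rw [sub_mul]
    rw [Finset.sum_sub_distrib]; ring
  rw [e]
  refine (abs_add_le _ _).trans ((add_le_add h1 h2).trans ?_)
  have h3 : 0 ≤ L * (C * (2 : ℝ) ^ ((j₀ : ℝ) / 2)) * G := by positivity
  have h4 : 0 ≤ L * C * E := by positivity
  linarith

/-! ### The balance between the bounds on the errors of each level -/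

/-- The minimum of an increasing and a decreasing exponential that meet at `x` with value `2^v`
decays geometrically on both sides of `x`, so its sum over levels is of order `2^v`. -/
theorem exists_sum_crossing_le {a b : ℝ} (ha : 0 < a) (hb : 0 < b) : ∃ G : ℝ, 0 < G ∧
    ∀ x : ℝ, 0 ≤ x → ∀ v : ℝ, ∃ H : ℕ → ℝ, (∀ j, 0 ≤ H j) ∧
      (∀ n, ∑ j ∈ Finset.range n, H j ≤ G * (2 : ℝ) ^ v) ∧
      ∀ j : ℕ, ∀ X : ℝ, X ≤ (2 : ℝ) ^ (v + a * (j - x)) → X ≤ (2 : ℝ) ^ (v - b * (j - x)) →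
        X ≤ H j := by
  have hm : 0 < min a b := lt_min ha hb
  obtain ⟨G, hG, h⟩ := exists_sum_two_rpow_abs_le hm
  refine ⟨G, hG, fun x hx v => ⟨fun j => (2 : ℝ) ^ (-(min a b * |(j : ℝ) - x|)) * (2 : ℝ) ^ v,
    fun j => by positivity, fun n => ?_, fun j X h1 h2 => ?_⟩⟩
  · rw [← Finset.sum_mul]
    gcongr
    exact h x hx n
  · dsimp only
    rw [← Real.rpow_add (by norm_num)]
    rcases le_total (j : ℝ) x with hjx | hjx
    · refine h1.trans (Real.rpow_le_rpow_of_exponent_le (by norm_num) ?_)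
      rw [abs_of_nonpos (by linarith)]
      nlinarith [min_le_left a b]
    · refine h2.trans (Real.rpow_le_rpow_of_exponent_le (by norm_num) ?_)
      rw [abs_of_nonneg (by linarith)]
      nlinarith [min_le_right a b]

/-- The sum over the levels `j ≤ jc` of the errors allowed by the noise level `2^{-y}`, by the local
regularity, and by the adaptive design. -/
theorem exists_level_sum {P s t u R : ℝ} (hs : 0 < s) (ht : 0 < t) (hu : 0 ≤ u)
    (hP : 0 < u → 0 < P) (hPu : P * t * u < 1) (hR : 1 ≤ R) :
    ∃ K : ℝ, 0 < K ∧ ∀ (y Λ : ℝ) (jc : ℕ), 0 ≤ y → (jc : ℝ) + 1 ≤ R * Λ →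
      ∃ H : ℕ → ℝ, (∀ j, 0 ≤ H j) ∧
        (∀ n, ∑ j ∈ Finset.range n, H j ≤
          K * ((2 : ℝ) ^ (-(y * rateExp (min (s + t * u) (s / (1 - P * t * u))))) *
            if s + t * u = s / (1 - P * t * u) then Λ else 1)) ∧
        ∀ j ≤ jc, ∀ X : ℝ, X ≤ R * (2 : ℝ) ^ (((j : ℝ) - y) / 2) →
          X ≤ R * (((j : ℝ) + 1) * (2 : ℝ) ^ (-((j : ℝ) * s))) →
          (s / (1 - P * t * u) < s + t * u → X ≤ R * (2 : ℝ) ^ (-((j : ℝ) * s))) →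
          (0 < u → X ≤ R * (2 : ℝ) ^ ((-y + (j : ℝ) * (1 - P * (s + t * u))) / (P + 2))) →
          X ≤ H j := by
  have hR0 : 0 < R := by linarith
  -- For `u = 0` one has `r' = s' = s`. The noise bound is balanced against the local decay, whose
  -- factor `j + 1 ≤ R Λ` becomes the logarithm in the rate.
  rcases hu.eq_or_lt with hu | hu
  · subst hu
    obtain ⟨G, hG, h⟩ := exists_sum_crossing_le (a := 1 / 2) (b := s) (by norm_num) hs
    refine ⟨R * R * G, by positivity, fun y Λ jc hy hjc => ?_⟩
    have hΛ : 0 ≤ R * Λ := le_trans (by positivity) hjc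
    have hΛ1 : 0 ≤ Λ := by
      by_contra hneg
      nlinarith
    have hq : 0 < 2 * s + 1 := by positivity
    obtain ⟨H, hH0, hH, hX⟩ := h (y / (2 * s + 1)) (by positivity) (-(y * rateExp s))
    have hα : rateExp s = s / (2 * s + 1) := rfl
    refine ⟨fun j => R * (R * Λ) * H j, fun j => mul_nonneg (by positivity) (hH0 j), fun n => ?_,
      fun j hj X h1 h2 _ _ => ?_⟩
    · have e1 : s + t * 0 = s := by ring
      have e2 : s / (1 - P * t * 0) = s := by simp
      rw [e1, e2, min_self, if_pos rfl, ← Finset.mul_sum]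
      calc _ ≤ R * (R * Λ) * (G * (2 : ℝ) ^ (-(y * rateExp s))) := by
            gcongr; exact hH n
        _ = _ := by ring
    · have hj' : (j : ℝ) + 1 ≤ R * Λ := by
        have : (j : ℝ) ≤ jc := by exact_mod_cast hj
        linarith
      have hp : 0 < R * Λ := lt_of_lt_of_le (by positivity) hj'
      have hp' : 0 < R * (R * Λ) := by positivity
      dsimp only
      rw [mul_comm, ← div_le_iff₀ hp']
      refine hX j _ ?_ ?_
      · rw [div_le_iff₀ hp']
        refine h1.trans ?_
        have e : -(y * rateExp s) + 1 / 2 * ((j : ℝ) - y / (2 * s + 1)) = ((j : ℝ) - y) / 2 := by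
          rw [hα]; field_simp; ring
        rw [e]
        have h1j : 1 ≤ R * Λ := by
          have : (0 : ℝ) ≤ j := Nat.cast_nonneg j
          linarith
        nlinarith [show 0 < R * (2 : ℝ) ^ (((j : ℝ) - y) / 2) by positivity]
      · rw [div_le_iff₀ hp']
        refine h2.trans ?_
        have e : -(y * rateExp s) - s * ((j : ℝ) - y / (2 * s + 1)) = -((j : ℝ) * s) := by
          rw [hα]; field_simp; ring
        rw [e]
        calc _ ≤ R * (R * Λ * (2 : ℝ) ^ (-((j : ℝ) * s))) := by gcongr
          _ = _ := by ring
  have hP := hP hu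
  have htu : 0 < t * u := by positivity
  have h1P : 0 < 1 - P * t * u := by linarith
  have hPtu : 0 < P * t * u := by positivity
  have hr0 : 0 < s + t * u := by positivity
  -- As `t u > 0`, comparing `P r'` with `1` is comparing `s'` with `r'`. Below `1` the adaptive
  -- bound increases with `j` and is balanced against `2^{-js}`, for which the decay without the
  -- factor `j + 1` is needed. At `1` it is constant, and the `O(Λ)` levels add up. Above `1` it
  -- decreases and is balanced against the noise bound.
  rcases lt_trichotomy (P * (s + t * u)) 1 with hc | hc | hc
  · have hlt : s / (1 - P * t * u) < s + t * u := by
      rw [div_lt_iff₀ h1P]; nlinarith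
    have hd : 0 < (1 - P * (s + t * u)) / (P + 2) := div_pos (by linarith) (by linarith)
    obtain ⟨G, hG, h⟩ := exists_sum_crossing_le hd hs
    refine ⟨R * G, by positivity, fun y Λ jc hy hjc => ?_⟩
    have hq : 0 < 2 * s + 1 - P * t * u := by linarith
    have hα : rateExp (s / (1 - P * t * u)) = s / (2 * s + 1 - P * t * u) := by
      unfold rateExp
      have : 2 * (s / (1 - P * t * u)) + 1 = (2 * s + 1 - P * t * u) / (1 - P * t * u) := by
        field_simp; ring
      rw [this, div_div_div_cancel_right₀ h1P.ne']
    rw [min_eq_right hlt.le, if_neg hlt.ne', mul_one, hα]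
    -- The crossing level solves `-y + j (1 - P (s + t u)) = -(P + 2) j s`.
    obtain ⟨H, hH0, hH, hX⟩ := h (y / (2 * s + 1 - P * t * u)) (by positivity)
      (-(y * (s / (2 * s + 1 - P * t * u))))
    refine ⟨fun j => R * H j, fun j => mul_nonneg hR0.le (hH0 j), fun n => ?_,
      fun j hj X _ _ h3 h4 => ?_⟩
    · rw [← Finset.mul_sum, mul_assoc]
      gcongr; exact hH n
    · dsimp only
      rw [mul_comm, ← div_le_iff₀ hR0]
      refine hX j _ ?_ ?_
      · rw [div_le_iff₀ hR0, mul_comm]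
        refine (h4 hu).trans (le_of_eq ?_)
        congr 2
        have hqd : 2 * s + 1 - P * t * u ≠ 0 := hq.ne'
        have e : y = y / (2 * s + 1 - P * t * u) * (2 * s + 1 - P * t * u) := by field_simp
        rw [div_eq_iff (by positivity), mul_div_left_comm]
        generalize y / (2 * s + 1 - P * t * u) = z at e
        rw [e]
        field_simp
        ring
      · rw [div_le_iff₀ hR0, mul_comm]
        refine (h3 hlt).trans (le_of_eq ?_)
        congr 2
        field_simp
        ring
  · have heq : s + t * u = s / (1 - P * t * u) := by
      rw [eq_div_iff h1P.ne']
      have : (s + t * u) * (1 - P * t * u) = s + t * u - (P * (s + t * u)) * (t * u) := by ring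
      rw [this, hc]; ring
    refine ⟨R * R, by positivity, fun y Λ jc hy hjc => ?_⟩
    -- Here `r' = 1 / P`, so the level-independent adaptive bound already has the exponent of the
    -- rate.
    have hα : rateExp (s + t * u) = 1 / (P + 2) := by
      unfold rateExp
      rw [div_eq_div_iff (by positivity) (by positivity)]
      nlinarith
    rw [← heq, min_self, if_pos rfl, hα]
    refine ⟨fun j => if j ≤ jc then R * (2 : ℝ) ^ (-(y * (1 / (P + 2)))) else 0,
      fun j => by dsimp only; split_ifs <;> positivity, fun n => ?_, fun j hj X _ _ _ h4 => ?_⟩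
    · rw [← Finset.sum_filter, Finset.sum_const, nsmul_eq_mul]
      have hcard : (((Finset.range n).filter (· ≤ jc)).card : ℝ) ≤ R * Λ := by
        refine le_trans ?_ hjc
        have : ((Finset.range n).filter (· ≤ jc)).card ≤ (Finset.range (jc + 1)).card :=
          Finset.card_le_card fun j hj => by
            rw [Finset.mem_filter] at hj
            rw [Finset.mem_range]; omega
        rw [Finset.card_range] at this
        exact_mod_cast this
      calc _ ≤ R * Λ * (R * (2 : ℝ) ^ (-(y * (1 / (P + 2))))) := by gcongr
        _ = _ := by ring
    · dsimp only
      rw [if_pos hj]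
      refine (h4 hu).trans (le_of_eq ?_)
      rw [hc]
      congr 2
      field_simp
      ring
  · have hlt : s + t * u < s / (1 - P * t * u) := by
      rw [lt_div_iff₀ h1P]; nlinarith
    have hd : 0 < (P * (s + t * u) - 1) / (P + 2) := div_pos (by linarith) (by linarith)
    obtain ⟨G, hG, h⟩ := exists_sum_crossing_le (a := 1 / 2) (by norm_num) hd
    refine ⟨R * G, by positivity, fun y Λ jc hy hjc => ?_⟩
    have hq : 0 < 2 * (s + t * u) + 1 := by positivity
    rw [min_eq_left hlt.le, if_neg hlt.ne, mul_one]
    obtain ⟨H, hH0, hH, hX⟩ := h (y / (2 * (s + t * u) + 1)) (by positivity)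
      (-(y * rateExp (s + t * u)))
    refine ⟨fun j => R * H j, fun j => mul_nonneg hR0.le (hH0 j), fun n => ?_,
      fun j hj X h1 _ _ h4 => ?_⟩
    · rw [← Finset.mul_sum, mul_assoc]
      gcongr; exact hH n
    · have hα : rateExp (s + t * u) = (s + t * u) / (2 * (s + t * u) + 1) := rfl
      generalize s + t * u = r' at *
      rw [hα] at hX
      dsimp only
      rw [mul_comm, ← div_le_iff₀ hR0]
      refine hX j _ ?_ ?_
      · rw [div_le_iff₀ hR0, mul_comm]
        refine h1.trans (le_of_eq ?_)
        congr 2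
        field_simp
        ring
      · rw [div_le_iff₀ hR0, mul_comm]
        refine (h4 hu).trans (le_of_eq ?_)
        congr 2
        field_simp
        ring

/-! ### Cascade of the stages of a run -/

theorem eventually_log_pow_le : ∀ᶠ n : ℕ in atTop,
    1 ≤ Real.log n ∧ Real.log n ^ 3 ≤ (n : ℝ) ^ (1 / 2 : ℝ) := by
  have h1 := ((isLittleO_log_rpow_rpow_atTop 3 (show (0 : ℝ) < 1 / 2 by norm_num)).comp_tendsto
    (tendsto_natCast_atTop_atTop (R := ℝ))).bound (show (0 : ℝ) < 1 by norm_num)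
  have h2 := (Real.tendsto_log_atTop.comp
    (tendsto_natCast_atTop_atTop (R := ℝ))).eventually_ge_atTop 1
  filter_upwards [h1, h2] with n h1 h2
  simp only [Function.comp_apply, one_mul, Real.norm_eq_abs] at h1 h2
  refine ⟨h2, ?_⟩
  rw [abs_of_nonneg (by positivity), abs_of_nonneg (by positivity)] at h1
  rwa [show (3 : ℝ) = ((3 : ℕ) : ℝ) by norm_num, Real.rpow_natCast] at h1

theorem log_pow_div_le {n : ℕ} (hn : 0 < n) (h : Real.log n ^ 3 ≤ (n : ℝ) ^ (1 / 2 : ℝ)) :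
    Real.log n ^ 3 / n ≤ (n : ℝ) ^ (-(1 / 2) : ℝ) := by
  have hn' : (0 : ℝ) < n := by exact_mod_cast hn
  rw [div_le_iff₀ hn', ← Real.rpow_add_one hn'.ne']
  norm_num
  norm_num at h
  exact h

/-- The times up to `n` at which the noise has to be controlled, for `n` in stage `m + 1`. -/
def Tuning.stageTime {j₀ : ℕ} (T : Tuning j₀) (n m a : ℕ) : ℕ := if a = 0 then n else T.size (m - a)

theorem Tuning.size_le_stageTime {j₀ : ℕ} (T : Tuning j₀) {n m : ℕ} (hn : T.size m ≤ n) (a : ℕ) :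
    T.size (m - a) ≤ T.stageTime n m a := by
  unfold stageTime
  split_ifs with h
  · subst h; exact hn
  · exact le_rfl

theorem Tuning.stageTime_le {j₀ : ℕ} (T : Tuning j₀) {n m : ℕ} (hn : T.size m ≤ n) (a : ℕ) :
    T.stageTime n m a ≤ n := by
  unfold stageTime
  split_ifs with h
  · exact le_rfl
  · exact (T.size_strictMono.monotone (Nat.sub_le _ _)).trans hn

theorem exists_pow_mul_le {t x : ℝ} (ht : 0 < t) (ht1 : t < 1) : ∃ a : ℕ, t ^ a * x ≤ 1 / 2 := by
  have h := (tendsto_pow_atTop_nhds_zero_of_lt_one ht.le ht1).mul_const x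
  rw [zero_mul] at h
  exact (h.eventually_le_const (show (0 : ℝ) < 1 / 2 by norm_num)).exists

/-- The cascade is formed by the last `2 a` stages of the run. The condition on `a` ensures that for
`j' ≤ t^a j` the factor `2^{j'(2(s+tu)+1)}` is at most `2^{j/2} ≤ √n`, while `log³ n / n ≤
n^{-1/2}`, so the recursion ends where the uniform noise bound suffices. -/
theorem WaveletBasis.exists_min_noiseBound_le {j₀ N L : ℕ} (W : WaveletBasis j₀ N L)
    (T : Tuning j₀) {M : ℝ} (hM : 0 < M) {κ : ℝ} (hκ1 : 1 < κ) (hκ : κ < T.κ) {P s u t B : ℝ}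
    (hP : 0 < P) (hB : 0 < B) (hs : 0 ≤ s) (hu : 0 ≤ u) (hPu : P * t * u ≤ 2 * s + 1) (ht : 0 < t)
    {a : ℕ} (ha : t ^ a * (2 * (s + t * u) + 1) ≤ 1 / 2) {D : ℝ} (hD : 1 ≤ D) :
    ∃ K : ℝ, 1 ≤ K ∧ ∃ c > 0, ∃ n₁ : ℕ, ∀ n, n₁ ≤ n → ∀ f : ℝ → ℝ, W.Controlled M f →
      (∀ j, j₀ ≤ j → ∑ k ∈ Finset.range (2 ^ j), |W.coeffβ f j k| ^ P ≤
        B * (2 : ℝ) ^ (-((j : ℝ) * (P * (s + u + 1 / 2) - 1)))) →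
      ∀ I : Set ℝ, Detectable L j₀ I s t (fun j k => |W.coeffβ f j k|) →
      ∀ x Y ε : ℕ → ℝ, IsRun W T x Y → (∀ m, Y m = f (x m) + ε m) →
      ∀ m, 2 * a + 2 ≤ m → T.size m ≤ n → (n : ℝ) ≤ D * T.size (m - (2 * a + 2)) →
      (∀ i ≤ 2 * a, W.NoiseGood T κ x ε (T.stageTime n m i)) →
      ∀ jc : ℕ, (2 : ℝ) ^ jc ≤ c * (n / Real.log n) → ∀ j k, j₀ ≤ j → j ≤ jc → k < 2 ^ j →
        (suppInterval L j k ∩ I).Nonempty →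
        min |W.coeffβ f j k| (noiseBound L T.σ x n j k) ^ (P + 2) ≤
          K * (Real.log n ^ 3 / n) * (2 : ℝ) ^ (-((j : ℝ) * (P * (s + t * u + 1 / 2)))) := by
  obtain ⟨C₁, hC₁, n₁, hest⟩ := W.exists_estimates T hM hκ1 hκ hD
  obtain ⟨C₂, hC₂, c₂, hc₂, n₂, hada⟩ :=
    W.exists_adaptive_noiseBound T hM hκ1 hκ hD (r := s + u) hP hB
  obtain ⟨c₁, hc₁, c₃, -, n₃, hn₃, hj⟩ := T.exists_jmax_bounds
  set C := max C₁ C₂ with hC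
  have hC1 : 1 ≤ C := hC₁.trans (le_max_left _ _)
  have hC0 : 0 < C := by linarith
  obtain ⟨J, hcas⟩ := Cascade.exists_bound L j₀ hP hu hPu ht hC1
  obtain ⟨K, hK, hcas⟩ := hcas a
  obtain ⟨n₄, hn₄⟩ := eventually_atTop.1 (eventually_log_pow_le.and
    ((tendsto_natCast_atTop_atTop (R := ℝ)).eventually_ge_atTop
      (((2 : ℝ) ^ ((J : ℝ) * (2 * (s + t * u + 1 / 2)))) ^ (2 : ℝ))))
  refine ⟨K, hK, min c₂ (min (c₁ / 2) 1), by positivity, max (max n₁ n₂) (max n₃ n₄),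
    fun n hn f hf hbes I hdet x Y ε hrun hY m hm hmn hnD hgood jc hjc => ?_⟩
  have hn1 : n₁ ≤ n := le_trans (by simp) hn
  have hn2 : n₂ ≤ n := le_trans (by simp) hn
  have hn3 : n₃ ≤ n := le_trans (by simp) hn
  obtain ⟨⟨hl1, hl3⟩, hJn⟩ := hn₄ n (le_trans (by simp) hn)
  have hnpos : 0 < n := by omega
  have hn0 : (0 : ℝ) < n := by exact_mod_cast hnpos
  have hl0 : 0 < Real.log n := by linarith
  have hw := log_pow_div_le hnpos hl3
  have hnl : 0 < (n : ℝ) / Real.log n := by positivity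
  have hru : 0 ≤ s + t * u := by positivity
  have hsz : ∀ i, (n : ℝ) ≤ D * T.size (m - (2 * a + 2)) → i ≤ 2 * a + 2 →
      (n : ℝ) ≤ D * T.size (m - i) := fun i h hi => h.trans (by
    gcongr
    exact T.size_strictMono.monotone (by omega))
  have hjj : ∀ j, j ≤ jc → (2 : ℝ) ^ j ≤ c₂ * (n / Real.log n) ∧ j < T.jmax n ∧ (2 : ℝ) ^ j ≤ n := by
    intro j hj'
    have h1 : (2 : ℝ) ^ j ≤ min c₂ (min (c₁ / 2) 1) * (n / Real.log n) :=
      (pow_le_pow_right₀ (by norm_num) hj').trans hjc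
    refine ⟨h1.trans (by gcongr; exact min_le_left _ _), ?_, ?_⟩
    · have h2 : (2 : ℝ) ^ j < 2 ^ T.jmax n := by
        refine h1.trans_lt (lt_of_lt_of_le ?_ (hj n hn3).1)
        have : min c₂ (min (c₁ / 2) 1) ≤ c₁ / 2 := (min_le_right _ _).trans (min_le_left _ _)
        exact mul_lt_mul_of_pos_right (by linarith) hnl
      exact (pow_lt_pow_iff_right₀ (by norm_num)).1 h2
    · calc _ ≤ 1 * ((n : ℝ) / Real.log n) := h1.trans (by
            gcongr; exact (min_le_right _ _).trans (min_le_right _ _))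
        _ ≤ n := by rw [one_mul]; exact div_le_self hn0.le hl1
  have hcasc : Cascade L j₀ jc (2 * a) I s u t P C (Real.log n ^ 3 / n)
      (fun j k => |W.coeffβ f j k|) (fun i j k => noiseBound L T.σ x (T.stageTime n m i) j k) := by
    refine ⟨fun _ _ => abs_nonneg _, fun _ _ _ => noiseBound_nonneg T.σ_pos.le _ _ _ _,
      by positivity, fun i hi j k hj0 hjc' hk => ?_,
      fun i hi j k j' k' hj0 hjc' hk hj0' hjc'' hk' hss => ?_, hdet⟩
    · have h1 := (hest n hn1 f hf x Y ε hrun hY (m - i - 1) (T.stageTime n m i)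
        (by rw [show m - i - 1 + 1 = m - i by omega]; exact T.size_le_stageTime hmn i)
        (T.stageTime_le hmn i) (by rw [Nat.sub_sub]; exact hsz _ hnD (by omega))).1 j k
        (hjj j hjc').2.1 hk
      refine h1.trans ?_
      gcongr
      · exact le_max_left _ _
      · nlinarith [mul_nonneg hl0.le (show 0 ≤ Real.log n ^ 2 - 1 by nlinarith)]
    · have e1 : m - i - 2 + 1 = m - (i + 1) := by omega
      have h1 := hada n hn2 f hf hbes x Y ε hrun hY (m - i - 2) (T.stageTime n m i)
        (by rw [show m - i - 2 + 2 = m - i by omega]; exact T.size_le_stageTime hmn i)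
        (T.stageTime_le hmn i) (by rw [Nat.sub_sub]; exact hsz _ hnD (by omega))
        (by have := hgood (i + 1) (by omega)
            rw [Tuning.stageTime, if_neg (by omega)] at this
            rw [e1]; exact this)
        j k j' k' hj0' (hjj j' hjc'').1 hk' (hjj j hjc').2.1 hk hss
      rw [e1] at h1
      have e2 : T.stageTime n m (i + 1) = T.size (m - (i + 1)) := if_neg (by omega)
      rw [e2]
      rcases h1 with h1 | h1
      · left
        refine h1.trans ?_
        gcongr
        · exact noiseBound_nonneg T.σ_pos.le _ _ _ _
        · exact le_max_right _ _
      · right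
        refine h1.trans ?_
        gcongr
        exact le_max_right _ _
  intro j k hj0 hjc' hk hne
  refine hcas jc (2 * a) I _ _ _ hcasc ?_ 0 (by omega) j k hj0 hjc' hk hne ?_
  · intro j hj
    calc _ ≤ (2 : ℝ) ^ ((J : ℝ) * (2 * (s + t * u + 1 / 2))) * (n : ℝ) ^ (-(1 / 2) : ℝ) := by
          gcongr; norm_num
      _ ≤ (n : ℝ) ^ (1 / 2 : ℝ) * (n : ℝ) ^ (-(1 / 2) : ℝ) := by
          gcongr
          have := Real.rpow_le_rpow (by positivity) hJn (show (0 : ℝ) ≤ 1 / 2 by norm_num)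
          rwa [← Real.rpow_mul (by positivity), show (2 : ℝ) * (1 / 2) = 1 by norm_num,
            Real.rpow_one] at this
      _ = 1 := by rw [← Real.rpow_add hn0]; norm_num
  · intro j' hj'
    calc _ ≤ (2 : ℝ) ^ ((j : ℝ) * (1 / 2)) * (n : ℝ) ^ (-(1 / 2) : ℝ) := by
          refine mul_le_mul ?_ hw (by positivity) (by positivity)
          refine Real.rpow_le_rpow_of_exponent_le (by norm_num) ?_
          have : (0 : ℝ) ≤ j := Nat.cast_nonneg j
          calc (j' : ℝ) * (2 * (s + t * u + 1 / 2)) ≤ t ^ a * j * (2 * (s + t * u + 1 / 2)) := by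
                gcongr
            _ = j * (t ^ a * (2 * (s + t * u) + 1)) := by ring
            _ ≤ _ := by gcongr
      _ ≤ (n : ℝ) ^ (1 / 2 : ℝ) * (n : ℝ) ^ (-(1 / 2) : ℝ) := by
          gcongr
          rw [Real.rpow_mul (by norm_num), Real.rpow_natCast]
          exact Real.rpow_le_rpow (by positivity) (hjj j hjc').2.2 (by norm_num)
      _ = 1 := by rw [← Real.rpow_add hn0]; norm_num

/-! ### The error on the event of controlled noise -/

theorem WaveletBasis.sum_coeffβ_rpow_le {j₀ N L : ℕ} (W : WaveletBasis j₀ N L) {p : ℝ≥0∞}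
    (hp : p ≠ ⊤) (hp0 : 0 < p.toReal) {r M : ℝ} {f : ℝ → ℝ}
    (hf : f ∈ W.besovClass r p M) (j : ℕ) (hj : j₀ ≤ j) :
    ∑ k ∈ Finset.range (2 ^ j), |W.coeffβ f j k| ^ p.toReal ≤
      M ^ p.toReal * (2 : ℝ) ^ (-((j : ℝ) * (p.toReal * (r + 1 / 2) - 1))) := by
  rw [besovClass, if_neg hp] at hf
  have h := hf.2.2 j hj
  set S := ∑ k ∈ Finset.range (2 ^ j), |W.coeffβ f j k| ^ p.toReal with hS
  have hS0 : 0 ≤ S := Finset.sum_nonneg fun _ _ => by positivity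
  have h1 := Real.rpow_le_rpow (by positivity) h hp0.le
  rw [Real.mul_rpow (by positivity) (by positivity), ← Real.rpow_mul hS0,
    one_div_mul_cancel hp0.ne', Real.rpow_one, ← Real.rpow_mul (by norm_num)] at h1
  have e : (j : ℝ) * (r + 1 / 2 - 1 / p.toReal) * p.toReal =
      (j : ℝ) * (p.toReal * (r + 1 / 2) - 1) := by field_simp
  rw [e] at h1
  rw [Real.rpow_neg (by norm_num), ← div_eq_mul_inv, le_div_iff₀ (by positivity), mul_comm]
  exact h1

theorem WaveletBasis.controlled_of_mem {j₀ N L : ℕ} (W : WaveletBasis j₀ N L) {p : ℝ≥0∞}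
    (hp : 1 ≤ p) {r M : ℝ} (hr : 1 / 2 + p⁻¹.toReal ≤ r) {f : ℝ → ℝ}
    (hf : f ∈ W.besovClass r p M) (hs : W.IsSumOfSeries f) : W.Controlled M f :=
  have h := W.besovClass_bounds hp hr hf
  ⟨h.1, hs, h.2.1, h.2.2⟩

/-- With `s ≥ 1/2`, a rate exponent below `s` makes the levels beyond `n / log n` negligible, and
one below `1/2` does so for the error in the coarsest scaling coefficients. -/
theorem rateExp_bounds {s m : ℝ} (hs : 1 / 2 ≤ s) (hm : 0 < m) :
    0 < rateExp m ∧ rateExp m < s ∧ rateExp m < 1 / 2 := by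
  unfold rateExp
  have h : 0 < 2 * m + 1 := by linarith
  refine ⟨by positivity, ?_, ?_⟩
  · rw [div_lt_iff₀ h]; nlinarith
  · rw [div_lt_iff₀ h]; linarith

/-- Bounds for the error `2^{j/2} min(b, e)` in a coefficient of size `b` with noise bound `e`. -/
theorem level_error_bounds {C Cd K P s r' M y b e R : ℝ} (hC : 1 ≤ C) (hCd : 0 ≤ Cd) (hK : 1 ≤ K)
    (hM : 0 ≤ M) (hP : 0 ≤ P) (hb : 0 ≤ b) (he : 0 ≤ e) (hR : C * (C + Cd + M + K) ≤ R) (j : ℕ)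
    (hew : e ^ 2 ≤ C * (2 : ℝ) ^ (-y))
    (hbd : b ≤ Cd * (j + 1) * (2 : ℝ) ^ (-((j : ℝ) * (s + 1 / 2)))) :
    (2 : ℝ) ^ ((j : ℝ) / 2) * (C * min b e) ≤ R * (2 : ℝ) ^ (((j : ℝ) - y) / 2) ∧
    (2 : ℝ) ^ ((j : ℝ) / 2) * (C * min b e) ≤ R * (((j : ℝ) + 1) * (2 : ℝ) ^ (-((j : ℝ) * s))) ∧
    ((2 : ℝ) ^ ((j : ℝ) * (s + 1 / 2)) * b ≤ M →
      (2 : ℝ) ^ ((j : ℝ) / 2) * (C * min b e) ≤ R * (2 : ℝ) ^ (-((j : ℝ) * s))) ∧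
    (min b e ^ (P + 2) ≤ K * (2 : ℝ) ^ (-y) * (2 : ℝ) ^ (-((j : ℝ) * (P * (r' + 1 / 2)))) →
      (2 : ℝ) ^ ((j : ℝ) / 2) * (C * min b e) ≤
        R * (2 : ℝ) ^ ((-y + (j : ℝ) * (1 - P * r')) / (P + 2))) := by
  have hC0 : 0 < C := by linarith
  have hK0 : 0 < K := by linarith
  have hX : 0 ≤ min b e := le_min hb he
  have hRC : C * C ≤ R := le_trans (by gcongr; linarith) hR
  have hRd : C * Cd ≤ R := le_trans (by gcongr; linarith) hR
  have hRM : C * M ≤ R := le_trans (by gcongr; linarith) hR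
  have hRK : C * K ≤ R := le_trans (by gcongr; linarith) hR
  have hsplit : ∀ v : ℝ, (2 : ℝ) ^ ((j : ℝ) / 2) * (2 : ℝ) ^ v = (2 : ℝ) ^ ((j : ℝ) / 2 + v) :=
    fun v => (Real.rpow_add (by norm_num) _ _).symm
  refine ⟨?_, ?_, fun h => ?_, fun h => ?_⟩
  · have h1 : e ≤ C * (2 : ℝ) ^ (-y / 2) := by
      refine abs_le_of_sq_le_sq' ?_ (by positivity) |>.2
      refine hew.trans ?_
      rw [mul_pow, ← Real.rpow_natCast ((2 : ℝ) ^ (-y / 2)), ← Real.rpow_mul (by norm_num)]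
      have e1 : -y / 2 * ((2 : ℕ) : ℝ) = -y := by push_cast; ring
      rw [e1]
      gcongr
      nlinarith
    calc _ ≤ (2 : ℝ) ^ ((j : ℝ) / 2) * (C * (C * (2 : ℝ) ^ (-y / 2))) := by
          gcongr; exact (min_le_right _ _).trans h1
      _ = C * C * (2 : ℝ) ^ (((j : ℝ) - y) / 2) := by
          rw [show ((j : ℝ) - y) / 2 = (j : ℝ) / 2 + -y / 2 by ring, ← hsplit]; ring
      _ ≤ _ := by gcongr
  · calc _ ≤ (2 : ℝ) ^ ((j : ℝ) / 2) *
          (C * (Cd * (j + 1) * (2 : ℝ) ^ (-((j : ℝ) * (s + 1 / 2))))) := by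
          gcongr; exact (min_le_left _ _).trans hbd
      _ = C * Cd * (((j : ℝ) + 1) * (2 : ℝ) ^ (-((j : ℝ) * s))) := by
          rw [show -((j : ℝ) * s) = (j : ℝ) / 2 + -((j : ℝ) * (s + 1 / 2)) by ring, ← hsplit]; ring
      _ ≤ _ := by gcongr
  · have h1 : b ≤ M * (2 : ℝ) ^ (-((j : ℝ) * (s + 1 / 2))) := by
      rw [Real.rpow_neg (by norm_num), ← div_eq_mul_inv, le_div_iff₀ (by positivity), mul_comm]
      exact h
    calc _ ≤ (2 : ℝ) ^ ((j : ℝ) / 2) * (C * (M * (2 : ℝ) ^ (-((j : ℝ) * (s + 1 / 2))))) := by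
          gcongr; exact (min_le_left _ _).trans h1
      _ = C * M * (2 : ℝ) ^ (-((j : ℝ) * s)) := by
          rw [show -((j : ℝ) * s) = (j : ℝ) / 2 + -((j : ℝ) * (s + 1 / 2)) by ring, ← hsplit]; ring
      _ ≤ _ := by gcongr
  · have hP2 : 0 < P + 2 := by linarith
    have h1 : min b e ≤
        K * (2 : ℝ) ^ ((-y + -((j : ℝ) * (P * (r' + 1 / 2)))) / (P + 2)) := by
      rw [← Real.rpow_le_rpow_iff hX (by positivity) hP2]
      refine h.trans ?_
      rw [Real.mul_rpow (by positivity) (by positivity), ← Real.rpow_mul (by norm_num),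
        div_mul_cancel₀ _ hP2.ne', Real.rpow_add (show (0 : ℝ) < 2 by norm_num), mul_assoc]
      gcongr
      exact Real.self_le_rpow_of_one_le hK (by linarith)
    calc _ ≤ (2 : ℝ) ^ ((j : ℝ) / 2) *
          (C * (K * (2 : ℝ) ^ ((-y + -((j : ℝ) * (P * (r' + 1 / 2)))) / (P + 2)))) := by gcongr
      _ = C * K * (2 : ℝ) ^ ((-y + (j : ℝ) * (1 - P * r')) / (P + 2)) := by
          rw [show (-y + (j : ℝ) * (1 - P * r')) / (P + 2) = (j : ℝ) / 2 +
            (-y + -((j : ℝ) * (P * (r' + 1 / 2)))) / (P + 2) by field_simp; ring, ← hsplit]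
          ring
      _ ≤ _ := by gcongr

/-- The parameters of the classes in terms of the gap `u = max(r - s, 0)`. -/
theorem gapU_bounds {p : ℝ≥0∞} (hp : 1 ≤ p) {r s t : ℝ} (hr : 1 / 2 + p⁻¹.toReal ≤ r)
    (hs : r - p⁻¹.toReal ≤ s) (ht : 0 < t) (ht1 : t < 1) :
    1 / 2 ≤ s ∧ 0 ≤ gapU r s ∧ p.toReal * t * gapU r s < 1 ∧
      (0 < gapU r s → p ≠ ⊤ ∧ 0 < p.toReal ∧ r = s + gapU r s) := by
  have hu : 0 ≤ gapU r s := le_max_right _ _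
  refine ⟨by linarith, hu, ?_, fun h => ?_⟩
  · rcases eq_or_ne p ⊤ with rfl | hpt
    · simp
    · have hp0 : 0 < p.toReal := ENNReal.toReal_pos (by positivity) hpt
      -- From `s ≥ r - 1/p` one gets `u ≤ 1/p`, hence `p t u ≤ t < 1`.
      have h1 : gapU r s ≤ p.toReal⁻¹ := by
        rw [ENNReal.toReal_inv] at hs
        exact max_le (by linarith) (by positivity)
      calc p.toReal * t * gapU r s ≤ p.toReal * t * p.toReal⁻¹ := by gcongr
        _ = t := by field_simp
        _ < 1 := ht1
  · have h1 : 0 < r - s := by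
      by_contra hneg
      rw [gapU, max_eq_right (not_lt.1 hneg)] at h
      exact lt_irrefl _ h
    have hpt : p ≠ ⊤ := by
      rintro rfl
      simp at hs
      linarith
    refine ⟨hpt, ENNReal.toReal_pos (by positivity) hpt, ?_⟩
    rw [gapU, max_eq_left h1.le]; ring

theorem log_le_log_pow {n : ℕ} (hl : 1 ≤ Real.log n) : Real.log n ≤ Real.log n ^ 3 :=
  le_self_pow₀ hl (by norm_num)

/-- A level `jc` with `2^jc` close to `c n / log n`. -/
theorem exists_level_near {c : ℝ} (hc : 0 < c) (hc1 : c ≤ 1) {n : ℕ} (hn : 0 < n)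
    (hl1 : 1 ≤ Real.log n) (hl3 : Real.log n ^ 3 ≤ (n : ℝ) ^ (1 / 2 : ℝ))
    (hcn : (1 / c) ^ (2 : ℝ) ≤ n) :
    ∃ jc : ℕ, (2 : ℝ) ^ jc ≤ c * (n / Real.log n) ∧ c * (n / Real.log n) < (2 : ℝ) ^ (jc + 1) ∧
      (jc : ℝ) + 1 ≤ 3 * Real.log n := by
  have hn0 : (0 : ℝ) < n := by exact_mod_cast hn
  have hl0 : 0 < Real.log n := by linarith
  have hnl : 0 < (n : ℝ) / Real.log n := by positivity
  have hcnl : 1 ≤ c * (n / Real.log n) := by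
    have h1 : 1 / c ≤ (n : ℝ) ^ (1 / 2 : ℝ) := by
      have := Real.rpow_le_rpow (by positivity) hcn (show (0 : ℝ) ≤ 1 / 2 by norm_num)
      rwa [← Real.rpow_mul (by positivity), show (2 : ℝ) * (1 / 2) = 1 by norm_num,
        Real.rpow_one] at this
    have h2 : Real.log n ≤ (n : ℝ) ^ (1 / 2 : ℝ) := (log_le_log_pow hl1).trans hl3
    have h3 : (n : ℝ) ^ (1 / 2 : ℝ) * (n : ℝ) ^ (1 / 2 : ℝ) = n := by
      rw [← Real.rpow_add hn0]; norm_num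
    have h4 : 1 / c ≤ n / Real.log n := by
      refine h1.trans ?_
      rw [le_div_iff₀ hl0]
      calc _ ≤ (n : ℝ) ^ (1 / 2 : ℝ) * (n : ℝ) ^ (1 / 2 : ℝ) := by gcongr
        _ = n := h3
    rw [div_le_iff₀ hc] at h4
    linarith
  obtain ⟨jc, hjc, hjc'⟩ := exists_nat_pow_near hcnl (show (1 : ℝ) < 2 by norm_num)
  refine ⟨jc, hjc, hjc', ?_⟩
  have h1 : (2 : ℝ) ^ jc ≤ n := by
    calc _ ≤ 1 * ((n : ℝ) / Real.log n) := hjc.trans (by gcongr)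
      _ ≤ n := by rw [one_mul]; exact div_le_self hn0.le hl1
  have h2 := Real.log_le_log (by positivity) h1
  rw [Real.log_pow] at h2
  have h3 := Real.log_two_gt_d9
  have h4 : (jc : ℝ) ≤ 2 * Real.log n := by nlinarith [Nat.cast_nonneg (α := ℝ) jc]
  linarith

-- Levels up to `jc`, with `2^jc` close to `c n / log n`, are treated by the balance of level
-- bounds; beyond `jc` the error is at most a multiple of the coefficient, which decays fast enough.
-- The number `a` is fixed before `D` because the stage ratio `D` used later depends on `a`.
set_option maxHeartbeats 1600000 in
theorem WaveletBasis.exists_path_bound {j₀ N L : ℕ} (W : WaveletBasis j₀ N L) (T : Tuning j₀)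
    {κ : ℝ} (hκ1 : 1 < κ) (hκ : κ < T.κ)
    {p : ℝ≥0∞} (hp : 1 ≤ p) {r s t M : ℝ} (hr : 1 / 2 + p⁻¹.toReal ≤ r)
    (hs : r - p⁻¹.toReal ≤ s) (ht : 0 < t) (ht1 : t < 1) (hM : 0 < M) :
    ∃ a : ℕ, ∀ D : ℝ, 1 ≤ D → ∃ K : ℝ, 0 < K ∧ ∃ n₁ : ℕ, ∀ n, n₁ ≤ n → ∀ I : Set ℝ,
      ∀ f ∈ W.sparseDetectable p r s t M I, W.IsSumOfSeries f →
      (sPrime p r s t < rPrime r s t → W.EdgeBound s M I f) →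
      ∀ x Y ε : ℕ → ℝ, IsRun W T x Y → (∀ m, Y m = f (x m) + ε m) →
      ∀ m, 2 * a + 2 ≤ m → T.size m ≤ n → (n : ℝ) ≤ D * T.size (m - (2 * a + 2)) →
      (∀ i ≤ 2 * a, W.NoiseGood T κ x ε (T.stageTime n m i)) →
      ∀ z ∈ I ∩ Ico 0 1, |W.estimator T x Y n z - f z| ≤ K * sensingRate p r s t n := by
  obtain ⟨hs2, hu, hPu, hgap⟩ := gapU_bounds hp hr hs ht ht1
  have hs0 : 0 < s := by linarith
  obtain ⟨a, ha⟩ := exists_pow_mul_le (x := 2 * (s + t * gapU r s) + 1) ht ht1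
  refine ⟨a, fun D hD => ?_⟩
  have hP0 : 0 ≤ p.toReal := ENNReal.toReal_nonneg
  have hcas : ∃ K : ℝ, 1 ≤ K ∧ ∃ c > 0, ∃ n₁ : ℕ, ∀ n, n₁ ≤ n → ∀ I : Set ℝ,
      ∀ f ∈ W.sparseDetectable p r s t M I, W.IsSumOfSeries f →
      ∀ x Y ε : ℕ → ℝ, IsRun W T x Y → (∀ m, Y m = f (x m) + ε m) →
      ∀ m, 2 * a + 2 ≤ m → T.size m ≤ n → (n : ℝ) ≤ D * T.size (m - (2 * a + 2)) →
      (∀ i ≤ 2 * a, W.NoiseGood T κ x ε (T.stageTime n m i)) → 0 < gapU r s →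
      ∀ jc : ℕ, (2 : ℝ) ^ jc ≤ c * (n / Real.log n) → ∀ j k, j₀ ≤ j → j ≤ jc → k < 2 ^ j →
        (suppInterval L j k ∩ I).Nonempty →
        min |W.coeffβ f j k| (noiseBound L T.σ x n j k) ^ (p.toReal + 2) ≤
          K * (Real.log n ^ 3 / n) *
            (2 : ℝ) ^ (-((j : ℝ) * (p.toReal * (s + t * gapU r s + 1 / 2)))) := by
    -- The adaptive bound is only claimed for `u > 0`, which forces `p < ∞`.
    rcases hu.eq_or_lt with hu0 | hu0
    · refine ⟨1, le_rfl, 1, one_pos, 0, ?_⟩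
      intro _ _ _ _ _ _ _ _ _ _ _ _ _ _ _ _ h
      rw [← hu0] at h
      exact absurd h (lt_irrefl _)
    · obtain ⟨hpt, hp0, hru⟩ := hgap hu0
      obtain ⟨K, hK, c, hc, n₁, h⟩ := W.exists_min_noiseBound_le T hM hκ1 hκ hp0
        (show 0 < M ^ p.toReal by positivity) hs0.le hu (by linarith) ht ha hD
      refine ⟨K, hK, c, hc, n₁, fun n hn I f hf hfs x Y ε hrun hY m hm hmn hnD hg _ =>
        h n hn f (W.controlled_of_mem hp hr hf.1 hfs) (fun j hj => ?_) I hf.2.2 x Y ε hrun hY m hm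
          hmn hnD hg⟩
      rw [← hru]
      exact W.sum_coeffβ_rpow_le hpt hp0 hf.1 j hj
  obtain ⟨Kc, hKc, cc, hcc, n₁, hcas⟩ := hcas
  obtain ⟨Ce, hCe, n₂, hest⟩ := W.exists_estimates T hM hκ1 hκ hD
  obtain ⟨Cd, hCd, hdecay⟩ := Detectable.exists_decay (L := L) (j₀ := j₀) ht hM hs0.le
  obtain ⟨Cb, hCb, herr⟩ := W.exists_error_bound
  obtain ⟨c₁, hc₁, c₃, -, n₃, hn₃, hjm⟩ := T.exists_jmax_bounds
  set R := Ce * (Ce + Cd + M + Kc) + 3 with hRdef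
  have hR0 : 0 ≤ Ce * (Ce + Cd + M + Kc) := by positivity
  have hR1 : 1 ≤ R := by linarith
  obtain ⟨Kl, hKl, hlevel⟩ := exists_level_sum (P := p.toReal) hs0 ht hu (fun h => (hgap h).2.1) hPu hR1
  have h1P : 0 < 1 - p.toReal * t * gapU r s := by linarith
  have hrP : 0 < rPrime r s t := by unfold rPrime; positivity
  have hsP : 0 < sPrime p r s t := by unfold sPrime; positivity
  obtain ⟨hα0, hαs, hα2⟩ := rateExp_bounds hs2 (lt_min hrP hsP)
  set α := rateExp (min (rPrime r s t) (sPrime p r s t)) with hα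
  -- An exponent strictly between `α` and `s`: the room `s - s₂` absorbs the factor `j + 1` of the
  -- decay, and `s₂ > α` makes the tail beyond `jc` of order at most `w^α`.
  set s₂ := (s + α) / 2 with hs₂
  obtain ⟨Gj, hGj, hgj⟩ := exists_add_one_le_two_rpow (show 0 < s - s₂ by linarith)
  obtain ⟨Gt, hGt, hgt⟩ := exists_sum_tail_le (show 0 < s₂ by linarith)
  set c := min cc (min (c₁ / 2) 1) with hc
  have hc0 : 0 < c := by positivity
  obtain ⟨n₄, hn₄⟩ := eventually_atTop.1 (eventually_log_pow_le.and
    ((tendsto_natCast_atTop_atTop (R := ℝ)).eventually_ge_atTop ((1 / c) ^ (2 : ℝ))))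
  have hKt : 0 < Ce * Cd * Gj * (Gt * (c⁻¹ ^ s₂)) := by positivity
  refine ⟨Cb * (Ce * Ce + (Kl + Ce * Cd * Gj * (Gt * (c⁻¹ ^ s₂)))), by positivity,
    max (max n₁ n₂) (max n₃ n₄), ?_⟩
  intro n hn I f hf hfs hedge x Y ε hrun hY m hm hmn hnD hgood z hz
  rw [max_le_iff, max_le_iff, max_le_iff] at hn
  obtain ⟨⟨hn1, hn2⟩, hn3, hn4⟩ := hn
  obtain ⟨⟨hl1, hl3⟩, hcn⟩ := hn₄ n hn4
  have hnpos : 0 < n := by omega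
  have hn0 : (0 : ℝ) < n := by exact_mod_cast hnpos
  have hl0 : 0 < Real.log n := by linarith
  set w := Real.log n ^ 3 / n with hw
  have hw0 : 0 < w := by positivity
  have hn1' : (1 : ℝ) ≤ n := by exact_mod_cast hnpos
  have hw1 : w ≤ 1 := (log_pow_div_le hnpos hl3).trans
    (Real.rpow_le_one_of_one_le_of_nonpos hn1' (by norm_num))
  have hlw : Real.log n / n ≤ w := by
    exact div_le_div_of_nonneg_right (log_le_log_pow hl1) hn0.le
  have hnl : 0 < (n : ℝ) / Real.log n := by positivity
  -- Writing `w = 2^{-y}` makes all level bounds exponentials of functions linear in `j` and `y`,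
  -- apart from the factor `j + 1`.
  set y := -Real.logb 2 w with hy
  have hwy : (2 : ℝ) ^ (-y) = w := by
    rw [hy, neg_neg, Real.rpow_logb (by norm_num) (by norm_num) hw0]
  have hy0 : 0 ≤ y := by
    rw [hy, Left.nonneg_neg_iff]
    exact Real.logb_nonpos (by norm_num) hw0.le hw1
  have hwα : (2 : ℝ) ^ (-(y * α)) = w ^ α := by
    rw [← hwy, ← Real.rpow_mul (by norm_num)]; congr 1; ring
  -- the rate
  set fac : ℝ := if rPrime r s t = sPrime p r s t then Real.log n else 1 with hfac
  have hfac1 : 1 ≤ fac := by rw [hfac]; split_ifs <;> linarith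
  have hrate : sensingRate p r s t n = w ^ α * fac := by
    unfold sensingRate
    rw [← hα, ← hfac, hw, Real.rpow_neg (by positivity), ← Real.inv_rpow (by positivity), inv_div]
  have hwα0 : 0 < w ^ α := by positivity
  have hrate1 : w ^ α ≤ w ^ α * fac := le_mul_of_one_le_right hwα0.le hfac1
  -- the last level at which the design is known to adapt
  obtain ⟨jc, hjc, hjc', hjcl⟩ := exists_level_near hc0
    ((min_le_right _ _).trans (min_le_right _ _)) hnpos hl1 hl3 hcn
  have hjcc : (2 : ℝ) ^ jc ≤ cc * (n / Real.log n) := hjc.trans (by gcongr; exact min_le_left _ _)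
  have hjmax : ∀ j, j ≤ jc → j < T.jmax n := by
    intro j hj
    have h2 : (2 : ℝ) ^ j < 2 ^ T.jmax n := by
      refine ((pow_le_pow_right₀ (by norm_num) hj).trans hjc).trans_lt
        (lt_of_lt_of_le ?_ (hjm n hn3).1)
      have : c ≤ c₁ / 2 := (min_le_right _ _).trans (min_le_left _ _)
      exact mul_lt_mul_of_pos_right (by linarith) hnl
    exact (pow_lt_pow_iff_right₀ (by norm_num)).1 h2
  obtain ⟨H, hH0, hHsum, hHX⟩ := hlevel y (Real.log n) jc hy0
    (hjcl.trans (mul_le_mul_of_nonneg_right (by linarith) hl0.le))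
  have hcon := W.controlled_of_mem hp hr hf.1 hfs
  have hest' := hest n hn2 f hcon x Y ε hrun hY (m - 1) n
    (by rw [show m - 1 + 1 = m by omega]; exact hmn) le_rfl
    (hnD.trans (by gcongr; exact T.size_strictMono.monotone (by omega)))
  obtain ⟨hnoise, hest'⟩ := hest'
  have hgood0 : W.NoiseGood T κ x ε n := by
    have := hgood 0 (by omega)
    rwa [Tuning.stageTime, if_pos rfl] at this
  obtain ⟨hestα, hestβ⟩ := hest' hgood0
  have hnoise' : ∀ j k, j < T.jmax n → k < 2 ^ j →
      noiseBound L T.σ x n j k ^ 2 ≤ Ce * w := fun j k hj hk =>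
    (hnoise j k hj hk).trans (by gcongr)
  have hdec := hdecay I (fun j k => |W.coeffβ f j k|) hf.2.2 (fun j k hj hk => by
    refine (hcon.coeffβ_le j k hj hk).trans (mul_le_of_le_one_right hM.le ?_)
    exact Real.rpow_le_one_of_one_le_of_nonpos (by norm_num) (by simp))
  set tail : ℕ → ℝ := fun j => if j ≤ jc then 0 else (2 : ℝ) ^ (-(s₂ * (j : ℝ))) with htail
  have htail0 : ∀ j, 0 ≤ tail j := fun j => by
    simp only [htail]; split_ifs <;> positivity
  have key := herr T x Y n f I (Ce * Ce * w ^ α)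
    (Kl * (w ^ α * fac) + Ce * Cd * Gj * (Gt * (c⁻¹ ^ s₂ * w ^ α)))
    (fun j => H j + Ce * Cd * Gj * tail j) hfs (by positivity)
    (fun j => add_nonneg (hH0 j) (mul_nonneg (by positivity) (htail0 j)))
    (fun k hk => ?_) (fun j k hj hk hne => ?_) (fun n' => ?_) z hz
  · refine key.trans ?_
    rw [hrate, mul_assoc Cb]
    refine mul_le_mul_of_nonneg_left ?_ hCb.le
    have h1 : Ce * Ce * w ^ α ≤ Ce * Ce * (w ^ α * fac) := by gcongr
    have h2 : Ce * Cd * Gj * (Gt * (c⁻¹ ^ s₂ * w ^ α)) ≤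
      Ce * Cd * Gj * (Gt * (c⁻¹ ^ s₂)) * (w ^ α * fac) := by
      calc _ = Ce * Cd * Gj * (Gt * (c⁻¹ ^ s₂)) * w ^ α := by ring
        _ ≤ _ := by gcongr
    linarith
  · refine (hestα k hk).trans ?_
    rw [mul_assoc]
    gcongr
    refine (abs_le_of_sq_le_sq' ((hnoise' j₀ k (T.lt_jmax n) hk).trans ?_) (by positivity)).2
    rw [mul_pow]
    have h1 : w ≤ (w ^ α) ^ 2 := by
      rw [← Real.rpow_natCast, ← Real.rpow_mul hw0.le]
      conv_lhs => rw [← Real.rpow_one w]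
      exact Real.rpow_le_rpow_of_exponent_ge hw0 hw1 (by push_cast; linarith)
    calc Ce * w ≤ Ce ^ 2 * w := by gcongr; nlinarith
      _ ≤ _ := by gcongr
  · rcases le_or_gt j jc with hjle | hjgt
    · rw [if_pos (hjmax j hjle)]
      have h0 : H j ≤ H j + Ce * Cd * Gj * tail j :=
        le_add_of_nonneg_right (mul_nonneg (by positivity) (htail0 j))
      refine le_trans ?_ h0
      have hb := (hestβ j k hj (hjmax j hjle) (hjmax j hjle) hk).1
      obtain ⟨b1, b2, b3, b4⟩ := level_error_bounds (r' := s + t * gapU r s) (P := p.toReal)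
        hCe hCd.le hKc hM.le hP0
        (abs_nonneg (W.coeffβ f j k)) (noiseBound_nonneg T.σ_pos.le x n j k)
        (show Ce * (Ce + Cd + M + Kc) ≤ R by linarith) j
        (by rw [hwy]; exact hnoise' j k (hjmax j hjle) hk) (hdec j k hj hk hne)
      have h1 : (2 : ℝ) ^ ((j : ℝ) / 2) * |W.betaThr T x Y n j k - W.coeffβ f j k| ≤
        (2 : ℝ) ^ ((j : ℝ) / 2) *
          (Ce * min |W.coeffβ f j k| (noiseBound L T.σ x n j k)) := by gcongr
      refine h1.trans (hHX j hjle _ b1 b2 (fun h => b3 (hedge h j k hj hk hne)) fun h => b4 ?_)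
      rw [hwy]
      exact hcas n hn1 I f hf hfs x Y ε hrun hY m hm hmn hnD hgood h jc hjcc j k hj hjle hk hne
    · have h0 : Ce * Cd * Gj * tail j ≤ H j + Ce * Cd * Gj * tail j :=
        le_add_of_nonneg_left (hH0 j)
      refine le_trans ?_ h0
      have hb : |(if j < T.jmax n then W.betaThr T x Y n j k else 0) - W.coeffβ f j k| ≤
          Ce * |W.coeffβ f j k| := by
        split_ifs with hjm'
        · refine (hestβ j k hj hjm' hjm' hk).1.trans ?_
          gcongr; exact min_le_left _ _
        · rw [zero_sub, abs_neg]
          exact le_mul_of_one_le_left (abs_nonneg _) hCe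
      rw [show tail j = (2 : ℝ) ^ (-(s₂ * (j : ℝ))) from if_neg (by omega)]
      calc _ ≤ (2 : ℝ) ^ ((j : ℝ) / 2) *
            (Ce * (Cd * (Gj * (2 : ℝ) ^ ((s - s₂) * (j : ℝ))) *
              (2 : ℝ) ^ (-((j : ℝ) * (s + 1 / 2))))) := by
            refine mul_le_mul_of_nonneg_left (hb.trans ?_) (by positivity)
            refine mul_le_mul_of_nonneg_left ((hdec j k hj hk hne).trans ?_) (by positivity)
            gcongr
            exact hgj j
        _ = Ce * Cd * Gj * ((2 : ℝ) ^ ((j : ℝ) / 2) * (2 : ℝ) ^ ((s - s₂) * (j : ℝ)) *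
              (2 : ℝ) ^ (-((j : ℝ) * (s + 1 / 2)))) := by ring
        _ = _ := by
            rw [← Real.rpow_add (by norm_num), ← Real.rpow_add (by norm_num)]
            congr 2; ring
  · rw [Finset.sum_add_distrib, ← Finset.mul_sum]
    have h1 := hHsum n'
    change _ ≤ Kl * ((2 : ℝ) ^ (-(y * α)) * fac) at h1
    rw [hwα] at h1
    have h2 := hgt jc n'
    have h3 : ((2 : ℝ) ^ (jc + 1))⁻¹ ^ s₂ ≤ c⁻¹ ^ s₂ * w ^ α := by
      calc ((2 : ℝ) ^ (jc + 1))⁻¹ ^ s₂ ≤ (c⁻¹ * w) ^ s₂ := by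
            refine Real.rpow_le_rpow (by positivity) ?_ (by linarith)
            refine (inv_anti₀ (by positivity) hjc'.le).trans ?_
            rw [mul_inv, inv_div]
            gcongr
        _ = c⁻¹ ^ s₂ * w ^ s₂ := Real.mul_rpow (by positivity) hw0.le
        _ ≤ _ := by
            gcongr ?_ * ?_
            exact Real.rpow_le_rpow_of_exponent_ge hw0 hw1 (by linarith)
    refine add_le_add h1 (mul_le_mul_of_nonneg_left (h2.trans ?_) (by positivity))
    gcongr

theorem Tuning.exists_size_add_le {j₀ : ℕ} (T : Tuning j₀) :
    ∃ D : ℝ, 1 ≤ D ∧ ∀ m i, (T.size (m + i) : ℝ) ≤ D ^ i * T.size m := by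
  obtain ⟨C, D, hC, h⟩ := T.size_ratio
  refine ⟨max D 1, le_max_right _ _, fun m i => ?_⟩
  induction i with
  | zero => simp
  | succ i ih =>
    calc (T.size (m + (i + 1)) : ℝ) ≤ D * T.size (m + i) := (h (m + i)).2
      _ ≤ max D 1 * (max D 1 ^ i * T.size m) := by
          gcongr
          exact le_max_left _ _
      _ = _ := by ring

end

/-! ### The main theorem: union bound over the last stages. -/

theorem theorem5 {j₀ N L : ℕ} (W : WaveletBasis j₀ N L) (T : Tuning j₀)
    (p : ℝ≥0∞) (hp : 1 ≤ p) (r s t M : ℝ)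
    (hr : 1 / 2 + p⁻¹.toReal ≤ r) (hrN : r < N)
    (hs : r - p⁻¹.toReal ≤ s) (hsN : s < N)
    (ht : 0 < t) (ht1 : t < 1) (hM : 0 < M)
    (I : Set ℝ) (hI : I.OrdConnected) (hI01 : I ⊆ Icc 0 1) :
    ∀ η : ℝ, 0 < η → ∃ K : ℝ, 0 < K ∧ ∃ n₁ : ℕ, ∀ n : ℕ, n₁ ≤ n →
      ∀ f ∈ W.sparseDetectable p r s t M I, W.IsSumOfSeries f →
        (sPrime p r s t < rPrime r s t → W.EdgeBound s M I f) →
        ∀ (Ω : Type*) [mΩ : MeasurableSpace Ω] (μ : Measure Ω) [IsProbabilityMeasure μ]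
          (ε x Y : ℕ → Ω → ℝ) (ℱ : Filtration ℕ mΩ),
          SensingExperiment W T f μ ε x Y ℱ →
          μ {ω | ¬ ∀ z ∈ I ∩ Ico 0 1,
              |W.estimator T (fun i => x i ω) (fun i => Y i ω) n z - f z| ≤
                K * sensingRate p r s t n} ≤ ENNReal.ofReal η := by
  intro η hη
  have hκ := T.one_lt_κ
  -- The midpoint of `1` and `T.κ` exceeds `1`, so that the noise event has small complement, and
  -- stays below `T.κ`, so that thresholding works.
  obtain ⟨a, hpath⟩ := W.exists_path_bound T (κ := (1 + T.κ) / 2) (by linarith) (by linarith) hp hr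
    hs ht ht1 hM
  obtain ⟨D, hD, hsize⟩ := T.exists_size_add_le
  -- For `T.size m ≤ n < T.size (m + 1)`, the earliest stage used is `m - (2 a + 2)`, which is `2 a
  -- + 3` stage ratios before `m + 1`.
  have hD1 : 1 ≤ D ^ (2 * a + 3) := one_le_pow₀ hD
  obtain ⟨K, hK, n₁, hpath⟩ := hpath (D ^ (2 * a + 3)) hD1
  obtain ⟨n₂, hnoise⟩ := W.exists_measure_not_noiseGood_le T (κ := (1 + T.κ) / 2) (by linarith)
    (show 0 < η / (2 * a + 1) by positivity)
  refine ⟨K, hK, max n₁ (max (T.size (2 * a + 2)) ⌈D ^ (2 * a + 3) * n₂⌉₊), ?_⟩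
  intro n hn f hf hfs hedge Ω mΩ μ hμ ε x Y ℱ hexp
  rw [max_le_iff, max_le_iff] at hn
  obtain ⟨hn1, hna, hnD⟩ := hn
  obtain ⟨m, hmn, hnm⟩ :=
    T.exists_stage ((T.size_strictMono.monotone (Nat.zero_le (2 * a + 2))).trans hna)
  have ham : 2 * a + 2 ≤ m := Nat.lt_succ_iff.1 (T.size_strictMono.lt_iff_lt.1 (hna.trans_lt hnm))
  have hnm' : (n : ℝ) ≤ D ^ (2 * a + 3) * T.size (m - (2 * a + 2)) := by
    have h1 := hsize (m - (2 * a + 2)) (2 * a + 3)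
    rw [show m - (2 * a + 2) + (2 * a + 3) = m + 1 by omega] at h1
    exact le_trans (by exact_mod_cast hnm.le) h1
  have htime : ∀ i ≤ 2 * a, n₂ ≤ T.stageTime n m i := by
    intro i hi
    have h1 : D ^ (2 * a + 3) * (n₂ : ℝ) ≤ D ^ (2 * a + 3) * T.size (m - (2 * a + 2)) :=
      (Nat.ceil_le.1 hnD).trans hnm'
    have h2 : n₂ ≤ T.size (m - (2 * a + 2)) := by
      exact_mod_cast le_of_mul_le_mul_left h1 (by linarith)
    exact h2.trans ((T.size_strictMono.monotone (by omega)).trans (T.size_le_stageTime hmn i))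
  calc μ {ω | ¬ ∀ z ∈ I ∩ Ico 0 1, |W.estimator T (fun i => x i ω) (fun i => Y i ω) n z - f z| ≤
          K * sensingRate p r s t n}
      ≤ μ (⋃ i ∈ Finset.range (2 * a + 1), {ω | ¬ W.NoiseGood T ((1 + T.κ) / 2)
          (fun i => x i ω) (fun i => ε i ω) (T.stageTime n m i)}) := by
        refine measure_mono fun ω hω => ?_
        by_contra hgood
        simp only [mem_iUnion, mem_ofPred_eq, Finset.mem_range, exists_prop, not_exists, not_and,
          not_not] at hgood
        exact hω (hpath n hn1 I f hf hfs hedge _ _ (fun i => ε i ω) (hexp.run ω)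
          (fun i => hexp.observation i ω) m ham hmn hnm' fun i hi => hgood i (by omega))
    _ ≤ ∑ i ∈ Finset.range (2 * a + 1), μ {ω | ¬ W.NoiseGood T ((1 + T.κ) / 2)
          (fun i => x i ω) (fun i => ε i ω) (T.stageTime n m i)} := measure_biUnion_finset_le _ _
    _ ≤ ∑ _i ∈ Finset.range (2 * a + 1), ENNReal.ofReal (η / (2 * a + 1)) :=
        Finset.sum_le_sum fun i hi => hnoise _ (htime i (by
          have := Finset.mem_range.1 hi
          omega)) f Ω μ ε x Y ℱ hexp
    _ = ENNReal.ofReal η := by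
        rw [← ENNReal.ofReal_sum_of_nonneg fun _ _ => by positivity, Finset.sum_const,
          Finset.card_range, nsmul_eq_mul]
        congr 1
        push_cast
        field_simp
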